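/- **Conventions.** Let $E$ be a Fréchet space over $\mathbb C$ and $\Omega\subseteq\mathbb R^q$ open. For $W\subseteq\mathbb C$ open, $\mathcal A(W,E)$ is the space of holomorphic $E$-valued functions on $W$ with uniform convergence on compact sets. For $U\subseteq\mathbb R^q$ open and $F$ a Fréchet space, $C^\infty(U,F)$ carries the topology of uniform convergence of all derivatives on compact sets. $\mathcal U(\Omega)$ is the system of all open $U$ with $\overline U$ compact and contained in $\Omega$. **Asymptotic types.** A variable discrete Mellin asymptotic type over $\Omega$ is a family $\mathcal R=(\mathcal R(y))_{y\in\Omega}$ of sets $\mathcal R(y)=\{(p_j(y),l_j(y))\}_j\subset\mathbb C\times\mathbb N$ such that for all $c<c'$ and $U\in\mathcal U(\Omega)$ there are finitely many $U_0,\dots,U_N\in\mathcal U(\Omega)$ covering $\overline U$, numbers $\varepsilon_i>0$ and compact sets $K_i\subset S_i:=\{c-\varepsilon_i<\mathrm{Re}\,z<c'+\varepsilon_i\}$ such that, for every $i$, $\pi_{\mathbb C}\mathcal R(y)\cap S_i\subset K_i$ for all $y\in U_i$, and $\sup_{y\in U_i}\sum_{p_j(y)\in K_i}(1+l_j(y))<\infty$.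 Here $\pi_{\mathbb C}\mathcal R(y)=\{p_j(y)\}_j$. We write $b$ for a triple $(c,c',U)$ together with any such choice of $U_i,K_i,\varepsilon_i$, and put $S_b:=\{c<\mathrm{Re}\,z<c'\}$, $K_b:=\bigcup_iK_i$. **Families.** For $U\in\mathcal U(\Omega)$ and $K\subset\mathbb C$ compact, $C^\infty(U,\mathcal A(\mathbb C\setminus K,E))^\bullet$ is the space of all $g\in C^\infty(U,\mathcal A(\mathbb C\setminus K,E))$ such that every $g(y,\cdot)$ extends to a meromorphic function on $\mathbb C$ with finitely many poles, all in $K$, the sum of their multiplicities being bounded uniformly in $y\in U$. Let $C^\infty(U,\mathcal A'(K,E))^\bullet$ be the space of the families of analytic functionals $\delta_g(y):h\mapsto\frac1{2\pi i}\int_C g(y,z)h(z)\,dz$, $h\in\mathcal A(\mathbb C)$, for such $g$, with $C$ a contour surrounding $K$ counter-clockwise. A family $f(y,\cdot)$, $y\in\Omega$, of $E$-valued meromorphic functions is subordinate to $\mathcal R$ if every pole of $f(y,\cdot)$ is some $p_j(y)$ and has multiplicity at most $l_j(y)+1$. The space $C^\infty(\Omega,\mathcal M_{\mathcal R}(E))$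 consists of all families subordinate to $\mathcal R$ that are smooth in $y$, i.e. for all $b$ and $i$ as above * $f|_{U_i\times(S_i\setminus K_i)}\in C^\infty(U_i,\mathcal A(S_i\setminus K_i,E))$, and * the family $\delta_i(y):h\mapsto\frac1{2\pi i}\int_{C_i}f(y,z)h(z)\,dz$, $y\in U_i$, belongs to $C^\infty(U_i,\mathcal A'(K_i,E))^\bullet$, with $C_i\subset S_i$ a contour surrounding $K_i$ counter-clockwise. **Proposition.** Let $\mathcal R$ be a variable discrete Mellin asymptotic type over $\Omega$. 1. For every $b$, let $C^\infty(U,\mathcal A_{\mathcal R}(\mathbb C\setminus K_b,E))^\bullet$ be the space of all $g\in C^\infty(U,\mathcal A(\mathbb C\setminus K_b,E))^\bullet$ such that every $g(y,\cdot)$, $y\in U$, is subordinate to $\{(p,l)\in\mathcal R(y):p\in K_b\}$. It is a closed subspace of $C^\infty(U,\mathcal A(\mathbb C\setminus K_b,E))$; it and $C^\infty(U,\mathcal A(S_b,E))$ are Fréchet spaces. The non-direct sum $$V_b:=C^\infty(U,\mathcal A(S_b,E))+C^\infty(U,\mathcal A_{\mathcal R}(\mathbb C\setminus K_b,E))^\bullet$$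 (as a space of functions on $U\times(S_b\setminus K_b)$), with the quotient topology under $(h,g)\mapsto h+g$, is a Fréchet space. 2. For every $b$ and every $f\in C^\infty(\Omega,\mathcal M_{\mathcal R}(E))$ the restriction of $f$ to $U\times(S_b\setminus K_b)$ belongs to $V_b$. 3. $C^\infty(\Omega,\mathcal M_{\mathcal R}(E))$ is a Fréchet space in the initial topology with respect to the restriction maps to all the $V_b$. 4. There are sequences $b_n=(c_n,c_n',U_n;\dots)$ that are exhausting, i.e. for all $c<c'$ and $U\in\mathcal U(\Omega)$ there is an $n$ with $c_n\le c$, $c'\le c_n'$, $U\subseteq U_n$. For every exhausting sequence, and every choice of the associated sets, $C^\infty(\Omega,\mathcal M_{\mathcal R}(E))$ is the intersection of the spaces $V_{b_n}$: a family $f(y,\cdot)\in\mathcal A(\mathbb C\setminus\pi_{\mathbb C}\mathcal R(y),E)$, $y\in\Omega$, belongs to it if and only if its restriction to $U_n\times(S_{b_n}\setminus K_{b_n})$ lies in $V_{b_n}$ for every $n$. The topology of 3. is the initial topology with respect to the restrictions to the countably many $V_{b_n}$ alone. -/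

import Mathlib

open Filter Topology Set

set_option linter.unusedSectionVars false

/-- A Fréchet space over `ℂ`: a Hausdorff, locally convex, metrizable (that is, first countable)
and complete topological vector space. -/
class FrechetSpace (V : Type*) [AddCommGroup V] [Module ℂ V] [TopologicalSpace V] : Prop extends
    IsTopologicalAddGroup V, ContinuousSMul ℂ V, LocallyConvexSpace ℝ V, T2Space V,
    FirstCountableTopology V where
  complete : @CompleteSpace V (IsTopologicalAddGroup.rightUniformSpace V)

namespace Mellin

section Spaces

variable {F : Type*} [AddCommGroup F] [Module ℂ F] [TopologicalSpace F]

/-- `u : W → F` is complex differentiable at every point of `W ⊆ ℂ`. -/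
def IsHolomorphic {W : Set ℂ} (u : W → F) : Prop :=
  ∀ z : W, ∃ e : F,
    Tendsto (fun w : W => ((w : ℂ) - (z : ℂ))⁻¹ • (u w - u z)) (𝓝[≠] z) (𝓝 e)

/-- `v` is the `i`-th partial derivative of `u : U → F` on the set `U ⊆ ℝ^q`. -/
def HasPartialDeriv {q : ℕ} {U : Set (EuclideanSpace ℝ (Fin q))} (i : Fin q) (u v : U → F) :
    Prop :=
  ∀ y : U, Tendsto
    (fun t : {t : ℝ // (y : EuclideanSpace ℝ (Fin q)) + t • EuclideanSpace.single i (1 : ℝ) ∈ U} =>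
      (((t : ℝ) : ℂ))⁻¹ • (u ⟨_, t.2⟩ - u y))
    (comap Subtype.val (𝓝[≠] (0 : ℝ))) (𝓝 (v y))

variable [IsTopologicalAddGroup F] [ContinuousConstSMul ℂ F]

variable (F) in
/-- The space `𝒜(W, F)` of holomorphic `F`-valued functions on the open set `W ⊆ ℂ`, with the
topology of uniform convergence on compact subsets of `W` (the compact-open topology). -/
def Hol (W : Set ℂ) : Submodule ℂ C(W, F) where
  carrier := {u | IsHolomorphic u}
  zero_mem' := fun z => ⟨0, by simpa using tendsto_const_nhds⟩
  add_mem' := by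
    intro u v hu hv z
    obtain ⟨a, ha⟩ := hu z
    obtain ⟨b, hb⟩ := hv z
    refine ⟨a + b, (ha.add hb).congr fun w => ?_⟩
    rw [← smul_add]; simp only [ContinuousMap.add_apply]; congr 1; abel
  smul_mem' := by
    intro k u hu z
    obtain ⟨a, ha⟩ := hu z
    refine ⟨k • a, (ha.const_smul k).congr fun w => ?_⟩
    simp only [ContinuousMap.smul_apply]; rw [smul_comm, smul_sub]

-- Shortcut instances: the structure of a subspace.
noncomputable instance (W : Set ℂ) : AddCommGroup (Hol F W) := Submodule.addCommGroup _
noncomputable instance (W : Set ℂ) : Module ℂ (Hol F W) := Submodule.module _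
noncomputable instance (W : Set ℂ) : TopologicalSpace (Hol F W) := instTopologicalSpaceSubtype
instance (W : Set ℂ) : IsTopologicalAddGroup (Hol F W) := Submodule.topologicalAddGroup _

variable (F) in
/-- The space `C^∞(U, F)` for an open set `U ⊆ ℝ^q`. A smooth function `u` is recorded together
with all its iterated partial derivatives: `D [] = u`, and `D (i :: α)` is the `i`-th partial
derivative of `D α`; all of them are continuous, and they are determined by `u`. The topology is
that of uniform convergence of all derivatives on compact subsets of `U`. -/
def CInf {q : ℕ} (U : Set (EuclideanSpace ℝ (Fin q))) :
    Submodule ℂ (List (Fin q) → C(U, F)) where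
  carrier := {D | ∀ α i, HasPartialDeriv i (D α) (D (i :: α))}
  zero_mem' := fun α i y => by simpa using tendsto_const_nhds
  add_mem' := by
    intro u v hu hv α i y
    refine ((hu α i y).add (hv α i y)).congr fun w => ?_
    rw [← smul_add]; simp only [Pi.add_apply, ContinuousMap.add_apply]; congr 1; abel
  smul_mem' := by
    intro k u hu α i y
    refine ((hu α i y).const_smul k).congr fun w => ?_
    simp only [Pi.smul_apply, ContinuousMap.smul_apply]; rw [smul_comm, smul_sub]

noncomputable instance {q : ℕ} (U : Set (EuclideanSpace ℝ (Fin q))) : AddCommGroup (CInf F U) := Submodule.addCommGroup _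
noncomputable instance {q : ℕ} (U : Set (EuclideanSpace ℝ (Fin q))) : Module ℂ (CInf F U) := Submodule.module _
noncomputable instance {q : ℕ} (U : Set (EuclideanSpace ℝ (Fin q))) : TopologicalSpace (CInf F U) := instTopologicalSpaceSubtype

/-- The value at `y` of an element of `C^∞(U, F)`. -/
def ev {q : ℕ} {U : Set (EuclideanSpace ℝ (Fin q))} (u : CInf F U) (y : U) : F :=
  u.1 [] y

end Spaces

variable {E : Type*} [AddCommGroup E] [Module ℂ E] [TopologicalSpace E]
  [IsTopologicalAddGroup E] [ContinuousSMul ℂ E]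

section Meromorphic

/-- `f` has at `p` at most a pole of multiplicity `m`: the function `(z - p)^m f(z)` extends
holomorphically across `p`. (Used for `f` holomorphic in a punctured neighbourhood of `p`.) -/
def PoleOrderLE {W : Set ℂ} (f : Hol E W) (p : ℂ) (m : ℕ) : Prop :=
  ∃ V : Set ℂ, IsOpen V ∧ p ∈ V ∧ ∃ G : Hol E V,
    ∀ (z : ℂ) (hV : z ∈ V) (hW : z ∈ W), z ≠ p → G.1 ⟨z, hV⟩ = (z - p) ^ m • f.1 ⟨z, hW⟩

/-- The projection to `ℂ` of a set of pairs `(p, l)` in `ℂ × ℕ`. -/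
def proj (A : Set (ℂ × ℕ)) : Set ℂ := Prod.fst '' A

/-- The subset of all pairs `(p, l)` of `A` with `p ∈ K`. -/
def restr (K : Set ℂ) (A : Set (ℂ × ℕ)) : Set (ℂ × ℕ) := {x ∈ A | x.1 ∈ K}

/-- A meromorphic function whose poles lie in the (closed, discrete) projection of `A`, given as a
holomorphic function off that set, is subordinate to `A`: for each `p` in the projection there is
a pair `(p, l) ∈ A` such that `p` is at most a pole of multiplicity `l + 1`. -/
def Subordinate (A : Set (ℂ × ℕ)) (f : Hol E (proj A)ᶜ) : Prop :=
  ∀ p ∈ proj A, ∃ l : ℕ, (p, l) ∈ A ∧ PoleOrderLE f p (l + 1)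

/-- `g`, holomorphic on `ℂ \ K`, extends to a meromorphic function on `ℂ` that is subordinate
to `A`. -/
def ExtendsSubordinate {K : Set ℂ} (A : Set (ℂ × ℕ)) (g : Hol E Kᶜ) : Prop :=
  ∃ f : Hol E (proj A)ᶜ, Subordinate A f ∧
    ∀ (z : ℂ) (hK : z ∈ Kᶜ) (hA : z ∈ (proj A)ᶜ), g.1 ⟨z, hK⟩ = f.1 ⟨z, hA⟩

lemma IsHolomorphic.comp_inclusion {V W : Set ℂ} (h : V ⊆ W) {u : W → E}
    (hu : IsHolomorphic u) : IsHolomorphic (fun z : V => u (Set.inclusion h z)) := by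
  intro z
  obtain ⟨e, he⟩ := hu (Set.inclusion h z)
  refine ⟨e, he.comp (f := Set.inclusion h) ?_⟩
  refine tendsto_nhdsWithin_iff.2
    ⟨(continuous_inclusion h).continuousAt.mono_left nhdsWithin_le_nhds, ?_⟩
  filter_upwards [self_mem_nhdsWithin] with w hw hw'
  exact hw (Set.inclusion_injective h hw')

/-- Restriction of holomorphic functions to a smaller set. -/
noncomputable def Hol.res {V W : Set ℂ} (h : V ⊆ W) (f : Hol E W) : Hol E V :=
  ⟨f.1.comp ⟨Set.inclusion h, continuous_inclusion h⟩, IsHolomorphic.comp_inclusion h f.2⟩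

lemma Hol.exists_mul {W : Set ℂ} (f : Hol E W) (p : ℂ) :
    ∃ g : Hol E W, ∀ z : W, g.1 z = ((z : ℂ) - p) • f.1 z := by
  have hc : Continuous fun z : W => ((z : ℂ) - p) • f.1 z :=
    (continuous_subtype_val.sub continuous_const).smul f.1.continuous
  refine ⟨⟨⟨_, hc⟩, fun z => ?_⟩, fun z => rfl⟩
  obtain ⟨e, he⟩ := f.2 z
  have h1 : Tendsto (fun w : W => f.1 w) (𝓝[≠] z) (𝓝 (f.1 z)) :=
    f.1.continuous.continuousAt.mono_left nhdsWithin_le_nhds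
  refine ⟨f.1 z + ((z : ℂ) - p) • e, (h1.add (he.const_smul ((z : ℂ) - p))).congr' ?_⟩
  filter_upwards [self_mem_nhdsWithin] with w hw
  have hne : (w : ℂ) - z ≠ 0 := fun h => hw (Subtype.ext (sub_eq_zero.1 h))
  have : ((w : ℂ) - p) • f.1 w - ((z : ℂ) - p) • f.1 z
      = ((w : ℂ) - z) • f.1 w + ((z : ℂ) - p) • (f.1 w - f.1 z) := by module
  simp only [ContinuousMap.coe_mk]
  rw [this, smul_add, inv_smul_smul₀ hne, smul_comm]

lemma Hol.exists_pow {W : Set ℂ} (f : Hol E W) (p : ℂ) (m : ℕ) :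
    ∃ g : Hol E W, ∀ z : W, g.1 z = ((z : ℂ) - p) ^ m • f.1 z := by
  induction m with
  | zero => exact ⟨f, by simp⟩
  | succ m ih =>
    obtain ⟨g, hg⟩ := ih
    obtain ⟨k, hk⟩ := Hol.exists_mul g p
    exact ⟨k, fun z => by rw [hk, hg, smul_smul, pow_succ']⟩

lemma PoleOrderLE.mono {W : Set ℂ} {f : Hol E W} {p : ℂ} {m n : ℕ} (hf : PoleOrderLE f p m)
    (h : m ≤ n) : PoleOrderLE f p n := by
  obtain ⟨V, hV, hp, G, hG⟩ := hf
  obtain ⟨k, rfl⟩ := Nat.exists_eq_add_of_le h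
  obtain ⟨G', hG'⟩ := Hol.exists_pow G p k
  exact ⟨V, hV, hp, G', fun z hz hW hzp => by
    rw [hG', hG z hz hW hzp, smul_smul, pow_add, mul_comm]⟩

lemma PoleOrderLE.add {W : Set ℂ} {f g : Hol E W} {p : ℂ} {m : ℕ} (hf : PoleOrderLE f p m)
    (hg : PoleOrderLE g p m) : PoleOrderLE (f + g) p m := by
  obtain ⟨V, hV, hp, F, hF⟩ := hf
  obtain ⟨T, hT, hq, G, hG⟩ := hg
  refine ⟨V ∩ T, hV.inter hT, ⟨hp, hq⟩,
    Hol.res inter_subset_left F + Hol.res inter_subset_right G, fun z hz hW hzp => ?_⟩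
  have h1 := hF z hz.1 hW hzp
  have h2 := hG z hz.2 hW hzp
  change F.1 ⟨z, hz.1⟩ + G.1 ⟨z, hz.2⟩ = _ • (f.1 _ + g.1 _)
  rw [h1, h2, smul_add]

lemma PoleOrderLE.smul {W : Set ℂ} {f : Hol E W} {p : ℂ} {m : ℕ} (k : ℂ)
    (hf : PoleOrderLE f p m) : PoleOrderLE (k • f) p m := by
  obtain ⟨V, hV, hp, F, hF⟩ := hf
  refine ⟨V, hV, hp, k • F, fun z hz hW hzp => ?_⟩
  change k • F.1 _ = _ • (k • f.1 _)
  rw [hF z hz hW hzp, smul_comm]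

lemma Subordinate.zero (A : Set (ℂ × ℕ)) : Subordinate A (0 : Hol E (proj A)ᶜ) := by
  rintro p ⟨⟨p, l⟩, hl, rfl⟩
  refine ⟨l, hl, univ, isOpen_univ, mem_univ _, 0, fun z _ hW _ => ?_⟩
  change (0 : E) = _ • (0 : E)
  rw [smul_zero]

lemma Subordinate.add {A : Set (ℂ × ℕ)} {f g : Hol E (proj A)ᶜ} (hf : Subordinate A f)
    (hg : Subordinate A g) : Subordinate A (f + g) := by
  intro p hp
  obtain ⟨l, hl, hfl⟩ := hf p hp
  obtain ⟨k, hk, hgk⟩ := hg p hp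
  rcases le_total l k with h | h
  · exact ⟨k, hk, (hfl.mono (by omega)).add hgk⟩
  · exact ⟨l, hl, hfl.add (hgk.mono (by omega))⟩

lemma Subordinate.smul {A : Set (ℂ × ℕ)} {f : Hol E (proj A)ᶜ} (k : ℂ) (hf : Subordinate A f) :
    Subordinate A (k • f) := fun p hp => by
  obtain ⟨l, hl, hfl⟩ := hf p hp
  exact ⟨l, hl, hfl.smul k⟩

lemma ExtendsSubordinate.zero {K : Set ℂ} (A : Set (ℂ × ℕ)) :
    ExtendsSubordinate A (0 : Hol E Kᶜ) :=
  ⟨0, Subordinate.zero A, fun _ _ _ => rfl⟩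

lemma ExtendsSubordinate.add {K : Set ℂ} {A : Set (ℂ × ℕ)} {f g : Hol E Kᶜ}
    (hf : ExtendsSubordinate A f) (hg : ExtendsSubordinate A g) :
    ExtendsSubordinate A (f + g) := by
  obtain ⟨f', h1, h2⟩ := hf
  obtain ⟨g', h3, h4⟩ := hg
  exact ⟨f' + g', h1.add h3, fun z hK hA => congrArg₂ (· + ·) (h2 z hK hA) (h4 z hK hA)⟩

lemma ExtendsSubordinate.smul {K : Set ℂ} {A : Set (ℂ × ℕ)} {f : Hol E Kᶜ} (k : ℂ)
    (hf : ExtendsSubordinate A f) : ExtendsSubordinate A (k • f) := by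
  obtain ⟨f', h1, h2⟩ := hf
  exact ⟨k • f', h1.smul k, fun z hK hA => congrArg (k • ·) (h2 z hK hA)⟩

lemma ExtendsSubordinate.mono {K : Set ℂ} {A B : Set (ℂ × ℕ)} {f : Hol E Kᶜ} (hA : A.Finite)
    (h : A ⊆ B) (hf : ExtendsSubordinate A f) : ExtendsSubordinate B f := by
  obtain ⟨f', h1, h2⟩ := hf
  have hAB : proj A ⊆ proj B := image_mono h
  refine ⟨Hol.res (compl_subset_compl.2 hAB) f', fun p hp => ?_,
    fun z hK hB => h2 z hK (fun hz => hB (hAB hz))⟩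
  by_cases hpA : p ∈ proj A
  · obtain ⟨l, hl, V, hV, hpV, G, hG⟩ := h1 p hpA
    exact ⟨l, h hl, V, hV, hpV, G, fun z hz hW hzp => hG z hz (fun hz' => hW (hAB hz')) hzp⟩
  · obtain ⟨⟨p, l⟩, hl, rfl⟩ := hp
    obtain ⟨G, hG⟩ := Hol.exists_pow f' p (l + 1)
    exact ⟨l, hl, (proj A)ᶜ, (hA.image _).isClosed.isOpen_compl, hpA, G,
      fun z hz hW _ => hG ⟨z, hz⟩⟩

end Meromorphic

section Bullet

variable {q : ℕ}

variable (E) in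
/-- The space `C^∞(U, 𝒜(ℂ \ K, E))^•` of all smooth families `g(y, z)`, `y ∈ U`, of holomorphic
functions on `ℂ \ K` that have, for every `y ∈ U`, a meromorphic extension to `ℂ` with finitely
many poles, all of them in `K`, where the sum of all multiplicities is bounded by a constant that
does not depend on `y`. -/
noncomputable def bullet (U : Set (EuclideanSpace ℝ (Fin q))) (K : Set ℂ) :
    Submodule ℂ (CInf (Hol E Kᶜ) U) where
  carrier := {g | ∃ M : ℕ, ∀ y : U, ∃ A : Finset (ℂ × ℕ), proj A ⊆ K ∧
    ∑ x ∈ A, (1 + x.2) ≤ M ∧ ExtendsSubordinate A (ev g y)}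
  zero_mem' := ⟨0, fun y => ⟨∅, by simp [proj], by simp, ExtendsSubordinate.zero _⟩⟩
  add_mem' := by
    classical
    rintro f g ⟨M, hM⟩ ⟨N, hN⟩
    refine ⟨M + N, fun y => ?_⟩
    obtain ⟨A, hA, hAM, hfA⟩ := hM y
    obtain ⟨B, hB, hBN, hgB⟩ := hN y
    refine ⟨A ∪ B, ?_, ?_, ?_⟩
    · rw [Finset.coe_union, proj, image_union]
      exact union_subset hA hB
    · have := Finset.sum_union_inter (s₁ := A) (s₂ := B) (f := fun x : ℂ × ℕ => 1 + x.2)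
      omega
    · have h1 := hfA.mono A.finite_toSet (B := ↑(A ∪ B)) (by simp)
      have h2 := hgB.mono B.finite_toSet (B := ↑(A ∪ B)) (by simp)
      exact h1.add h2
  smul_mem' := by
    rintro k f ⟨M, hM⟩
    refine ⟨M, fun y => ?_⟩
    obtain ⟨A, hA, hAM, hfA⟩ := hM y
    exact ⟨A, hA, hAM, hfA.smul k⟩

/-- Extension of a function on a subset of `ℂ` by zero. -/
noncomputable def extZero {W : Set ℂ} (f : W → E) : ℂ → E := Function.extend Subtype.val f 0

/-- The integral of `f` along the boundary of the rectangle with lower left corner `a` and upper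
right corner `b`, in counter-clockwise orientation, with respect to `(2πi)⁻¹ dz`. -/
noncomputable def rectIntegral (a b : ℂ) (f : ℂ → ℂ) : ℂ :=
  (2 * Real.pi * Complex.I)⁻¹ *
    ((∫ x : ℝ in a.re..b.re, f (x + a.im * Complex.I)) -
      (∫ x : ℝ in a.re..b.re, f (x + b.im * Complex.I)) +
      Complex.I * (∫ t : ℝ in a.im..b.im, f (b.re + t * Complex.I)) -
      Complex.I * (∫ t : ℝ in a.im..b.im, f (a.re + t * Complex.I)))

/-- Integrability of `f` along the four sides of the rectangle with corners `a`, `b`. -/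
def RectIntegrable (a b : ℂ) (f : ℂ → ℂ) : Prop :=
  IntervalIntegrable (fun x : ℝ => f (x + a.im * Complex.I)) MeasureTheory.volume a.re b.re ∧
  IntervalIntegrable (fun x : ℝ => f (x + b.im * Complex.I)) MeasureTheory.volume a.re b.re ∧
  IntervalIntegrable (fun t : ℝ => f (b.re + t * Complex.I)) MeasureTheory.volume a.im b.im ∧
  IntervalIntegrable (fun t : ℝ => f (a.re + t * Complex.I)) MeasureTheory.volume a.im b.im

/-- `e` is the (Pettis) integral of the `E`-valued function `u` along the boundary of the rectangle
with corners `a`, `b`, with respect to `(2πi)⁻¹ dz`. -/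
def IsRectIntegral (a b : ℂ) (u : ℂ → E) (e : E) : Prop :=
  ∀ φ : E →L[ℂ] ℂ, RectIntegrable a b (fun z => φ (u z)) ∧
    rectIntegral a b (fun z => φ (u z)) = φ e

/-- The `E`-valued analytic functional `ζ` on `𝒜(ℂ)` is given by
`h ↦ ∫ f(z) h(z) (2πi)⁻¹ dz`, the integral being taken counter-clockwise along the boundary of the
rectangle with corners `a`, `b`. -/
def Represents {W : Set ℂ} (a b : ℂ) (f : Hol E W) (ζ : Hol ℂ univ →L[ℂ] E) : Prop :=
  ∀ h : Hol ℂ univ,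
    IsRectIntegral a b (fun z => h.1 ⟨z, mem_univ z⟩ • extZero f.1 z) (ζ h)

/-- The boundary of the rectangle with corners `a`, `b` is a contour surrounding `K`. -/
def Surrounds (a b : ℂ) (K : Set ℂ) : Prop :=
  a.re < b.re ∧ a.im < b.im ∧ K ⊆ Ioo a.re b.re ×ℂ Ioo a.im b.im

lemma extZero_apply {W : Set ℂ} (f : W → E) (z : ℂ) [Decidable (z ∈ W)] :
    extZero f z = if h : z ∈ W then f ⟨z, h⟩ else 0 := by
  split_ifs with h
  · exact Subtype.val_injective.extend_apply f 0 ⟨z, h⟩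
  · exact Function.extend_apply' _ _ _ (by rintro ⟨a, rfl⟩; exact h a.2)

lemma IsRectIntegral.add {a b : ℂ} {u v : ℂ → E} {e d : E} (hu : IsRectIntegral a b u e)
    (hv : IsRectIntegral a b v d) : IsRectIntegral a b (fun z => u z + v z) (e + d) := by
  intro φ
  obtain ⟨⟨u1, u2, u3, u4⟩, hu⟩ := hu φ
  obtain ⟨⟨v1, v2, v3, v4⟩, hv⟩ := hv φ
  simp only [map_add]
  refine ⟨⟨u1.add v1, u2.add v2, u3.add v3, u4.add v4⟩, ?_⟩
  rw [← hu, ← hv]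
  simp only [rectIntegral]
  rw [intervalIntegral.integral_add u1 v1, intervalIntegral.integral_add u2 v2,
    intervalIntegral.integral_add u3 v3, intervalIntegral.integral_add u4 v4]
  ring

lemma IsRectIntegral.smul {a b : ℂ} {u : ℂ → E} {e : E} (k : ℂ) (hu : IsRectIntegral a b u e) :
    IsRectIntegral a b (fun z => k • u z) (k • e) := by
  intro φ
  obtain ⟨⟨u1, u2, u3, u4⟩, hu⟩ := hu φ
  simp only [map_smul, smul_eq_mul]
  refine ⟨⟨u1.const_mul k, u2.const_mul k, u3.const_mul k, u4.const_mul k⟩, ?_⟩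
  rw [← hu]
  simp only [rectIntegral, intervalIntegral.integral_const_mul]
  ring

lemma Represents.add {W : Set ℂ} {a b : ℂ} {f g : Hol E W} {ζ ξ : Hol ℂ univ →L[ℂ] E}
    (hf : Represents a b f ζ) (hg : Represents a b g ξ) : Represents a b (f + g) (ζ + ξ) := by
  classical
  intro h
  have key := (hf h).add (hg h)
  change IsRectIntegral a b _ (ζ h + ξ h)
  convert key using 2 with z
  rw [← smul_add, extZero_apply, extZero_apply, extZero_apply]
  split_ifs
  · rfl
  · simp

lemma Represents.smul {W : Set ℂ} {a b : ℂ} {f : Hol E W} {ζ : Hol ℂ univ →L[ℂ] E} (k : ℂ)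
    (hf : Represents a b f ζ) : Represents a b (k • f) (k • ζ) := by
  classical
  intro h
  have key := (hf h).smul k
  change IsRectIntegral a b _ (k • ζ h)
  convert key using 2 with z
  rw [smul_comm, extZero_apply, extZero_apply]
  split_ifs
  · rfl
  · simp

lemma Represents.zero {W : Set ℂ} (a b : ℂ) : Represents a b (0 : Hol E W) 0 := by
  classical
  intro h φ
  have key : (fun z => φ (h.1 ⟨z, mem_univ z⟩ • extZero (0 : Hol E W).1 z)) = fun _ => 0 := by
    funext z
    have : extZero (0 : Hol E W).1 z = 0 := by rw [extZero_apply]; split_ifs <;> rfl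
    rw [this, smul_zero, map_zero]
  rw [key]
  simp [RectIntegrable, rectIntegral]

variable (E) in
/-- The space `C^∞(U, 𝒜'(K, E))^•` of all families `δ_g(y)`, `y ∈ U`, of `E`-valued analytic
functionals `δ_g(y) : h ↦ ∫_C g(y, z) h(z) (2πi)⁻¹ dz`, where `C` is a contour surrounding `K` and
`g` is an element of `C^∞(U, 𝒜(ℂ \ K, E))^•`. (Such families are automatically carried by `K` and
smooth in `y`.) -/
noncomputable def bulletFunctional (U : Set (EuclideanSpace ℝ (Fin q))) (K : Set ℂ) :
    Submodule ℂ (U → (Hol ℂ univ →L[ℂ] E)) where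
  carrier := {ζ | ∃ g ∈ bullet E U K, ∀ (y : U) (a b : ℂ), Surrounds a b K →
    Represents a b (ev g y) (ζ y)}
  zero_mem' := ⟨0, Submodule.zero_mem _, fun _ a b _ => Represents.zero a b⟩
  add_mem' := by
    rintro ζ ξ ⟨f, hf, hfζ⟩ ⟨g, hg, hgξ⟩
    exact ⟨f + g, Submodule.add_mem _ hf hg, fun y a b h => (hfζ y a b h).add (hgξ y a b h)⟩
  smul_mem' := by
    rintro k ζ ⟨f, hf, hfζ⟩
    exact ⟨k • f, Submodule.smul_mem _ k hf, fun y a b h => (hfζ y a b h).smul k⟩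

end Bullet

section AsymptoticTypes

variable {q : ℕ}

/-- The system `𝒰(Ω)` of all open sets `U` such that the closure of `U` is compact and contained
in `Ω`. -/
def relCompactOpens (Ω : Set (EuclideanSpace ℝ (Fin q))) :
    Set (Set (EuclideanSpace ℝ (Fin q))) :=
  {U | IsOpen U ∧ IsCompact (closure U) ∧ closure U ⊆ Ω}

/-- The open strip `{c < Re z < c'}`. -/
def strip (c c' : ℝ) : Set ℂ := {z | c < z.re ∧ z.re < c'}

/-- For a system `R` of sets of pairs `(p, l) ∈ ℂ × ℕ` parametrised by `y ∈ Ω`: a triple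
`b = (c, c', U)` with `c < c'` and `U ∈ 𝒰(Ω)`, together with a finite open covering
`V 0, …, V N` of the closure of `U` and compact sets `K 0, …, K N` such that `K i` lies in the strip
`{c - ε i < Re z < c' + ε i}` and contains all points `p` of `R(y)` in that strip for all
`y ∈ V i`, and the sum of the numbers `1 + l` over all `(p, l) ∈ R(y)` with `p ∈ K i` is bounded
uniformly in `y ∈ V i`. -/
structure Datum (Ω : Set (EuclideanSpace ℝ (Fin q)))
    (R : EuclideanSpace ℝ (Fin q) → Set (ℂ × ℕ)) where
  c : ℝ
  c' : ℝ
  lt : c < c'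
  U : Set (EuclideanSpace ℝ (Fin q))
  U_mem : U ∈ relCompactOpens Ω
  N : ℕ
  V : Fin (N + 1) → Set (EuclideanSpace ℝ (Fin q))
  V_mem : ∀ i, V i ∈ relCompactOpens Ω
  cover : closure U ⊆ ⋃ i, V i
  K : Fin (N + 1) → Set ℂ
  K_compact : ∀ i, IsCompact (K i)
  ε : Fin (N + 1) → ℝ
  ε_pos : ∀ i, 0 < ε i
  K_subset : ∀ i, K i ⊆ strip (c - ε i) (c' + ε i)
  poles_subset : ∀ i, ∀ y ∈ V i, proj (R y) ∩ strip (c - ε i) (c' + ε i) ⊆ K i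
  bounded : ∀ i, ∃ M : ℕ, ∀ y ∈ V i, ∀ A : Finset (ℂ × ℕ), (A : Set (ℂ × ℕ)) ⊆ restr (K i) (R y) →
    ∑ x ∈ A, (1 + x.2) ≤ M

/-- `R = (R(y))_{y ∈ Ω}` is a variable discrete Mellin asymptotic type over `Ω`. (Values of `R`
off `Ω` play no role.) -/
def IsAsymptoticType (Ω : Set (EuclideanSpace ℝ (Fin q)))
    (R : EuclideanSpace ℝ (Fin q) → Set (ℂ × ℕ)) : Prop :=
  ∀ (c c' : ℝ) (U : Set (EuclideanSpace ℝ (Fin q))), c < c' → U ∈ relCompactOpens Ω →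
    ∃ b : Datum Ω R, b.c = c ∧ b.c' = c' ∧ b.U = U

variable {Ω : Set (EuclideanSpace ℝ (Fin q))} {R : EuclideanSpace ℝ (Fin q) → Set (ℂ × ℕ)}

namespace Datum

variable (b : Datum Ω R)

/-- The strip `{c < Re z < c'}`. -/
def S : Set ℂ := strip b.c b.c'

/-- The slightly larger strip `{c - ε i < Re z < c' + ε i}`. -/
def Sε (i : Fin (b.N + 1)) : Set ℂ := strip (b.c - b.ε i) (b.c' + b.ε i)

/-- The compact set `K_b`, the union of the sets `K i`. -/
def Kb : Set ℂ := ⋃ i, b.K i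

lemma mem_Ω {y : EuclideanSpace ℝ (Fin q)} (hy : y ∈ b.U) : y ∈ Ω :=
  b.U_mem.2.2 (subset_closure hy)

lemma mem_Ω_of_V {i : Fin (b.N + 1)} {y : EuclideanSpace ℝ (Fin q)} (hy : y ∈ b.V i) : y ∈ Ω :=
  (b.V_mem i).2.2 (subset_closure hy)

lemma not_mem_proj {y : EuclideanSpace ℝ (Fin q)} (hy : y ∈ b.U) {z : ℂ} (hz : z ∈ b.S \ b.Kb) :
    z ∈ (proj (R y))ᶜ := by
  intro hp
  obtain ⟨i, hi⟩ := mem_iUnion.1 (b.cover (subset_closure hy))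
  refine hz.2 (mem_iUnion.2 ⟨i, b.poles_subset i y hi ⟨hp, ?_⟩⟩)
  have h1 := hz.1.1
  have h2 := hz.1.2
  have h3 := b.ε_pos i
  exact ⟨by linarith, by linarith⟩

lemma not_mem_proj_of_V {i : Fin (b.N + 1)} {y : EuclideanSpace ℝ (Fin q)} (hy : y ∈ b.V i)
    {z : ℂ} (hz : z ∈ b.Sε i \ b.K i) : z ∈ (proj (R y))ᶜ :=
  fun hp => hz.2 (b.poles_subset i y hy ⟨hp, hz.1⟩)

end Datum

/-- A family `f(y, ·)`, `y ∈ Ω`, of `E`-valued holomorphic functions off the points of `R(y)` is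
smooth in `y`: for every `b = (c, c', U)`, every system of sets `V i`, `K i` as in the definition
of an asymptotic type and every `i`, firstly `f` is a smooth function of `y ∈ V i` with values in
the holomorphic functions on `{c - ε i < Re z < c' + ε i} \ K i`, and secondly the family of
analytic functionals `δ_i(y) : h ↦ ∫ f(y, z) h(z) (2πi)⁻¹ dz`, `y ∈ V i`, with integration along
a contour in `{c - ε i < Re z < c' + ε i}` surrounding `K i`, belongs to
`C^∞(V i, 𝒜'(K i, E))^•`. -/
def SmoothFamily (f : ∀ y : Ω, Hol E (proj (R y))ᶜ) : Prop :=
  ∀ (b : Datum Ω R) (i : Fin (b.N + 1)),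
    (∃ F : CInf (Hol E (b.Sε i \ b.K i)) (b.V i), ∀ (y : b.V i) (z : ↥(b.Sε i \ b.K i)),
      (ev F y).1 z = (f ⟨y, b.mem_Ω_of_V y.2⟩).1 ⟨z, b.not_mem_proj_of_V y.2 z.2⟩) ∧
    ∃ δ ∈ bulletFunctional E (b.V i) (b.K i), ∀ (y : b.V i) (u v : ℂ),
      Surrounds u v (b.K i) → Icc u.re v.re ×ℂ Icc u.im v.im ⊆ b.Sε i →
        Represents u v (f ⟨y, b.mem_Ω_of_V y.2⟩) (δ y)

variable (E Ω R) in
/-- The space `C^∞(Ω, ℳ_R(E))` of smooth families `f(y, ·)`, `y ∈ Ω`, of `E`-valued meromorphic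
functions subordinate to `R`. -/
noncomputable def MSpace : Submodule ℂ (∀ y : Ω, Hol E (proj (R y))ᶜ) where
  carrier := {f | (∀ y : Ω, Subordinate (R y) (f y)) ∧ SmoothFamily f}
  zero_mem' := ⟨fun y => Subordinate.zero _, fun b i =>
    ⟨⟨0, fun _ _ => rfl⟩, 0, Submodule.zero_mem _, fun _ u v _ _ => Represents.zero u v⟩⟩
  add_mem' := by
    rintro f g ⟨hf, hf'⟩ ⟨hg, hg'⟩
    refine ⟨fun y => (hf y).add (hg y), fun b i => ?_⟩
    obtain ⟨⟨F, hF⟩, ζ, hζ, hfζ⟩ := hf' b i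
    obtain ⟨⟨G, hG⟩, ξ, hξ, hgξ⟩ := hg' b i
    exact ⟨⟨F + G, fun y z => congrArg₂ (· + ·) (hF y z) (hG y z)⟩, ζ + ξ,
      Submodule.add_mem _ hζ hξ,
      fun y u v h1 h2 => (hfζ y u v h1 h2).add (hgξ y u v h1 h2)⟩
  smul_mem' := by
    rintro k f ⟨hf, hf'⟩
    refine ⟨fun y => (hf y).smul k, fun b i => ?_⟩
    obtain ⟨⟨F, hF⟩, ζ, hζ, hfζ⟩ := hf' b i
    exact ⟨⟨k • F, fun y z => congrArg (k • ·) (hF y z)⟩, k • ζ, Submodule.smul_mem _ k hζ,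
      fun y u v h1 h2 => (hfζ y u v h1 h2).smul k⟩

namespace Datum

variable (b : Datum Ω R)

variable (E) in
/-- The space `C^∞(U, 𝒜_R(ℂ \ K_b, E))^•` of all elements of `C^∞(U, 𝒜(ℂ \ K_b, E))^•` that are
subordinate to the restriction of `R` to `U` and `K_b`. -/
noncomputable def merPart : Submodule ℂ (CInf (Hol E b.Kbᶜ) b.U) where
  carrier := {g | g ∈ bullet E b.U b.Kb ∧
    ∀ y : b.U, ExtendsSubordinate (restr b.Kb (R y)) (ev g y)}
  zero_mem' := ⟨Submodule.zero_mem _, fun _ => ExtendsSubordinate.zero _⟩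
  add_mem' := fun hf hg => ⟨Submodule.add_mem _ hf.1 hg.1, fun y => (hf.2 y).add (hg.2 y)⟩
  smul_mem' := fun k _ hf => ⟨Submodule.smul_mem _ k hf.1, fun y => (hf.2 y).smul k⟩

noncomputable instance : AddCommGroup (b.merPart E) := Submodule.addCommGroup _
noncomputable instance : Module ℂ (b.merPart E) := Submodule.module _
noncomputable instance : TopologicalSpace (b.merPart E) := instTopologicalSpaceSubtype

variable (E) in
/-- The map `(h, g) ↦ h + g` from
`C^∞(U, 𝒜({c < Re z < c'}, E)) × C^∞(U, 𝒜_R(ℂ \ K_b, E))^•` to functions on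
`U × ({c < Re z < c'} \ K_b)`. -/
noncomputable def sumMap :
    (CInf (Hol E b.S) b.U × b.merPart E) →ₗ[ℂ] (b.U → ↥(b.S \ b.Kb) → E) where
  toFun x y z := (ev x.1 y).1 ⟨z, z.2.1⟩ + (ev x.2.1 y).1 ⟨z, z.2.2⟩
  map_add' x x' := by
    funext y z
    exact add_add_add_comm _ _ _ _
  map_smul' k x := by
    funext y z
    exact (smul_add k _ _).symm

variable (E) in
/-- The non-direct sum
`C^∞(U, 𝒜({c < Re z < c'}, E)) + C^∞(U, 𝒜_R(ℂ \ K_b, E))^•`, as a space of functions on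
`U × ({c < Re z < c'} \ K_b)`. -/
noncomputable def sumSpace : Submodule ℂ (b.U → ↥(b.S \ b.Kb) → E) := LinearMap.range (b.sumMap E)

variable (E) in
/-- The topology of the non-direct sum: the quotient topology under `(h, g) ↦ h + g`. -/
@[reducible] noncomputable def sumTopology : TopologicalSpace (b.sumSpace E) :=
  TopologicalSpace.coinduced (b.sumMap E).rangeRestrict inferInstance

/-- The restriction of a family `f(y, z)` to `U × ({c < Re z < c'} \ K_b)`. -/
noncomputable def restrict (f : ∀ y : Ω, Hol E (proj (R y))ᶜ) : b.U → ↥(b.S \ b.Kb) → E :=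
  fun y z => (f ⟨y, b.mem_Ω y.2⟩).1 ⟨z, b.not_mem_proj y.2 z.2⟩

end Datum

/-- The triples `(c, c', U)` of the sequence `b` exhaust all such triples. -/
def Exhausting (b : ℕ → Datum Ω R) : Prop :=
  ∀ (c c' : ℝ) (U : Set (EuclideanSpace ℝ (Fin q))), c < c' → U ∈ relCompactOpens Ω →
    ∃ n, (b n).c ≤ c ∧ c' ≤ (b n).c' ∧ U ⊆ (b n).U

end AsymptoticTypes

end Mellin

/-! A function u on D is treated as meromorphic on W through a denominator: a finite multiset s such
that `rootProd s • u` extends holomorphically to W (`HasDen`). In the families considered the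
cardinality of s is bounded uniformly in y. The maximum principle then controls the extension away
from the zeros of the denominator by the values of u on a compact subset of D, with a constant that
depends only on the degree bound (`HasDen.exists_estimate`). The poles themselves need not depend
even continuously on y. Smoothness is therefore never read off from them; it is transferred from u
to the extended or split function by `exists_cInf_of_relation`, which needs only a linear relation
graded by degree, with estimates and closed projections.

With a fixed denominator the extension condition is closed, because restriction to the complement of
a compact set has closed range. An asymptotic type supplies a finite denominator for every y, of
bounded degree on relatively compact sets. Hence the meromorphic summand is closed, and `V_b` is a
quotient of a Fréchet space by a closed kernel.

If f is a smooth family, its functional over a set of the covering comes from a family g with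
finitely many poles. The difference of f and g has vanishing moments, so it is holomorphic across
the compact set (`exists_holOn_of_isRectIntegral_zero`), and this splits f locally as h + g. A
smooth partition of unity in y glues these splittings (`Datum.restrict_mem_sumSpace`). Conversely,
if the restrictions of f lie in the spaces of an exhausting sequence, the identity theorem locates
the poles and their orders, and Newton interpolation together with Liouville's theorem yields smooth
principal parts, which represent the required functionals (`mem_MSpace_of_restrict`).

For the topology, the family space embeds in the countable product of the spaces `V_{b_n}`. Its
image is cut out by pointwise equations between continuous evaluations, hence is closed. The compact
sets of two data are unrelated, so continuity of the restriction to a further `V_d` is obtained from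
the closed graph theorem (`iInf_induced_le`), not from an explicit formula. -/

open Filter Topology Set

/-! ### Permanence properties of Fréchet spaces -/

namespace FrechetSpace

/-- A vector space with a compatible uniform structure that is complete is a Fréchet space as soon
as it is Hausdorff, locally convex and first countable. -/
theorem of_uniformSpace (V : Type*) [AddCommGroup V] [Module ℂ V] [UniformSpace V]
    [IsUniformAddGroup V] [ContinuousSMul ℂ V] [LocallyConvexSpace ℝ V] [T2Space V]
    [FirstCountableTopology V] [h : CompleteSpace V] : FrechetSpace V where
  complete := by rwa [IsUniformAddGroup.rightUniformSpace_eq]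

instance continuousSMul_real (V : Type*) [AddCommGroup V] [Module ℂ V] [TopologicalSpace V]
    [ContinuousSMul ℂ V] : ContinuousSMul ℝ V :=
  ⟨(Complex.continuous_ofReal.comp continuous_fst).smul continuous_snd⟩

section embedding

variable {V W : Type*} [AddCommGroup V] [Module ℂ V] [TopologicalSpace V]
  [AddCommGroup W] [Module ℂ W] [TopologicalSpace W] [FrechetSpace W]

/-- Every axiom is pulled back along f. For completeness, an additive map inducing the topology also
induces the group uniformity, and the closed range is complete. -/
theorem of_isClosedEmbedding (f : V →ₗ[ℂ] W) (hf : IsClosedEmbedding f) : FrechetSpace V := by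
  let : UniformSpace W := IsTopologicalAddGroup.rightUniformSpace W
  have : IsUniformAddGroup W := isUniformAddGroup_of_addCommGroup
  have : CompleteSpace W := FrechetSpace.complete
  have hi : IsInducing f := hf.isInducing
  have : IsTopologicalAddGroup V := by
    have := topologicalAddGroup_induced (f : V →ₗ[ℂ] W)
    rwa [← hi.eq_induced] at this
  have : ContinuousSMul ℂ V := ⟨by
    rw [hi.continuous_iff]
    have : (f ∘ fun p : ℂ × V => p.1 • p.2) = fun p : ℂ × V => p.1 • f p.2 := by
      funext p; simp
    rw [this]
    exact continuous_fst.smul (hi.continuous.comp continuous_snd)⟩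
  have : LocallyConvexSpace ℝ V :=
    hi.locallyConvexSpace (f := (f.restrictScalars ℝ : V →ₗ[ℝ] W))
  have : T2Space V := hf.isEmbedding.t2Space
  have : FirstCountableTopology V := hi.firstCountableTopology
  let : UniformSpace V := IsTopologicalAddGroup.rightUniformSpace V
  have : IsUniformAddGroup V := isUniformAddGroup_of_addCommGroup
  have hu : IsUniformInducing f := by
    refine ⟨?_⟩
    rw [uniformity_eq_comap_nhds_zero V, uniformity_eq_comap_nhds_zero W, comap_comap,
      hi.nhds_eq_comap, comap_comap, map_zero]
    congr 1
    funext p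
    simp
  have : CompleteSpace V := by
    rw [completeSpace_iff_isComplete_range hu]
    exact hf.isClosed_range.isComplete
  exact of_uniformSpace V

theorem of_isClosed (p : Submodule ℂ W) (hp : IsClosed (p : Set W)) : FrechetSpace p :=
  of_isClosedEmbedding p.subtype hp.isClosedEmbedding_subtypeVal

end embedding

instance prod {V W : Type*} [AddCommGroup V] [Module ℂ V] [TopologicalSpace V] [FrechetSpace V]
    [AddCommGroup W] [Module ℂ W] [TopologicalSpace W] [FrechetSpace W] :
    FrechetSpace (V × W) := by
  let : UniformSpace W := IsTopologicalAddGroup.rightUniformSpace W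
  have : IsUniformAddGroup W := isUniformAddGroup_of_addCommGroup
  have : CompleteSpace W := FrechetSpace.complete
  let : UniformSpace V := IsTopologicalAddGroup.rightUniformSpace V
  have : IsUniformAddGroup V := isUniformAddGroup_of_addCommGroup
  have : CompleteSpace V := FrechetSpace.complete
  exact of_uniformSpace (V × W)

instance pi {ι : Type*} [Countable ι] {V : ι → Type*} [∀ i, AddCommGroup (V i)]
    [∀ i, Module ℂ (V i)] [∀ i, TopologicalSpace (V i)] [∀ i, FrechetSpace (V i)] :
    FrechetSpace (∀ i, V i) := by
  let _ : ∀ i, UniformSpace (V i) := fun i => IsTopologicalAddGroup.rightUniformSpace (V i)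
  have h1 : ∀ i, IsUniformAddGroup (V i) := fun i => isUniformAddGroup_of_addCommGroup
  have h2 : ∀ i, CompleteSpace (V i) := fun i => FrechetSpace.complete
  have : LocallyConvexSpace ℝ (∀ i, V i) :=
    LocallyConvexSpace.iInf fun i =>
      LocallyConvexSpace.induced (LinearMap.proj i : (∀ i, V i) →ₗ[ℝ] V i)
  exact of_uniformSpace (∀ i, V i)

instance continuousMap {X V : Type*} [TopologicalSpace X] [LocallyCompactSpace X]
    [SigmaCompactSpace X] [AddCommGroup V]
    [Module ℂ V] [TopologicalSpace V] [FrechetSpace V] : FrechetSpace C(X, V) := by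
  let _ : UniformSpace V := IsTopologicalAddGroup.rightUniformSpace V
  have : IsUniformAddGroup V := isUniformAddGroup_of_addCommGroup
  have : CompleteSpace V := FrechetSpace.complete
  have : (uniformity V).IsCountablyGenerated :=
    IsUniformAddGroup.uniformity_countably_generated
  have : FirstCountableTopology C(X, V) := inferInstance
  let f : C(X, V) →+ UniformOnFun X V {K | IsCompact K} :=
    { toFun := ContinuousMap.toUniformOnFunIsCompact
      map_zero' := rfl
      map_add' := fun _ _ => rfl }
  have : IsUniformAddGroup C(X, V) :=
    IsUniformInducing.isUniformAddGroup f
      ContinuousMap.isUniformEmbedding_toUniformOnFunIsCompact.isUniformInducing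
  exact of_uniformSpace C(X, V)

-- The nonnegative elements of ℂ in its partial order are real, so complex convexity of a set
-- follows from real convexity. This is the source of the continuous seminorms over ℂ used
-- throughout.
open scoped ComplexOrder in
instance polynormableSpace (V : Type*) [AddCommGroup V] [Module ℂ V] [TopologicalSpace V]
    [FrechetSpace V] : PolynormableSpace ℂ V := by
  have : LocallyConvexSpace ℂ V := by
    refine LocallyConvexSpace.ofBasisZero ℂ V _ _
      (LocallyConvexSpace.convex_basis_zero ℝ V) fun s hs => ?_
    refine convex_of_nonneg_surjective_algebraMap (R := ℝ) (A := ℂ)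
      (fun z hz => ?_) hs.2
    obtain ⟨x, hx, rfl⟩ := (RCLike.nonneg_iff_exists_ofReal (K := ℂ)).mp hz
    exact ⟨x, hx, rfl⟩
  exact LocallyConvexSpace.toPolynormableSpace

section quotient

variable {V W : Type*} [AddCommGroup V] [Module ℂ V] [TopologicalSpace V] [FrechetSpace V]
  [AddCommGroup W] [Module ℂ W]

/-- Images of convex neighbourhoods of 0 are convex, and form a neighbourhood basis because f is
open. -/
theorem of_isOpenMap [TopologicalSpace W] [IsTopologicalAddGroup W] (f : V →ₗ[ℝ] W)
    (hf : IsOpenQuotientMap f) : LocallyConvexSpace ℝ W := by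
  refine LocallyConvexSpace.ofBasisZero ℝ W (fun s : Set V => f '' s)
    (fun s => s ∈ 𝓝 (0 : V) ∧ Convex ℝ s) ?_ fun s hs => hs.2.linear_image f
  have h := (LocallyConvexSpace.convex_basis_zero ℝ V).map f
  rwa [hf.map_nhds_eq, map_zero] at h

theorem of_quotient (p : Submodule ℂ V) (hp : IsClosed (p : Set V)) : FrechetSpace (V ⧸ p) := by
  have : IsClosed (p : Set V) := hp
  have : T3Space (V ⧸ p) := inferInstance
  have : FirstCountableTopology (V ⧸ p) :=
    inferInstanceAs (FirstCountableTopology (V ⧸ p.toAddSubgroup))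
  have : LocallyConvexSpace ℝ (V ⧸ p) :=
    of_isOpenMap (p.mkQ.restrictScalars ℝ) p.isOpenQuotientMap_mkQ
  have : @CompleteSpace V (IsTopologicalAddGroup.rightUniformSpace V) := FrechetSpace.complete
  exact { complete := QuotientAddGroup.completeSpace_right' V p.toAddSubgroup }

/-- The quotient topology under a surjective linear map with closed kernel. -/
theorem coinduced (f : V →ₗ[ℂ] W) (hf : Function.Surjective f)
    (hk : IsClosed (LinearMap.ker f : Set V)) :
    @FrechetSpace W _ _ (TopologicalSpace.coinduced f inferInstance) := by
  let _ : TopologicalSpace W := TopologicalSpace.coinduced f inferInstance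
  have := of_quotient _ hk
  let e := f.quotKerEquivOfSurjective hf
  have he : IsHomeomorph e := by
    have h1 : IsQuotientMap f := ⟨⟨rfl⟩, hf⟩
    have h2 := (LinearMap.ker f).isQuotientMap_mkQ
    have h3 : (e : (V ⧸ LinearMap.ker f) → W) ∘ (LinearMap.ker f).mkQ = f := by
      funext x
      simp [e]
    have h4 : IsQuotientMap e := IsQuotientMap.of_comp (h2.continuous)
      (h2.continuous_iff.2 (h3 ▸ h1.continuous)) (h3 ▸ h1)
    exact isHomeomorph_iff_continuous_isClosedMap_bijective.2 ⟨h4.continuous, fun s hs => by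
      rw [← h4.isClosed_preimage, e.injective.preimage_image]; exact hs, e.bijective⟩
  refine of_isClosedEmbedding e.symm.toLinearMap ?_
  convert (he.homeomorph.symm.isClosedEmbedding) using 1
  funext x
  exact (e.symm_apply_eq).2 (he.homeomorph.apply_symm_apply x).symm

end quotient

/-! ### The open mapping and closed graph theorems -/

section openMapping

variable {V W : Type*} [AddCommGroup V] [Module ℂ V] [TopologicalSpace V] [FrechetSpace V]
  [AddCommGroup W] [Module ℂ W] [TopologicalSpace W] [FrechetSpace W]

theorem baireSpace (W : Type*) [AddCommGroup W] [Module ℂ W] [TopologicalSpace W]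
    [FrechetSpace W] : BaireSpace W := by
  let _ : UniformSpace W := IsTopologicalAddGroup.rightUniformSpace W
  have : IsUniformAddGroup W := isUniformAddGroup_of_addCommGroup
  have : CompleteSpace W := FrechetSpace.complete
  have : (uniformity W).IsCountablyGenerated :=
    IsUniformAddGroup.uniformity_countably_generated
  infer_instance

-- The Baire category argument: the multiples of the closed image of a smaller neighbourhood cover
-- W, so one of them, and hence that closed image itself, has an interior point. Translating this
-- point to 0 costs a difference, which stays inside the image of U up to closure.
open scoped Pointwise in
theorem closure_image_mem_nhds_zero (f : V →L[ℂ] W) (hf : Function.Surjective f) {U : Set V}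
    (hU : U ∈ 𝓝 (0 : V)) : closure (f '' U) ∈ 𝓝 (0 : W) := by
  have := baireSpace W
  obtain ⟨U', hU', hs⟩ := exists_nhds_half_neg hU
  have hcov : ⋃ n : ℕ, ((n + 1 : ℂ)) • closure (f '' U') = univ := by
    refine eq_univ_of_forall fun w => ?_
    obtain ⟨v, rfl⟩ := hf w
    have ht : Tendsto (fun n : ℕ => ((n + 1 : ℂ))⁻¹ • v) atTop (𝓝 0) := by
      have h0 : Tendsto (fun n : ℕ => ((n + 1 : ℂ))⁻¹) atTop (𝓝 0) := by
        simpa using tendsto_one_div_add_atTop_nhds_zero_nat (𝕜 := ℂ)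
      simpa using h0.smul_const v
    obtain ⟨n, hn⟩ := (ht.eventually hU').exists
    refine mem_iUnion.2 ⟨n, (mem_smul_set_iff_inv_smul_mem₀ (Nat.cast_add_one_ne_zero n) _ _).2
      (subset_closure ⟨_, hn, by simp⟩)⟩
  obtain ⟨n, w, hw⟩ := nonempty_interior_of_iUnion_of_closed
    (fun n : ℕ => isClosed_closure.smul_of_ne_zero (c := (n + 1 : ℂ)) (s := closure (f '' U'))
      (Nat.cast_add_one_ne_zero n)) hcov
  rw [interior_smul₀ (Nat.cast_add_one_ne_zero n),
    mem_smul_set_iff_inv_smul_mem₀ (Nat.cast_add_one_ne_zero n)] at hw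
  generalize ((n : ℂ) + 1)⁻¹ • w = y at hw
  have h1 : (fun x => x + y) ⁻¹' interior (closure (f '' U')) ∈ 𝓝 (0 : W) := by
    refine (continuous_add_const y).continuousAt.preimage_mem_nhds ?_
    rw [zero_add]
    exact isOpen_interior.mem_nhds hw
  filter_upwards [h1] with x hx
  have hx' := interior_subset hx
  have hy' := interior_subset hw
  have : (x + y) - y ∈ closure (f '' U) :=
    map_mem_closure₂ continuous_sub hx' hy' (by
      rintro _ ⟨a, ha, rfl⟩ _ ⟨b, hb, rfl⟩
      exact ⟨a - b, hs a ha b hb, by simp⟩)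
  simpa using this

/-- Successive approximation: a point in the closure of the image is corrected by elements of ever
smaller neighbourhoods. The corrections sum to a preimage by completeness of V. -/
theorem closure_image_subset (f : V →L[ℂ] W) (hf : Function.Surjective f) {u : ℕ → Set V}
    (hu : (𝓝 (0 : V)).HasAntitoneBasis u)
    (hadd : ∀ n, ∀ x ∈ u (n + 1), ∀ y ∈ u (n + 1), x + y ∈ u n) (k : ℕ) :
    closure (f '' u (k + 1)) ⊆ f '' closure (u k) := by
  intro y hy
  have step : ∀ (n : ℕ) (w : W), w ∈ closure (f '' u n) →
      ∃ x ∈ u n, w - f x ∈ closure (f '' u (n + 1)) := by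
    intro n w hw
    have hN := closure_image_mem_nhds_zero f hf (hu.mem (n + 1))
    have : (fun z => w - z) ⁻¹' closure (f '' u (n + 1)) ∈ 𝓝 w := by
      refine (continuous_const.sub continuous_id).continuousAt.preimage_mem_nhds ?_
      simpa using hN
    obtain ⟨_, hz, x, hx, rfl⟩ := mem_closure_iff_nhds.1 hw _ this
    exact ⟨x, hx, hz⟩
  choose! g hg hg' using step
  -- z n is the error that remains after n corrections; the n-th correction is taken in `u (k + 1 +
  -- n)`.
  let z : ℕ → W := fun n => Nat.rec y (fun n w => w - f (g (k + 1 + n) w)) n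
  have hz : ∀ n, z n ∈ closure (f '' u (k + 1 + n)) := by
    intro n
    induction n with
    | zero => exact hy
    | succ n ih => exact hg' _ _ ih
  let s : ℕ → V := fun n => ∑ i ∈ Finset.range n, g (k + 1 + i) (z i)
  -- Every block of corrections starting at index n stays in `u (k + n)`: the first term and the
  -- remaining block both lie in the next smaller set, and `hadd` absorbs their sum.
  have hsum : ∀ m n, ∑ i ∈ Finset.range m, g (k + 1 + (n + i)) (z (n + i)) ∈ u (k + n) := by
    intro m
    induction m with
    | zero => intro n; simpa using mem_of_mem_nhds (hu.mem (k + n))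
    | succ m ih =>
      intro n
      rw [Finset.sum_range_succ']
      have h1 := hg _ _ (hz n)
      rw [show k + 1 + n = (k + n) + 1 by omega] at h1
      have h2 := hadd _ _ (ih (n + 1)) _ h1
      rw [show k + 1 + (n + 0) = k + n + 1 by omega, add_zero]
      have h3 : ∀ i, n + (i + 1) = n + 1 + i := fun i => by omega
      rwa [show (fun i => g (k + 1 + (n + (i + 1))) (z (n + (i + 1)))) =
        fun i => g (k + 1 + (n + 1 + i)) (z (n + 1 + i)) from funext fun i => by rw [h3]]
  have hdiff : ∀ n m, s (n + m) - s n ∈ u (k + n) := by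
    intro n m
    have := hsum m n
    simp only [s]
    rwa [Finset.sum_range_add, add_sub_cancel_left]
  have hfs : ∀ n, f (s n) = y - z n := by
    intro n
    induction n with
    | zero => simp [s, z]
    | succ n ih =>
      simp only [s] at ih ⊢
      rw [Finset.sum_range_succ, map_add, ih]
      simp only [z]
      abel
  have hzlim : Tendsto z atTop (𝓝 0) := by
    intro N hN
    obtain ⟨C, hC, hCc, hCN⟩ := exists_mem_nhds_isClosed_subset hN
    have : f ⁻¹' C ∈ 𝓝 (0 : V) := f.continuous.continuousAt.preimage_mem_nhds (by simpa using hC)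
    obtain ⟨i, hi⟩ := hu.mem_iff.1 this
    refine mem_map.2 (mem_atTop_sets.2 ⟨i, fun n hn => hCN ?_⟩)
    refine closure_minimal ?_ hCc (hz n)
    rintro _ ⟨x, hx, rfl⟩
    exact hi (hu.antitone (by omega) hx)
  let _ : UniformSpace V := IsTopologicalAddGroup.rightUniformSpace V
  have : IsUniformAddGroup V := isUniformAddGroup_of_addCommGroup
  have : CompleteSpace V := FrechetSpace.complete
  have hcs : CauchySeq s := by
    have hb : (uniformity V).HasBasis (fun _ : ℕ => True) fun i => {x | x.2 - x.1 ∈ u i} := by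
      rw [uniformity_eq_comap_nhds_zero V]
      exact hu.toHasBasis.comap _
    rw [hb.cauchySeq_iff']
    intro i _
    obtain ⟨j, hj⟩ := hu.mem_iff.1 (neg_mem_nhds_zero V (hu.mem i))
    refine ⟨j, fun n hn => ?_⟩
    obtain ⟨m, rfl⟩ := Nat.exists_eq_add_of_le hn
    have := hj (hu.antitone (by omega) (hdiff j m))
    simpa using this
  obtain ⟨x, hx⟩ := cauchySeq_tendsto_of_complete hcs
  refine ⟨x, mem_closure_of_tendsto hx (Eventually.of_forall fun n => ?_), ?_⟩
  · simpa [s] using hdiff 0 n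
  · have h1 := (f.continuous.tendsto x).comp hx
    have h2 : Tendsto (f ∘ s) atTop (𝓝 (y - 0)) :=
      (tendsto_const_nhds.sub hzlim).congr fun n => (hfs n).symm
    simpa using tendsto_nhds_unique h1 h2

/-- The open mapping theorem for Fréchet spaces. -/
theorem isOpenMap (f : V →L[ℂ] W) (hf : Function.Surjective f) : IsOpenMap f := by
  have key : ∀ N ∈ 𝓝 (0 : V), f '' N ∈ 𝓝 (0 : W) := by
    intro N hN
    obtain ⟨u, hu, hadd⟩ := IsTopologicalAddGroup.exists_antitone_basis_nhds_zero V
    obtain ⟨C, hC, hCc, hCN⟩ := exists_mem_nhds_isClosed_subset hN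
    obtain ⟨k, hk⟩ := hu.mem_iff.1 hC
    refine mem_of_superset (closure_image_mem_nhds_zero f hf (hu.mem (k + 1))) ?_
    exact (closure_image_subset f hf hu
      (fun n x hx y hy => hadd n (Set.add_mem_add hx hy)) k).trans
      (image_mono ((closure_minimal hk hCc).trans hCN))
  refine IsOpenMap.of_nhds_le fun x s hs => ?_
  rw [mem_map] at hs
  have h1 : (fun v => x + v) ⁻¹' (f ⁻¹' s) ∈ 𝓝 (0 : V) :=
    (continuous_const.add continuous_id).continuousAt.preimage_mem_nhds (by simpa using hs)
  have h2 := key _ h1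
  have h3 : (fun w => w - f x) ⁻¹' (f '' ((fun v => x + v) ⁻¹' (f ⁻¹' s))) ∈ 𝓝 (f x) :=
    (continuous_id.sub continuous_const).continuousAt.preimage_mem_nhds (by simpa using h2)
  refine mem_of_superset h3 ?_
  rintro w ⟨v, hv, hvw⟩
  have : f (x + v) ∈ s := hv
  rwa [map_add, hvw, add_sub_cancel] at this

/-- The closed graph theorem for Fréchet spaces. -/
theorem continuous_of_isClosed_graph (T : V →ₗ[ℂ] W)
    (hT : IsClosed (T.graph : Set (V × W))) : Continuous T := by
  have := of_isClosed T.graph hT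
  let f : T.graph →L[ℂ] V := (ContinuousLinearMap.fst ℂ V W).comp T.graph.subtypeL
  have hf : Function.Surjective f := fun v => ⟨⟨(v, T v), by simp [LinearMap.mem_graph_iff]⟩, rfl⟩
  have hq : IsQuotientMap f := (isOpenMap f hf).isQuotientMap f.continuous hf
  rw [hq.continuous_iff]
  have : T ∘ f = fun x : T.graph => x.1.2 := by
    funext x
    exact ((LinearMap.mem_graph_iff T x.1).1 x.2).symm
  rw [this]
  exact continuous_snd.comp continuous_subtype_val

end openMapping

end FrechetSpace

/-! ### Seminorms, dual functionals and the Cauchy criterion -/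

namespace FrechetSpace

variable {E : Type*} [AddCommGroup E] [Module ℂ E] [TopologicalSpace E] [FrechetSpace E]

theorem exists_seminorm_ball_subset {N : Set E} (hN : N ∈ 𝓝 (0 : E)) :
    ∃ p : Seminorm ℂ E, Continuous p ∧ {x | p x < 1} ⊆ N := by
  obtain ⟨⟨s, r⟩, hr, h⟩ :=
    (PolynormableSpace.withSeminorms ℂ E).hasBasis_zero_ball.mem_iff.1 hN
  have hr : 0 < r := hr
  set p := s.sup (fun p : {p : Seminorm ℂ E // Continuous p} => p.1) with hp
  have hp1 : p.ball 0 1 ∈ 𝓝 (0 : E) :=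
    (PolynormableSpace.withSeminorms ℂ E).hasBasis_zero_ball.mem_of_mem (i := (s, 1)) one_pos
  have hpc : Continuous p := Seminorm.continuous' (r := 1) (mem_of_superset hp1
    (Seminorm.ball_subset_closedBall _ _ _))
  let c : NNReal := ⟨r⁻¹, by positivity⟩
  refine ⟨c • p, hpc.const_smul c, fun x hx => h ?_⟩
  have hx : r⁻¹ * p x < 1 := hx
  rw [Seminorm.mem_ball_zero]
  rwa [inv_mul_lt_iff₀ hr, mul_one] at hx

theorem setOf_seminorm_lt_mem_nhds {p : Seminorm ℂ E} (hp : Continuous p) {r : ℝ} (hr : 0 < r) :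
    {x | p x < r} ∈ 𝓝 (0 : E) :=
  hp.continuousAt.preimage_mem_nhds (by rw [map_zero]; exact Iio_mem_nhds hr)

/-- Hahn–Banach, applied to the functional `c • x ↦ c * p x` on the line through x. -/
theorem exists_dual_eq_seminorm {p : Seminorm ℂ E} (hp : Continuous p) (x : E) :
    ∃ φ : E →L[ℂ] ℂ, (∀ y, ‖φ y‖ ≤ p y) ∧ ‖φ x‖ = p x := by
  by_cases hx : p x = 0
  · exact ⟨0, by simp, by simp [hx]⟩
  have hx0 : x ≠ 0 := by rintro rfl; simp at hx
  let S : Submodule ℂ E := Submodule.span ℂ {x}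
  let e := LinearEquiv.toSpanNonzeroSingleton ℂ E x hx0
  let f : Module.Dual ℂ S := ((p x : ℂ)) • (e.symm : S →ₗ[ℂ] ℂ)
  have key : ∀ y : S, ‖f y‖ = p y := by
    intro y
    obtain ⟨c, rfl⟩ := e.surjective y
    have h1 : f (e c) = p x * c := by
      simp only [f, LinearMap.smul_apply, LinearEquiv.coe_coe, LinearEquiv.symm_apply_apply,
        smul_eq_mul]
    have h2 : ((e c : S) : E) = c • x := rfl
    rw [h1, h2, map_smul_eq_mul, norm_mul, Complex.norm_real, Real.norm_of_nonneg
      (apply_nonneg p x), mul_comm]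
  obtain ⟨g, hg, hg'⟩ := Module.Dual.exists_continuous_extension_of_le_seminorm S f hp
    fun y => (key y).le
  refine ⟨g, hg', ?_⟩
  rw [show g x = f ⟨x, Submodule.mem_span_singleton_self x⟩ from hg ⟨x, _⟩, key]

/-- A norming functional reduces seminorm estimates to scalar ones, so that the maximum principle
and the mean value inequality are needed only for ℂ-valued functions. -/
theorem seminorm_le_of_dual {p : Seminorm ℂ E} (hp : Continuous p) {x : E} {C : ℝ}
    (h : ∀ φ : E →L[ℂ] ℂ, (∀ y, ‖φ y‖ ≤ p y) → ‖φ x‖ ≤ C) : p x ≤ C := by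
  obtain ⟨φ, h1, h2⟩ := exists_dual_eq_seminorm hp x
  exact h2 ▸ h φ h1

theorem eq_zero_of_seminorm {x : E} (h : ∀ p : Seminorm ℂ E, Continuous p → p x = 0) : x = 0 := by
  by_contra hx
  obtain ⟨p, hp, hpN⟩ := exists_seminorm_ball_subset (E := E) (N := {x}ᶜ)
    (isOpen_compl_singleton.mem_nhds (by simpa using Ne.symm hx))
  exact hpN (a := x) (by simp [h p hp]) rfl

theorem eq_of_dual {x y : E} (h : ∀ φ : E →L[ℂ] ℂ, φ x = φ y) : x = y := by
  rw [← sub_eq_zero]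
  refine eq_zero_of_seminorm fun p hp => le_antisymm ?_ (apply_nonneg p _)
  exact seminorm_le_of_dual hp fun φ _ => by simp [h φ]

/-- The filter-theoretic Cauchy criterion in a Fréchet space. -/
theorem exists_tendsto_of_cauchy {α : Type*} {l : Filter α} [l.NeBot] (u : α → E)
    (h : ∀ p : Seminorm ℂ E, Continuous p → ∀ ε > 0, ∃ s ∈ l, ∀ a ∈ s, ∀ b ∈ s,
      p (u a - u b) < ε) : ∃ e, Tendsto u l (𝓝 e) := by
  let _ : UniformSpace E := IsTopologicalAddGroup.rightUniformSpace E
  have : IsUniformAddGroup E := isUniformAddGroup_of_addCommGroup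
  have : CompleteSpace E := FrechetSpace.complete
  refine CompleteSpace.complete (f := map u l) ⟨inferInstance, ?_⟩
  rw [uniformity_eq_comap_nhds_zero E]
  intro s hs
  obtain ⟨N, hN, hNs⟩ := mem_comap.1 hs
  obtain ⟨p, hp, hpN⟩ := exists_seminorm_ball_subset hN
  obtain ⟨t, ht, h1⟩ := h p hp 1 one_pos
  refine mem_prod_iff.2 ⟨u '' t, image_mem_map ht, u '' t, image_mem_map ht, ?_⟩
  rintro ⟨_, _⟩ ⟨⟨a, ha, rfl⟩, ⟨b, hb, rfl⟩⟩
  exact hNs (hpN (h1 b hb a ha))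

theorem tendsto_of_seminorm {α : Type*} {l : Filter α} {u : α → E} {e : E}
    (h : ∀ p : Seminorm ℂ E, Continuous p → ∀ ε > 0, ∀ᶠ a in l, p (u a - e) < ε) :
    Tendsto u l (𝓝 e) := by
  refine tendsto_sub_nhds_zero_iff.1 fun N hN => ?_
  obtain ⟨p, hp, hpN⟩ := exists_seminorm_ball_subset hN
  exact mem_of_superset (h p hp 1 one_pos) fun a ha => hpN ha

theorem exists_seminorm_bound {X : Type*} [TopologicalSpace X] {p : Seminorm ℂ E}
    (hp : Continuous p) {K : Set X} (hK : IsCompact K) {u : X → E} (hu : ContinuousOn u K) :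
    ∃ B : ℝ, 0 ≤ B ∧ ∀ z ∈ K, p (u z) ≤ B := by
  obtain ⟨B, hB⟩ := (hK.image_of_continuousOn (hp.comp_continuousOn hu)).bddAbove
  exact ⟨max B 0, le_max_right _ _, fun z hz =>
    (hB (mem_image_of_mem _ hz)).trans (le_max_left _ _)⟩

end FrechetSpace

/-! ### Weakly holomorphic functions with values in a Fréchet space -/

namespace Mellin

variable {E : Type*} [AddCommGroup E] [Module ℂ E] [TopologicalSpace E]

/-- Holomorphy of `u` on `W` in the weak sense, for functions defined on all of `ℂ`. -/
structure HolOn (u : ℂ → E) (W : Set ℂ) : Prop where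
  continuousOn : ContinuousOn u W
  differentiableOn (φ : E →L[ℂ] ℂ) : DifferentiableOn ℂ (fun z => φ (u z)) W

namespace HolOn

section basic

variable [IsTopologicalAddGroup E] [ContinuousSMul ℂ E]

variable {u v : ℂ → E} {V W : Set ℂ}

theorem mono (h : HolOn u W) (hV : V ⊆ W) : HolOn u V :=
  ⟨h.1.mono hV, fun φ => (h.2 φ).mono hV⟩

theorem congr (h : HolOn u W) (huv : EqOn v u W) : HolOn v W :=
  ⟨h.1.congr huv, fun φ => (h.2 φ).congr fun z hz => by simp only [huv hz]⟩

theorem of_local (h : ∀ z ∈ W, ∃ V, IsOpen V ∧ z ∈ V ∧ HolOn u V) : HolOn u W := by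
  constructor
  · intro z hz
    obtain ⟨V, hV, hzV, hu⟩ := h z hz
    exact ((hu.1 z hzV).continuousAt (hV.mem_nhds hzV)).continuousWithinAt
  · intro φ z hz
    obtain ⟨V, hV, hzV, hu⟩ := h z hz
    exact ((hu.2 φ z hzV).differentiableAt (hV.mem_nhds hzV)).differentiableWithinAt

theorem union (h : HolOn u V) (h' : HolOn u W) (hV : IsOpen V) (hW : IsOpen W) :
    HolOn u (V ∪ W) :=
  of_local fun _ hz => hz.elim (fun hz => ⟨V, hV, hz, h⟩) (fun hz => ⟨W, hW, hz, h'⟩)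

theorem const (c : E) : HolOn (fun _ => c) W :=
  ⟨continuousOn_const, fun _ => differentiableOn_const _⟩

theorem add (h : HolOn u W) (h' : HolOn v W) : HolOn (fun z => u z + v z) W :=
  ⟨h.1.add h'.1, fun φ => by simp only [map_add]; exact (h.2 φ).add (h'.2 φ)⟩

theorem sub (h : HolOn u W) (h' : HolOn v W) : HolOn (fun z => u z - v z) W :=
  ⟨h.1.sub h'.1, fun φ => by simp only [map_sub]; exact (h.2 φ).sub (h'.2 φ)⟩

theorem smul {g : ℂ → ℂ} (hg : DifferentiableOn ℂ g W) (h : HolOn u W) :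
    HolOn (fun z => g z • u z) W :=
  ⟨hg.continuousOn.smul h.1, fun φ => by
    simp only [map_smul, smul_eq_mul]; exact hg.mul (h.2 φ)⟩

theorem const_smul (c : ℂ) (h : HolOn u W) : HolOn (fun z => c • u z) W :=
  h.smul (differentiableOn_const c)

end basic

section frechet

variable [FrechetSpace E]

variable {u v : ℂ → E} {V W : Set ℂ}

/-- The scalar maximum principle for φ ∘ u, with the same bound for every φ dominated by p. -/
theorem seminorm_le_of_frontier (h : HolOn u W) {U : Set ℂ} (hU : Bornology.IsBounded U)
    (hUW : closure U ⊆ W) {p : Seminorm ℂ E} (hp : Continuous p) {B : ℝ}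
    (hB : ∀ z ∈ frontier U, p (u z) ≤ B) {z : ℂ} (hz : z ∈ closure U) : p (u z) ≤ B := by
  refine FrechetSpace.seminorm_le_of_dual hp fun φ hφ => ?_
  have hd : DiffContOnCl ℂ (fun z => φ (u z)) U :=
    ⟨(h.2 φ).mono (subset_closure.trans hUW), ((h.2 φ).mono hUW).continuousOn⟩
  exact Complex.norm_le_of_forall_mem_frontier_norm_le hU hd
    (fun w hw => (hφ _).trans (hB w hw)) hz

theorem eqOn_zero (h : HolOn u W) (hWo : IsOpen W) (hW : IsPreconnected W) {z₀ : ℂ}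
    (hz₀ : z₀ ∈ W) (h0 : ∀ᶠ z in 𝓝 z₀, u z = 0) : ∀ z ∈ W, u z = 0 := by
  intro z hz
  refine FrechetSpace.eq_of_dual fun φ => ?_
  rw [map_zero]
  refine ((h.2 φ).analyticOnNhd hWo).eqOn_zero_of_preconnected_of_eventuallyEq_zero hW hz₀ ?_ hz
  filter_upwards [h0] with w hw
  simp [hw]

theorem eq_zero_of_tendsto_cocompact (h : HolOn u univ) (h0 : Tendsto u (cocompact ℂ) (𝓝 0))
    (z : ℂ) : u z = 0 := by
  refine FrechetSpace.eq_of_dual fun φ => ?_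
  have := (differentiableOn_univ.1 (h.2 φ)).apply_eq_of_tendsto_cocompact z
    ((φ.continuous.tendsto 0).comp h0)
  simpa using this

/-- Weak holomorphy yields a strong derivative. The difference quotients at z are Lipschitz near z,
uniformly over all functionals dominated by p, because the maximum principle bounds the second
difference quotient. They are thus Cauchy, and E is complete. -/
theorem exists_tendsto_slope (h : HolOn u W) (hW : IsOpen W) {z : ℂ} (hz : z ∈ W) :
    ∃ e : E, Tendsto (fun w => (w - z)⁻¹ • (u w - u z)) (𝓝[≠] z) (𝓝 e) := by
  obtain ⟨R, hR, hRW⟩ := Metric.nhds_basis_closedBall.mem_iff.1 (hW.mem_nhds hz)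
  refine FrechetSpace.exists_tendsto_of_cauchy _ fun p hp ε hε => ?_
  obtain ⟨B, hB0, hB⟩ := FrechetSpace.exists_seminorm_bound hp (isCompact_closedBall z R)
    (h.1.mono hRW)
  -- On the circle of radius R the first quotient is at most 2B/R. The second is at most twice that,
  -- divided by R/2, a lower bound for the distance from the circle to w'.
  set C : ℝ := (2 * (2 * B / R)) / (R / 2) with hC
  have hC0 : 0 ≤ C := by positivity
  obtain ⟨δ, hδ, hδC⟩ : ∃ δ > 0, C * (2 * δ) < ε := by
    refine ⟨ε / (4 * (C + 1)), by positivity, ?_⟩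
    have : C * (2 * (ε / (4 * (C + 1)))) = (C / (C + 1)) * (ε / 2) := by field_simp; ring
    rw [this]
    have : C / (C + 1) ≤ 1 := by rw [div_le_one (by positivity)]; linarith
    nlinarith
  set r := min δ (R / 2) with hr
  have hr0 : 0 < r := lt_min hδ (by positivity)
  refine ⟨Metric.ball z r ∩ {z}ᶜ, inter_mem (mem_nhdsWithin_of_mem_nhds (Metric.ball_mem_nhds z hr0))
    self_mem_nhdsWithin, ?_⟩
  rintro w ⟨hw, hwz⟩ w' ⟨hw', hwz'⟩
  refine lt_of_le_of_lt (FrechetSpace.seminorm_le_of_dual hp (C := C * dist w w') fun φ hφ => ?_) ?_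
  swap
  · refine lt_of_le_of_lt (mul_le_mul_of_nonneg_left ?_ hC0) hδC
    have h1 := (Metric.mem_ball.1 hw).le.trans (min_le_left _ _)
    have h2 := (Metric.mem_ball.1 hw').le.trans (min_le_left _ _)
    have := dist_triangle_right w w' z
    linarith
  set f : ℂ → ℂ := fun z => φ (u z) with hf
  have hfd : DifferentiableOn ℂ f (Metric.closedBall z R) := (h.2 φ).mono hRW
  have hfW : DifferentiableOn ℂ f W := h.2 φ
  set F := dslope f z with hF
  have hFW : DifferentiableOn ℂ F W :=
    (Complex.differentiableOn_dslope (hW.mem_nhds hz)).2 hfW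
  have hball : Metric.ball z r ⊆ W := fun x hx => hRW (Metric.ball_subset_closedBall
    (Metric.ball_subset_ball ((min_le_right _ _).trans (by linarith)) hx))
  set G := dslope F w' with hG
  have hGW : DifferentiableOn ℂ G W :=
    (Complex.differentiableOn_dslope (hW.mem_nhds (hball hw'))).2 hFW
  have hFval : ∀ x, x ≠ z → F x = φ ((x - z)⁻¹ • (u x - u z)) := by
    intro x hx
    rw [hF, dslope_of_ne _ hx, slope_def_module, map_smul, map_sub]
  have hfB : ∀ x ∈ Metric.closedBall z R, ‖f x‖ ≤ B := fun x hx => (hφ _).trans (hB x hx)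
  have hFS : ∀ x ∈ Metric.sphere z R, ‖F x‖ ≤ 2 * B / R := by
    intro x hx
    have hxz : x ≠ z := by rintro rfl; simp at hx; exact hR.ne hx
    rw [hF, dslope_of_ne _ hxz, slope_def_module, norm_smul, norm_inv,
      ← dist_eq_norm, Metric.mem_sphere.1 hx, inv_mul_eq_div]
    gcongr
    have h1 := hfB x (Metric.sphere_subset_closedBall hx)
    have h2 := hfB z (Metric.mem_closedBall_self hR.le)
    exact (norm_sub_le _ _).trans (by linarith)
  have hfr : frontier (Metric.ball z R) = Metric.sphere z R := frontier_ball z hR.ne'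
  have hcl : closure (Metric.ball z R) ⊆ W := by rw [closure_ball z hR.ne']; exact hRW
  have max : ∀ g : ℂ → ℂ, DifferentiableOn ℂ g W → ∀ M, (∀ x ∈ Metric.sphere z R, ‖g x‖ ≤ M) →
      ∀ x ∈ Metric.closedBall z R, ‖g x‖ ≤ M := by
    intro g hg M hM x hx
    refine Complex.norm_le_of_forall_mem_frontier_norm_le (U := Metric.ball z R)
      Metric.isBounded_ball ⟨hg.mono (subset_closure.trans hcl), (hg.mono hcl).continuousOn⟩
      (by rwa [hfr]) (by rwa [closure_ball z hR.ne'])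
  have hr2 : ∀ x ∈ Metric.ball z r, dist x z < R / 2 := fun x hx =>
    (Metric.mem_ball.1 hx).trans_le (min_le_right _ _)
  have hGS : ∀ x ∈ Metric.sphere z R, ‖G x‖ ≤ C := by
    intro x hx
    have h1 := hr2 w' hw'
    have h2 : R / 2 ≤ dist x w' := by
      have := dist_triangle x w' z
      rw [Metric.mem_sphere.1 hx] at this
      linarith
    have hxw : x ≠ w' := by rintro rfl; simp at h2; linarith
    rw [hG, dslope_of_ne _ hxw, slope_def_module, norm_smul, norm_inv, ← dist_eq_norm,
      inv_mul_eq_div, hC]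
    have h3 := hFS x hx
    have h4 := max F hFW _ hFS w' (by
      rw [Metric.mem_closedBall]; linarith)
    have h5 := norm_sub_le (F x) (F w')
    gcongr
    linarith
  have hGw := max G hGW C hGS w (by rw [Metric.mem_closedBall]; linarith [hr2 w hw])
  rw [map_sub, ← hFval w hwz, ← hFval w' hwz', ← sub_smul_dslope F w' w, norm_smul, ← hG,
    dist_eq_norm, mul_comm]
  gcongr

/-- Division by `z - a` of `u - u a`. -/
theorem exists_slope (h : HolOn u W) (hW : IsOpen W) {a : ℂ} (ha : a ∈ W) :
    ∃ v : ℂ → E, HolOn v W ∧ ∀ z, u z = u a + (z - a) • v z := by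
  obtain ⟨e, he⟩ := h.exists_tendsto_slope hW ha
  classical
  set v : ℂ → E := Function.update (fun w => (w - a)⁻¹ • (u w - u a)) a e with hv
  refine ⟨v, ⟨fun z hz => ?_, fun φ => ?_⟩, fun z => ?_⟩
  · by_cases hza : z = a
    · subst hza
      exact (continuousAt_update_same.2 he).continuousWithinAt
    · rw [hv, continuousWithinAt_update_of_ne hza]
      have h1 : ContinuousAt (fun w : ℂ => (w - a)⁻¹) z :=
        (continuousAt_id.sub continuousAt_const).inv₀ (sub_ne_zero.2 hza)
      exact h1.continuousWithinAt.smul ((h.1 z hz).sub continuousWithinAt_const)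
  · have h1 := (Complex.differentiableOn_dslope (hW.mem_nhds ha)).2 (h.2 φ)
    refine h1.congr fun z hz => ?_
    by_cases hza : z = a
    · subst hza
      rw [hv, Function.update_self, dslope_same]
      have h2 := ((h.2 φ z hz).differentiableAt (hW.mem_nhds hz)).hasDerivAt
      rw [hasDerivAt_iff_tendsto_slope] at h2
      refine tendsto_nhds_unique ((φ.continuous.tendsto e).comp he) (h2.congr fun w => ?_)
      simp [slope_def_module]
    · rw [hv, Function.update_of_ne hza, dslope_of_ne _ hza, slope_def_module, map_smul, map_sub]
  · by_cases hza : z = a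
    · subst hza; simp
    · rw [hv, Function.update_of_ne hza, smul_inv_smul₀ (sub_ne_zero.2 hza)]
      abel

end frechet

end HolOn

end Mellin

/-! ### The spaces 𝒜(W, E) -/

namespace Mellin

variable {E : Type*} [AddCommGroup E] [Module ℂ E] [TopologicalSpace E] [FrechetSpace E]

variable {V W : Set ℂ}

/-- The extension by zero of a holomorphic function. -/
noncomputable def fn (f : Hol E W) : ℂ → E := extZero f.1

theorem fn_apply (f : Hol E W) {z : ℂ} (hz : z ∈ W) : fn f z = f.1 ⟨z, hz⟩ :=
  Subtype.val_injective.extend_apply _ _ (⟨z, hz⟩ : W)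

theorem fn_coe (f : Hol E W) (z : W) : fn f z = f.1 z := fn_apply f z.2

theorem fn_of_notMem (f : Hol E W) {z : ℂ} (hz : z ∉ W) : fn f z = 0 :=
  Function.extend_apply' _ _ _ (by rintro ⟨a, rfl⟩; exact hz a.2)

theorem fn_add (f g : Hol E W) (z : ℂ) : fn (f + g) z = fn f z + fn g z := by
  by_cases hz : z ∈ W
  · simp only [fn_apply _ hz]; rfl
  · simp only [fn_of_notMem _ hz, add_zero]

theorem fn_sub (f g : Hol E W) (z : ℂ) : fn (f - g) z = fn f z - fn g z := by
  by_cases hz : z ∈ W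
  · simp only [fn_apply _ hz]; rfl
  · simp only [fn_of_notMem _ hz, sub_zero]

theorem fn_smul (c : ℂ) (f : Hol E W) (z : ℂ) : fn (c • f) z = c • fn f z := by
  by_cases hz : z ∈ W
  · simp only [fn_apply _ hz]; rfl
  · simp only [fn_of_notMem _ hz, smul_zero]

theorem fn_zero (z : ℂ) : fn (0 : Hol E W) z = 0 := by
  by_cases hz : z ∈ W
  · simp only [fn_apply _ hz]; rfl
  · exact fn_of_notMem _ hz

theorem ext_fn {f g : Hol E W} (h : ∀ z ∈ W, fn f z = fn g z) : f = g :=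
  Subtype.ext (ContinuousMap.ext fun z => by rw [← fn_coe, ← fn_coe, h z z.2])

theorem continuous_fn (z : ℂ) : Continuous fun f : Hol E W => fn f z := by
  by_cases hz : z ∈ W
  · simp only [fn_apply _ hz]
    exact (continuous_eval_const (F := C(W, E)) (⟨z, hz⟩ : W)).comp continuous_subtype_val
  · simp only [fn_of_notMem _ hz]
    exact continuous_const

/-- Since W is open, punctured neighbourhoods in the subtype and in ℂ agree, so the strong
derivative from `Hol` can be composed with a functional. `HolOn.isHolomorphic` is the converse
passage. -/
theorem fn_holOn (f : Hol E W) (hW : IsOpen W) : HolOn (fn f) W := by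
  have hc : ContinuousOn (fn f) W := by
    rw [continuousOn_iff_continuous_domRestrict]
    convert f.1.continuous using 1
    funext z
    exact fn_coe f z
  refine ⟨hc, fun φ z hz => ?_⟩
  obtain ⟨e, he⟩ := f.2 ⟨z, hz⟩
  have h1 : map Subtype.val (𝓝[≠] (⟨z, hz⟩ : W)) = 𝓝[≠] z := by
    have h := hW.isOpenEmbedding_subtypeVal.map_nhdsWithin_preimage_eq {z}ᶜ (⟨z, hz⟩ : W)
    have h' : (Subtype.val ⁻¹' {z}ᶜ : Set W) = {⟨z, hz⟩}ᶜ := by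
      ext w
      simp [Subtype.ext_iff]
    rwa [h'] at h
  have h2 : Tendsto (fun w => (w - z)⁻¹ • (fn f w - fn f z)) (𝓝[≠] z) (𝓝 e) := by
    rw [← h1, tendsto_map'_iff]
    refine he.congr fun w => ?_
    simp [fn_coe, fn_apply _ hz]
  have h3 : HasDerivAt (fun z => φ (fn f z)) (φ e) z := by
    rw [hasDerivAt_iff_tendsto_slope]
    refine ((φ.continuous.tendsto e).comp h2).congr fun w => ?_
    simp [slope_def_module]
  exact h3.differentiableAt.differentiableWithinAt

theorem HolOn.isHolomorphic {u : ℂ → E} {W : Set ℂ} (h : HolOn u W) (hW : IsOpen W) :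
    IsHolomorphic (fun z : W => u z) := by
  intro z
  obtain ⟨e, he⟩ := h.exists_tendsto_slope hW z.2
  refine ⟨e, he.comp (f := ((↑) : W → ℂ)) (tendsto_nhdsWithin_iff.2
    ⟨continuous_subtype_val.continuousAt.mono_left nhdsWithin_le_nhds, ?_⟩)⟩
  filter_upwards [self_mem_nhdsWithin] with w hw hw'
  exact hw (Subtype.ext hw')

/-- A function that is holomorphic on the open set `W`, as an element of `𝒜(W, E)`. -/
noncomputable def HolOn.toHol {u : ℂ → E} {W : Set ℂ} (h : HolOn u W) (hW : IsOpen W) :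
    Hol E W :=
  ⟨⟨fun z => u z, continuousOn_iff_continuous_domRestrict.1 h.1⟩, h.isHolomorphic hW⟩

theorem HolOn.fn_toHol {u : ℂ → E} {W : Set ℂ} (h : HolOn u W) (hW : IsOpen W) {z : ℂ}
    (hz : z ∈ W) : fn (h.toHol hW) z = u z := fn_apply _ hz

namespace Hol

variable {V W : Set ℂ}

/-- Convergence in the compact-open topology becomes locally uniform convergence after applying a
functional, and locally uniform limits of scalar holomorphic functions are holomorphic. The limit is
thus weakly holomorphic, hence holomorphic. -/
theorem isClosed_hol (hW : IsOpen W) : IsClosed (Hol E W : Set C(W, E)) := by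
  refine isClosed_of_closure_subset fun u hu => ?_
  have hne : (𝓝[(Hol E W : Set C(W, E))] u).NeBot := mem_closure_iff_nhdsWithin_neBot.1 hu
  let _ : UniformSpace E := IsTopologicalAddGroup.rightUniformSpace E
  have : IsUniformAddGroup E := isUniformAddGroup_of_addCommGroup
  have : LocallyCompactSpace W := hW.locallyCompactSpace
  have hlim : Tendsto (fun v : C(W, E) => v) (𝓝[(Hol E W : Set C(W, E))] u) (𝓝 u) :=
    tendsto_id.mono_left nhdsWithin_le_nhds
  have hu' : HolOn (extZero u) W := by
    refine ⟨?_, fun φ => ?_⟩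
    · rw [continuousOn_iff_continuous_domRestrict]
      convert u.continuous using 1
      funext z
      exact Subtype.val_injective.extend_apply _ _ z
    · have h1 := (((⟨φ, φ.continuous⟩ : C(E, ℂ)).continuous_postcomp (X := W)).tendsto u).comp hlim
      rw [ContinuousMap.tendsto_iff_tendstoLocallyUniformly] at h1
      have h2 : TendstoLocallyUniformlyOn (fun (v : C(W, E)) z => φ (extZero v z))
          (fun z => φ (extZero u z)) (𝓝[(Hol E W : Set C(W, E))] u) W := by
        rw [tendstoLocallyUniformlyOn_iff_tendstoLocallyUniformly_comp_coe]
        have h3 : ∀ (v : C(W, E)) (z : W), φ (extZero v z) = φ (v z) := fun v z =>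
          congrArg φ (Subtype.val_injective.extend_apply _ _ z)
        simp only [Function.comp_def, h3]
        exact h1
      refine h2.differentiableOn ?_ hW
      filter_upwards [self_mem_nhdsWithin] with v hv
      exact (fn_holOn ⟨v, hv⟩ hW).2 φ
  have := hu'.isHolomorphic hW
  have h2 : (fun z : W => extZero u z) = u := by
    funext z
    exact Subtype.val_injective.extend_apply _ _ z
  rw [h2] at this
  exact this

theorem frechetSpace (hW : IsOpen W) : FrechetSpace (Hol E W) := by
  have : LocallyCompactSpace W := hW.locallyCompactSpace
  exact FrechetSpace.of_isClosed _ (isClosed_hol hW)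

theorem setOf_seminorm_lt_mem_nhds {L : Set ℂ} (hL : IsCompact L) (hLW : L ⊆ W)
    {p : Seminorm ℂ E} (hp : Continuous p) {r : ℝ} (hr : 0 < r) :
    {f : Hol E W | ∀ z ∈ L, p (fn f z) < r} ∈ 𝓝 (0 : Hol E W) := by
  rw [nhds_induced, mem_comap]
  refine ⟨{u | MapsTo u (Subtype.val ⁻¹' L) {x | p x < r}}, ?_, ?_⟩
  · refine (((𝓝 (0 : E)).basis_sets.nhds_continuousMapConst (X := W)).mem_of_mem
      (i := (Subtype.val ⁻¹' L, {x | p x < r})) ⟨?_, FrechetSpace.setOf_seminorm_lt_mem_nhds hp hr⟩)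
    exact IsInducing.subtypeVal.isCompact_preimage' hL (by simpa using hLW)
  · intro f hf z hz
    rw [fn_apply f (hLW hz)]
    exact hf (x := ⟨z, hLW hz⟩) hz

theorem exists_seminorm_subset {N : Set (Hol E W)} (hN : N ∈ 𝓝 (0 : Hol E W)) :
    ∃ (L : Set ℂ) (p : Seminorm ℂ E), IsCompact L ∧ L ⊆ W ∧ Continuous p ∧
      {f : Hol E W | ∀ z ∈ L, p (fn f z) < 1} ⊆ N := by
  rw [nhds_induced, mem_comap] at hN
  obtain ⟨N', hN', h⟩ := hN
  obtain ⟨⟨L, s⟩, ⟨hL, hs⟩, h'⟩ :=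
    ((𝓝 (0 : E)).basis_sets.nhds_continuousMapConst (X := W)).mem_iff.1 hN'
  obtain ⟨p, hp, hps⟩ := FrechetSpace.exists_seminorm_ball_subset hs
  refine ⟨Subtype.val '' L, p, hL.image continuous_subtype_val, by simp, hp, fun f hf => h (h' ?_)⟩
  intro z hz
  have := hf z ⟨z, hz, rfl⟩
  rw [fn_coe] at this
  exact hps this

/-- Restriction to a smaller set, as a continuous linear map. -/
noncomputable def resL (h : V ⊆ W) : Hol E W →L[ℂ] Hol E V where
  toFun := Hol.res h
  map_add' _ _ := rfl
  map_smul' _ _ := rfl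
  cont := by
    refine Continuous.subtype_mk ?_ _
    exact (ContinuousMap.continuous_precomp _).comp continuous_subtype_val

theorem fn_resL (h : V ⊆ W) (f : Hol E W) {z : ℂ} (hz : z ∈ V) : fn (resL h f) z = fn f z := by
  rw [fn_apply _ hz, fn_apply _ (h hz)]
  rfl

end Hol

end Mellin

/-! ### The spaces C^∞(U, F) -/

namespace FrechetSpace

variable {F : Type*} [AddCommGroup F] [Module ℂ F] [TopologicalSpace F] [FrechetSpace F]

theorem eventually_continuousMap_sub_lt {X : Type*} [TopologicalSpace X] (u : C(X, F)) {L : Set X}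
    (hL : IsCompact L) {p : Seminorm ℂ F} (hp : Continuous p) {r : ℝ} (hr : 0 < r) :
    ∀ᶠ v : C(X, F) in 𝓝 u, ∀ x ∈ L, p (v x - u x) < r := by
  have h1 : {v : C(X, F) | MapsTo v L {x | p x < r}} ∈ 𝓝 (0 : C(X, F)) :=
    ((𝓝 (0 : F)).basis_sets.nhds_continuousMapConst (X := X)).mem_of_mem
      (i := (L, {x | p x < r})) ⟨hL, setOf_seminorm_lt_mem_nhds hp hr⟩
  have h2 : Tendsto (fun v => v - u) (𝓝 u) (𝓝 0) := by
    have : Tendsto (fun v => v - u) (𝓝 u) (𝓝 (u - u)) :=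
      (continuous_id.sub continuous_const).tendsto u
    rwa [sub_self] at this
  filter_upwards [h2 h1] with v hv x hx
  exact hv hx

end FrechetSpace

namespace Mellin

variable {q : ℕ} {F G : Type*} [AddCommGroup F] [Module ℂ F] [TopologicalSpace F] [FrechetSpace F]
  [AddCommGroup G] [Module ℂ G] [TopologicalSpace G] [FrechetSpace G]
  {U V : Set (EuclideanSpace ℝ (Fin q))} {i : Fin q}

theorem eventually_add_smul_mem (hU : IsOpen U) {y : EuclideanSpace ℝ (Fin q)} (hy : y ∈ U)
    (e : EuclideanSpace ℝ (Fin q)) : ∀ᶠ t : ℝ in 𝓝 0, y + t • e ∈ U := by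
  have : Continuous fun t : ℝ => y + t • e := by fun_prop
  exact this.continuousAt.preimage_mem_nhds (by simpa using hU.mem_nhds hy)

/-- For open U the admissible increments form a neighbourhood of 0, so the subtype of increments can
be dropped and u replaced by any extension w. -/
theorem hasPartialDeriv_iff (hU : IsOpen U) {u v : U → F} {w : EuclideanSpace ℝ (Fin q) → F}
    (hw : ∀ y : U, w y = u y) : HasPartialDeriv i u v ↔ ∀ y : U,
      Tendsto (fun t : ℝ => ((t : ℂ))⁻¹ • (w (y + t • EuclideanSpace.single i (1 : ℝ)) - w y))
        (𝓝[≠] 0) (𝓝 (v y)) := by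
  refine forall_congr' fun y => ?_
  have h1 : range (Subtype.val : {t : ℝ // (y : EuclideanSpace ℝ (Fin q)) +
      t • EuclideanSpace.single i (1 : ℝ) ∈ U} → ℝ) ∈ 𝓝[≠] (0 : ℝ) :=
    mem_of_superset (mem_nhdsWithin_of_mem_nhds (eventually_add_smul_mem hU y.2 _))
      fun t ht => ⟨⟨t, ht⟩, rfl⟩
  conv_rhs => rw [← map_comap_of_mem h1, tendsto_map'_iff]
  refine tendsto_congr fun t => ?_
  simp only [Function.comp_apply]
  rw [← hw, ← hw]

/-- Extension by zero of a function on `U`. -/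
noncomputable def extU (u : U → F) : EuclideanSpace ℝ (Fin q) → F :=
  Function.extend Subtype.val u 0

theorem extU_coe (u : U → F) (y : U) : extU u y = u y :=
  Subtype.val_injective.extend_apply _ _ y

theorem extU_apply (u : U → F) {y : EuclideanSpace ℝ (Fin q)} (hy : y ∈ U) :
    extU u y = u ⟨y, hy⟩ := extU_coe u ⟨y, hy⟩

theorem extU_of_notMem (u : U → F) {y : EuclideanSpace ℝ (Fin q)} (hy : y ∉ U) : extU u y = 0 :=
  Function.extend_apply' _ _ _ (by rintro ⟨a, rfl⟩; exact hy a.2)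

theorem HasPartialDeriv.tendsto (hU : IsOpen U) {u v : U → F} (h : HasPartialDeriv i u v) (y : U) :
    Tendsto (fun t : ℝ => ((t : ℂ))⁻¹ •
      (extU u (y + t • EuclideanSpace.single i (1 : ℝ)) - extU u y)) (𝓝[≠] 0) (𝓝 (v y)) :=
  (hasPartialDeriv_iff hU (extU_coe u)).1 h y

theorem HasPartialDeriv.add {u v u' v' : U → F} (h : HasPartialDeriv i u v)
    (h' : HasPartialDeriv i u' v') : HasPartialDeriv i (u + u') (v + v') := fun y =>
  ((h y).add (h' y)).congr fun t => by
    rw [← smul_add]; simp only [Pi.add_apply]; congr 1; abel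

/-- The mean value inequality along a coordinate line. -/
theorem HasPartialDeriv.seminorm_le (hU : IsOpen U) {u v : U → F} (h : HasPartialDeriv i u v)
    {p : Seminorm ℂ F} (hp : Continuous p) (y : EuclideanSpace ℝ (Fin q)) (t : ℝ)
    (ht : ∀ s ∈ uIcc 0 t, y + s • EuclideanSpace.single i (1 : ℝ) ∈ U) (c : F) {B : ℝ}
    (hB : ∀ s ∈ uIcc 0 t, p (extU v (y + s • EuclideanSpace.single i (1 : ℝ)) - c) ≤ B) :
    p (extU u (y + t • EuclideanSpace.single i (1 : ℝ)) - extU u y - (t : ℂ) • c) ≤ B * |t| := by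
  refine FrechetSpace.seminorm_le_of_dual hp fun φ hφ => ?_
  set γ : ℝ → EuclideanSpace ℝ (Fin q) := fun s => y + s • EuclideanSpace.single i (1 : ℝ) with hγ
  set g : ℝ → ℂ := fun s => φ (extU u (γ s) - (s : ℂ) • c) with hg
  have hd : ∀ s ∈ uIcc 0 t, HasDerivAt g (φ (extU v (γ s) - c)) s := by
    intro s hs
    have h1 := h.tendsto hU ⟨γ s, ht s hs⟩
    rw [← extU_apply v (ht s hs)] at h1
    have h2 : HasDerivAt (fun s => φ (extU u (γ s))) (φ (extU v (γ s))) s := by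
      rw [hasDerivAt_iff_tendsto_slope_zero]
      refine ((φ.continuous.tendsto _).comp h1).congr fun r => ?_
      simp only [Function.comp_apply, map_smul, map_sub, hγ, smul_eq_mul, Complex.real_smul,
        Complex.ofReal_inv, add_smul, add_assoc]
    have h3 : HasDerivAt (fun s : ℝ => (s : ℂ) * φ c) (φ c) s := by
      simpa using (Complex.ofRealCLM.hasDerivAt (x := s)).mul_const (φ c)
    simp only [hg, map_sub, map_smul, smul_eq_mul]
    exact h2.sub h3
  have := (convex_uIcc (𝕜 := ℝ) 0 t).norm_image_sub_le_of_norm_hasDerivWithin_le (f := g)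
    (fun s hs => (hd s hs).hasDerivWithinAt) (fun s hs => (hφ _).trans (hB s hs))
    left_mem_uIcc right_mem_uIcc
  simpa [hg, hγ, sub_right_comm] using this

/-- This is the converse of `HasPartialDeriv.seminorm_le` for continuous v: near y the bound B can
be taken arbitrarily small. It recasts differentiability as an inequality along segments that
survives uniform limits. -/
theorem hasPartialDeriv_of_seminorm_le (hU : IsOpen U) {u v : U → F} (hv : Continuous v)
    (h : ∀ (p : Seminorm ℂ F), Continuous p → ∀ (y : U) (t : ℝ),
      (∀ s ∈ uIcc 0 t, (y : EuclideanSpace ℝ (Fin q)) + s • EuclideanSpace.single i (1 : ℝ) ∈ U) →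
      ∀ B : ℝ, (∀ s ∈ uIcc 0 t,
        p (extU v (y + s • EuclideanSpace.single i (1 : ℝ)) - v y) ≤ B) →
      p (extU u (y + t • EuclideanSpace.single i (1 : ℝ)) - extU u y - (t : ℂ) • v y) ≤ B * |t|) :
    HasPartialDeriv i u v := by
  rw [hasPartialDeriv_iff hU (extU_coe u)]
  intro y
  refine FrechetSpace.tendsto_of_seminorm fun p hp ε hε => ?_
  have hvc : ContinuousAt (extU v) y := by
    have : ContinuousOn (extU v) U := by
      rw [continuousOn_iff_continuous_domRestrict]
      convert hv using 1
      funext z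
      exact extU_coe v z
    exact this.continuousAt (hU.mem_nhds y.2)
  have h1 : ∀ᶠ z in 𝓝 (y : EuclideanSpace ℝ (Fin q)), z ∈ U ∧ p (extU v z - v y) < ε / 2 := by
    refine Filter.Eventually.and (hU.mem_nhds y.2) ?_
    have h2 : ContinuousAt (fun z => p (extU v z - v y)) (y : EuclideanSpace ℝ (Fin q)) :=
      hp.continuousAt.comp (hvc.sub continuousAt_const)
    have h3 : p (extU v y - v y) < ε / 2 := by rw [extU_coe]; simpa using half_pos hε
    exact h2.eventually_lt continuousAt_const h3
  have h2 : ∀ᶠ t : ℝ in 𝓝 0, (y : EuclideanSpace ℝ (Fin q)) +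
      t • EuclideanSpace.single i (1 : ℝ) ∈ U ∧
      p (extU v (y + t • EuclideanSpace.single i (1 : ℝ)) - v y) < ε / 2 := by
    have hc : Continuous fun t : ℝ => (y : EuclideanSpace ℝ (Fin q)) +
      t • EuclideanSpace.single i (1 : ℝ) := by fun_prop
    have h0 : Tendsto (fun t : ℝ => (y : EuclideanSpace ℝ (Fin q)) +
        t • EuclideanSpace.single i (1 : ℝ)) (𝓝 0) (𝓝 y) := by simpa using hc.tendsto 0
    exact h0.eventually h1
  obtain ⟨δ, hδ, hball⟩ := Metric.eventually_nhds_iff.1 h2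
  have h3 : Metric.ball (0 : ℝ) δ ∈ 𝓝[≠] (0 : ℝ) :=
    mem_nhdsWithin_of_mem_nhds (Metric.ball_mem_nhds _ hδ)
  filter_upwards [h3, self_mem_nhdsWithin] with t ht ht0
  have hseg : ∀ s ∈ uIcc 0 t, dist s 0 < δ := by
    intro s hs
    refine lt_of_le_of_lt ?_ (Metric.mem_ball.1 ht)
    simpa [Real.dist_eq] using abs_sub_left_of_mem_uIcc hs
  have key := h p hp y t (fun s hs => (hball (hseg s hs)).1) (ε / 2)
    fun s hs => (hball (hseg s hs)).2.le
  have ht0' : (t : ℂ) ≠ 0 := by exact_mod_cast ht0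
  have hpos : 0 < |t| := abs_pos.2 ht0
  have heq : ((t : ℂ))⁻¹ • (extU u (y + t • EuclideanSpace.single i (1 : ℝ)) - extU u y) - v y =
      ((t : ℂ))⁻¹ • (extU u (y + t • EuclideanSpace.single i (1 : ℝ)) - extU u y
        - (t : ℂ) • v y) := by
    rw [smul_sub _ (_ - _) (_ • _), inv_smul_smul₀ ht0']
  rw [heq, map_smul_eq_mul, norm_inv, Complex.norm_real, Real.norm_eq_abs, inv_mul_lt_iff₀ hpos]
  nlinarith

/-- The mean value inequality involves only the values on a compact segment, so it passes to limits
in the compact-open topology. -/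
theorem isClosed_hasPartialDeriv (hU : IsOpen U) (i : Fin q) :
    IsClosed {w : C(U, F) × C(U, F) | HasPartialDeriv i w.1 w.2} := by
  refine isClosed_of_closure_subset fun w hw => ?_
  refine hasPartialDeriv_of_seminorm_le hU w.2.continuous fun p hp y t ht B hB => ?_
  have hyU : (y : EuclideanSpace ℝ (Fin q)) ∈ U := y.2
  set e : EuclideanSpace ℝ (Fin q) := EuclideanSpace.single i (1 : ℝ) with he
  set L : Set U := Subtype.val ⁻¹' ((fun s : ℝ => (y : EuclideanSpace ℝ (Fin q)) + s • e) ''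
    uIcc 0 t) with hL
  have hLc : IsCompact L := by
    refine IsInducing.subtypeVal.isCompact_preimage' (isCompact_uIcc.image (by fun_prop)) ?_
    rintro _ ⟨s, hs, rfl⟩
    exact ⟨⟨_, ht s hs⟩, rfl⟩
  have hmem : ∀ s (hs : s ∈ uIcc 0 t), (⟨y + s • e, ht s hs⟩ : U) ∈ L := fun s hs => ⟨s, hs, rfl⟩
  have hyL : y ∈ L := ⟨0, left_mem_uIcc, by simp⟩
  -- An approximating pair w' is ε-close on the segment. Two values of its derivative enter B, two
  -- values of the function and one multiple t of the derivative enter the remainder; then ε tends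
  -- to 0.
  have key : ∀ ε > 0, p (extU w.1 (y + t • e) - extU w.1 y - (t : ℂ) • w.2 y) ≤
      (B + 2 * ε) * |t| + (ε + ε + |t| * ε) := by
    intro ε hε
    have h1 := FrechetSpace.eventually_continuousMap_sub_lt w.1 hLc hp hε
    have h2 := FrechetSpace.eventually_continuousMap_sub_lt w.2 hLc hp hε
    obtain ⟨w', ⟨h1, h2⟩, h3⟩ := mem_closure_iff_nhds.1 hw _
      (inter_mem (continuous_fst.continuousAt.eventually h1)
        (continuous_snd.continuousAt.eventually h2))
    have h1 : ∀ x ∈ L, p (w'.1 x - w.1 x) < ε := h1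
    have h2 : ∀ x ∈ L, p (w'.2 x - w.2 x) < ε := h2
    have h4 := HasPartialDeriv.seminorm_le hU h3 hp y t ht (w'.2 y) (B := B + 2 * ε) ?_
    · rw [extU_apply _ (ht t right_mem_uIcc), extU_coe] at h4 ⊢
      have e1 := h1 _ (hmem t right_mem_uIcc)
      have e2 := h1 y hyL
      have e3 := h2 y hyL
      set a' := w'.1 ⟨y + t • e, _⟩
      set a := w.1 ⟨y + t • e, _⟩
      have heq : a - w.1 y - (t : ℂ) • w.2 y = (a' - w'.1 y - (t : ℂ) • w'.2 y) -
          ((a' - a) - (w'.1 y - w.1 y) - (t : ℂ) • (w'.2 y - w.2 y)) := by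
        rw [smul_sub]; abel
      rw [heq]
      refine (map_sub_le_add p _ _).trans (add_le_add h4 ?_)
      refine (map_sub_le_add p _ _).trans (add_le_add ((map_sub_le_add p _ _).trans
        (add_le_add e1.le e2.le)) ?_)
      rw [map_smul_eq_mul, Complex.norm_real, Real.norm_eq_abs]
      gcongr
    · intro s hs
      have h5 := hB s hs
      rw [extU_apply _ (ht s hs)] at h5 ⊢
      have e1 := h2 _ (hmem s hs)
      have e2 := h2 y hyL
      set a' := w'.2 ⟨y + s • e, _⟩
      set a := w.2 ⟨y + s • e, _⟩
      have heq : a' - w'.2 y = (a - w.2 y) + ((a' - a) - (w'.2 y - w.2 y)) := by abel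
      rw [heq]
      refine (map_add_le_add p _ _).trans ?_
      have := map_sub_le_add p (a' - a) (w'.2 y - w.2 y)
      linarith
  refine le_of_tendsto_of_tendsto (f := fun _ : ℝ => p (extU w.1 (y + t • e) - extU w.1 y -
    (t : ℂ) • w.2 y)) (b := 𝓝[>] 0) (g := fun ε => (B + 2 * ε) * |t| + (ε + ε + |t| * ε))
    tendsto_const_nhds ?_ ?_
  · have : Continuous fun ε : ℝ => (B + 2 * ε) * |t| + (ε + ε + |t| * ε) := by fun_prop
    have := (this.tendsto 0).mono_left (nhdsWithin_le_nhds (s := Ioi 0))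
    simpa using this
  · filter_upwards [self_mem_nhdsWithin] with ε hε
    exact key ε hε

theorem isClosed_cInf (hU : IsOpen U) :
    IsClosed (CInf F U : Set (List (Fin q) → C(U, F))) := by
  have : (CInf F U : Set (List (Fin q) → C(U, F))) = ⋂ (α) (i), (fun D => (D α, D (i :: α))) ⁻¹'
      {w : C(U, F) × C(U, F) | HasPartialDeriv i w.1 w.2} := by
    ext D
    simp only [mem_iInter, mem_preimage]
    exact Iff.rfl
  rw [this]
  refine isClosed_iInter fun α => isClosed_iInter fun i =>
    (isClosed_hasPartialDeriv hU i).preimage ?_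
  exact (continuous_apply α).prodMk (continuous_apply (i :: α))

theorem frechetSpace_cInf (hU : IsOpen U) : FrechetSpace (CInf F U) := by
  have : LocallyCompactSpace U := hU.locallyCompactSpace
  exact FrechetSpace.of_isClosed _ (isClosed_cInf hU)

theorem continuous_ev (y : U) : Continuous fun D : CInf F U => ev D y :=
  (continuous_eval_const (F := C(U, F)) y).comp
    ((continuous_apply []).comp continuous_subtype_val)

/-- A function that belongs to a class of continuous functions closed under partial derivatives is
smooth. -/
theorem exists_cInf_of_forall (P : (U → F) → Prop) (hc : ∀ u, P u → Continuous u)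
    (hd : ∀ u, P u → ∀ i, ∃ v, P v ∧ HasPartialDeriv i u v) {u : U → F} (hu : P u) :
    ∃ D : CInf F U, ∀ y, ev D y = u y := by
  choose! d hdP hdd using hd
  let D : List (Fin q) → {u // P u} := fun α =>
    List.rec ⟨u, hu⟩ (fun i _ w => ⟨d w.1 i, hdP w.1 w.2 i⟩) α
  exact ⟨⟨fun α => ⟨(D α).1, hc _ (D α).2⟩, fun α i => hdd (D α).1 (D α).2 i⟩, fun y => rfl⟩

theorem exists_cInf_map (h : V ⊆ U) (T : F →L[ℂ] G) (D : CInf F U) :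
    ∃ D' : CInf G V, ∀ y : V, ev D' y = T (ev D ⟨y, h y.2⟩) := by
  refine ⟨⟨fun α => ((⟨T, T.continuous⟩ : C(F, G)).comp (D.1 α)).comp
    ⟨Set.inclusion h, continuous_inclusion h⟩, fun α i y => ?_⟩, fun y => rfl⟩
  have h1 := D.2 α i (Set.inclusion h y)
  let ι : {t : ℝ // (y : EuclideanSpace ℝ (Fin q)) + t • EuclideanSpace.single i (1 : ℝ) ∈ V} →
    {t : ℝ // (y : EuclideanSpace ℝ (Fin q)) + t • EuclideanSpace.single i (1 : ℝ) ∈ U} :=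
    fun t => ⟨t, h t.2⟩
  have h2 : Tendsto ι (comap Subtype.val (𝓝[≠] (0 : ℝ))) (comap Subtype.val (𝓝[≠] (0 : ℝ))) :=
    tendsto_comap_iff.2 tendsto_comap
  refine ((T.continuous.tendsto _).comp (h1.comp h2)).congr fun t => ?_
  simp only [Function.comp_apply, map_smul, map_sub]
  rfl

/-- By the Leibniz rule, finite sums of products of a cutoff supported in V with a derivative of D
form a class stable under partial derivatives. At points off V everything vanishes in a
neighbourhood, because the support is closed. -/
theorem exists_cInf_cutoff (hU : IsOpen U) (hV : IsOpen V) (D : CInf F V)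
    {χ : EuclideanSpace ℝ (Fin q) → ℝ} (hχ : ContDiff ℝ (⊤ : ℕ∞) χ) (hχV : tsupport χ ⊆ V) :
    ∃ D' : CInf F U, ∀ y : U, ev D' y = (χ y : ℂ) • extU (ev D) y := by
  let S : Set (U → F) := {u | ∃ χ : EuclideanSpace ℝ (Fin q) → ℝ, ContDiff ℝ (⊤ : ℕ∞) χ ∧
    tsupport χ ⊆ V ∧ ∃ α, u = fun y : U => (χ y : ℂ) • extU (D.1 α) y}
  have hSc : ∀ χ : EuclideanSpace ℝ (Fin q) → ℝ, Continuous χ → tsupport χ ⊆ V → ∀ α,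
      Continuous fun y => (χ y : ℂ) • extU (D.1 α) y := by
    intro χ hχ hχV α
    refine continuous_iff_continuousAt.2 fun y => ?_
    by_cases hy : y ∈ V
    · have : ContinuousOn (extU (D.1 α)) V := by
        rw [continuousOn_iff_continuous_domRestrict]
        convert (D.1 α).continuous using 1
        funext z
        exact extU_coe _ z
      exact (Complex.continuous_ofReal.comp hχ).continuousAt.smul
        (this.continuousAt (hV.mem_nhds hy))
    · have h1 : ∀ᶠ z in 𝓝 y, (χ z : ℂ) • extU (D.1 α) z = 0 := by
        filter_upwards [(isClosed_tsupport χ).isOpen_compl.mem_nhds fun h => hy (hχV h)] with z hz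
        rw [image_eq_zero_of_notMem_tsupport hz]
        simp
      exact (continuousAt_const (y := (0 : F))).congr (h1.mono fun z hz => hz.symm)
  refine exists_cInf_of_forall (fun u => u ∈ AddSubmonoid.closure S) (fun u hu => ?_)
    (fun u hu i => ?_) (AddSubmonoid.subset_closure ⟨χ, hχ, hχV, [], rfl⟩)
  · induction hu using AddSubmonoid.closure_induction with
    | mem u hu =>
      obtain ⟨χ, hχ, hχV, α, rfl⟩ := hu
      exact (hSc χ hχ.continuous hχV α).comp continuous_subtype_val
    | zero => exact continuous_const
    | add u v _ _ hu hv => exact hu.add hv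
  · induction hu using AddSubmonoid.closure_induction with
    | zero =>
      exact ⟨0, zero_mem _, fun y => by simpa using tendsto_const_nhds⟩
    | add u u' _ _ hu hu' =>
      obtain ⟨v, hv, hd⟩ := hu
      obtain ⟨v', hv', hd'⟩ := hu'
      exact ⟨v + v', add_mem hv hv', hd.add hd'⟩
    | mem u hu =>
      obtain ⟨χ, hχ, hχV, α, rfl⟩ := hu
      set e : EuclideanSpace ℝ (Fin q) := EuclideanSpace.single i (1 : ℝ) with he
      set χ' : EuclideanSpace ℝ (Fin q) → ℝ := fun y => fderiv ℝ χ y e with hχ'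
      have hχ'd : ContDiff ℝ (⊤ : ℕ∞) χ' := (hχ.fderiv_right (by simp)).clm_apply contDiff_const
      have hχ'V : tsupport χ' ⊆ V := (tsupport_fderiv_apply_subset ℝ e).trans hχV
      refine ⟨(fun y : U => (χ' y : ℂ) • extU (D.1 α) y) +
        (fun y : U => (χ y : ℂ) • extU (D.1 (i :: α)) y),
        add_mem (AddSubmonoid.subset_closure ⟨χ', hχ'd, hχ'V, α, rfl⟩)
          (AddSubmonoid.subset_closure ⟨χ, hχ, hχV, i :: α, rfl⟩), ?_⟩
      rw [hasPartialDeriv_iff hU (w := fun y => (χ y : ℂ) • extU (D.1 α) y) fun _ => rfl]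
      intro y
      have hγ : Continuous fun t : ℝ => (y : EuclideanSpace ℝ (Fin q)) + t • e := by fun_prop
      have hγ0 : Tendsto (fun t : ℝ => (y : EuclideanSpace ℝ (Fin q)) + t • e) (𝓝[≠] 0)
          (𝓝 (y : EuclideanSpace ℝ (Fin q))) := by
        have := (hγ.tendsto 0).mono_left (nhdsWithin_le_nhds (s := {0}ᶜ))
        simpa using this
      by_cases hy : (y : EuclideanSpace ℝ (Fin q)) ∈ V
      · have h1 := (HasPartialDeriv.tendsto hV (D.2 α i) ⟨y, hy⟩)
        rw [← extU_coe (D.1 (i :: α))] at h1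
        have h2 : Tendsto (fun t : ℝ => (t : ℂ)⁻¹ * ((χ (y + t • e) : ℂ) - χ y)) (𝓝[≠] 0)
            (𝓝 (χ' y : ℂ)) := by
          have h3 : HasDerivAt (fun t : ℝ => χ (y + t • e)) (χ' y) 0 := by
            have h4 := (hχ.differentiable (by simp) (y : EuclideanSpace ℝ (Fin q))).hasFDerivAt
            exact h4.hasLineDerivAt e
          rw [hasDerivAt_iff_tendsto_slope_zero] at h3
          refine ((Complex.continuous_ofReal.tendsto _).comp h3).congr fun t => ?_
          simp
        have h3 : Tendsto (fun t : ℝ => (χ (y + t • e) : ℂ)) (𝓝[≠] 0) (𝓝 (χ y : ℂ)) :=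
          ((Complex.continuous_ofReal.comp hχ.continuous).tendsto _).comp hγ0
        refine ((h2.smul_const (extU (D.1 α) y)).add (h3.smul h1)).congr fun t => ?_
        simp only [← he]
        module
      · have h1 : (y : EuclideanSpace ℝ (Fin q)) ∈ (tsupport χ)ᶜ := fun h => hy (hχV h)
        have h2 := hγ0.eventually ((isClosed_tsupport χ).isOpen_compl.mem_nhds h1)
        have h3 : (y : EuclideanSpace ℝ (Fin q)) ∈ (tsupport χ')ᶜ := fun h => hy (hχ'V h)
        simp only [Pi.add_apply, image_eq_zero_of_notMem_tsupport h1,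
          image_eq_zero_of_notMem_tsupport h3, Complex.ofReal_zero, zero_smul, add_zero, sub_zero]
        refine tendsto_const_nhds.congr' ?_
        filter_upwards [h2] with t ht
        rw [image_eq_zero_of_notMem_tsupport ht]
        simp

/-- Transfer of smooth families along a graded linear relation with continuity estimates. -/
theorem exists_cInf_of_relation (hU : IsOpen U) (Γ : ℕ → Set (F × G))
    (hsub : ∀ m n, ∀ x ∈ Γ m, ∀ y ∈ Γ n, x - y ∈ Γ (m + n))
    (hsmul : ∀ m (c : ℂ), ∀ x ∈ Γ m, c • x ∈ Γ m)
    (hest : ∀ m, ∀ N ∈ 𝓝 (0 : G), ∃ M ∈ 𝓝 (0 : F), ∀ x ∈ Γ m, x.1 ∈ M → x.2 ∈ N)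
    (hcl : ∀ m, IsClosed (Prod.fst '' Γ m)) (D : CInf F U) (m : ℕ)
    (hD : ∀ y, ev D y ∈ Prod.fst '' Γ m) :
    ∃ D' : CInf G U, ∀ y, (ev D y, ev D' y) ∈ Γ m := by
  -- A difference quotient subtracts two elements, which adds their degrees, so each derivative
  -- doubles the degree. Closedness of the projection at the doubled degree lets the limit stay in
  -- it.
  have h1 : ∀ α y, D.1 α y ∈ Prod.fst '' Γ (2 ^ α.length * m) := by
    intro α
    induction α with
    | nil =>
      intro y
      rw [List.length_nil, pow_zero, one_mul]
      exact hD y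
    | cons i α ih =>
      intro y
      have h2 := HasPartialDeriv.tendsto hU (D.2 α i) y
      refine (hcl _).mem_of_tendsto h2 ?_
      filter_upwards [mem_nhdsWithin_of_mem_nhds (eventually_add_smul_mem hU y.2 _)] with t ht
      rw [extU_apply _ ht, extU_coe]
      obtain ⟨a, ha, ha'⟩ := ih ⟨_, ht⟩
      obtain ⟨b, hb, hb'⟩ := ih y
      refine ⟨(t : ℂ)⁻¹ • (a - b), ?_, by simp [ha', hb']⟩
      have := hsmul _ (t : ℂ)⁻¹ _ (hsub _ _ a ha b hb)
      rwa [show 2 ^ (i :: α).length * m = 2 ^ α.length * m + 2 ^ α.length * m by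
        rw [List.length_cons]; ring]
  have h2 : ∀ α y, ∃ b, (D.1 α y, b) ∈ Γ (2 ^ α.length * m) := by
    intro α y
    obtain ⟨⟨a, b⟩, hab, rfl⟩ := h1 α y
    exact ⟨b, hab⟩
  choose T hT using h2
  -- The partners in G are chosen point by point. Continuity, and below differentiability, follow by
  -- applying `hest` to differences of related pairs whose first component is small.
  have hc : ∀ α, Continuous (T α) := by
    refine fun α => continuous_iff_continuousAt.2 fun y => ?_
    refine tendsto_sub_nhds_zero_iff.1 fun N hN => ?_
    obtain ⟨M, hM, hMN⟩ := hest (2 ^ α.length * m + 2 ^ α.length * m) N hN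
    have h3 := tendsto_sub_nhds_zero_iff.2 ((D.1 α).continuous.tendsto y)
    have h3' : {z | D.1 α z - D.1 α y ∈ M} ∈ 𝓝 y := h3 hM
    rw [mem_map]
    filter_upwards [h3'] with z hz
    exact hMN _ (hsub _ _ _ (hT α z) _ (hT α y)) hz
  refine ⟨⟨fun α => ⟨T α, hc α⟩, fun α i => ?_⟩, fun y => ?_⟩
  · refine (hasPartialDeriv_iff hU (extU_coe _)).2 fun y => ?_
    refine tendsto_sub_nhds_zero_iff.1 fun N hN => ?_
    -- This is the degree of a difference quotient of order α minus the candidate for its limit.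
    obtain ⟨M, hM, hMN⟩ := hest ((2 ^ α.length * m + 2 ^ α.length * m) +
      2 ^ (i :: α).length * m) N hN
    have h3 := tendsto_sub_nhds_zero_iff.2 (HasPartialDeriv.tendsto hU (D.2 α i) y)
    have h4 : {t : ℝ | (y : EuclideanSpace ℝ (Fin q)) + t • EuclideanSpace.single i (1 : ℝ) ∈ U} ∈
        𝓝[≠] (0 : ℝ) :=
      mem_nhdsWithin_of_mem_nhds (eventually_add_smul_mem hU y.2 _)
    rw [mem_map]
    filter_upwards [mem_map.1 (h3 hM), h4] with t ht ht'
    have h5 := hsub _ _ _ (hsmul _ (t : ℂ)⁻¹ _ (hsub _ _ _ (hT α ⟨_, ht'⟩) _ (hT α y))) _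
      (hT (i :: α) y)
    have ht : (t : ℂ)⁻¹ • (extU (D.1 α) (y + t • EuclideanSpace.single i (1 : ℝ)) -
      extU (D.1 α) y) - D.1 (i :: α) y ∈ M := ht
    rw [extU_apply _ ht', extU_coe] at ht
    have h6 := hMN _ h5 ht
    change (t : ℂ)⁻¹ • (extU (T α) (y + t • EuclideanSpace.single i (1 : ℝ)) -
      extU (T α) y) - T (i :: α) y ∈ N
    rw [extU_apply _ ht', extU_coe]
    exact h6
  · have := hT [] y
    rw [List.length_nil, pow_zero, one_mul] at this
    exact this

end Mellin

/-! ### Closed ranges and meromorphic functions with denominators -/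

namespace FrechetSpace

/-- The hypothesis is a lower estimate. It makes f uniformly inducing, so the range is complete and
therefore closed. -/
theorem isClosed_range_of_nhds {V W : Type*} [AddCommGroup V] [Module ℂ V] [TopologicalSpace V]
    [FrechetSpace V] [AddCommGroup W] [Module ℂ W] [TopologicalSpace W] [FrechetSpace W]
    (f : V →L[ℂ] W) (h : ∀ N ∈ 𝓝 (0 : V), ∃ M ∈ 𝓝 (0 : W), ∀ x, f x ∈ M → x ∈ N) :
    IsClosed (range f) := by
  let _ : UniformSpace W := IsTopologicalAddGroup.rightUniformSpace W
  have : IsUniformAddGroup W := isUniformAddGroup_of_addCommGroup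
  let _ : UniformSpace V := IsTopologicalAddGroup.rightUniformSpace V
  have : IsUniformAddGroup V := isUniformAddGroup_of_addCommGroup
  have : CompleteSpace V := FrechetSpace.complete
  have h0 : 𝓝 (0 : V) = comap f (𝓝 0) := by
    refine le_antisymm ?_ fun N hN => ?_
    · rw [← tendsto_iff_comap]
      simpa using f.continuous.tendsto 0
    · obtain ⟨M, hM, hMN⟩ := h N hN
      exact mem_comap.2 ⟨M, hM, hMN⟩
  have hu : IsUniformInducing f := by
    refine ⟨?_⟩
    rw [uniformity_eq_comap_nhds_zero V, uniformity_eq_comap_nhds_zero W, comap_comap,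
      h0, comap_comap]
    congr 1
    funext p
    simp
  exact ((completeSpace_iff_isComplete_range hu).1 inferInstance).isClosed

end FrechetSpace

namespace Mellin

theorem multiset_map_toList_get (s : Multiset ℂ) : Finset.univ.val.map
    (fun j : Fin s.card => s.toList.get (j.cast (Multiset.length_toList s).symm)) = s := by
  have hl : ∀ l : List ℂ, Finset.univ.val.map (fun j : Fin l.length => l.get j) = l := by
    intro l
    simp
  have h : ∀ (n : ℕ) (hn : n = s.toList.length), Finset.univ.val.map
      (fun j : Fin n => s.toList.get (j.cast hn)) = s := by
    rintro n rfl
    exact (hl s.toList).trans (Multiset.coe_toList s)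
  exact h _ _

/-- The monic polynomial function with the multiset `s` of zeros. -/
noncomputable def rootProd (s : Multiset ℂ) (z : ℂ) : ℂ := (s.map fun a => z - a).prod

section rootProd

variable {s t : Multiset ℂ} {z : ℂ}

theorem rootProd_zero (z : ℂ) : rootProd 0 z = 1 := by simp [rootProd]

theorem rootProd_cons (a : ℂ) (s : Multiset ℂ) (z : ℂ) :
    rootProd (a ::ₘ s) z = (z - a) * rootProd s z := by simp [rootProd]

theorem rootProd_add (s t : Multiset ℂ) (z : ℂ) :
    rootProd (s + t) z = rootProd s z * rootProd t z := by simp [rootProd]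

theorem rootProd_ne_zero (h : z ∉ s) : rootProd s z ≠ 0 := by
  refine Multiset.prod_ne_zero fun h0 => ?_
  obtain ⟨a, ha, h1⟩ := Multiset.mem_map.1 h0
  rw [sub_eq_zero.1 h1] at h
  exact h ha

theorem differentiable_rootProd (s : Multiset ℂ) : Differentiable ℂ (rootProd s) := by
  induction s using Multiset.induction_on with
  | empty => simp [funext rootProd_zero]
  | cons a s ih =>
    rw [funext (rootProd_cons a s)]
    exact (differentiable_id.sub_const a).mul ih

theorem pow_le_norm_rootProd {d : ℝ} (hd : 0 ≤ d) (h : ∀ a ∈ s, d ≤ ‖z - a‖) :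
    d ^ s.card ≤ ‖rootProd s z‖ := by
  induction s using Multiset.induction_on with
  | empty => simp [rootProd_zero]
  | cons a s ih =>
    rw [rootProd_cons, Multiset.card_cons, pow_succ', norm_mul]
    exact mul_le_mul (h a (Multiset.mem_cons_self a s))
      (ih fun b hb => h b (Multiset.mem_cons_of_mem hb)) (by positivity) (norm_nonneg _)

theorem norm_rootProd_le_pow {r : ℝ} (h : ∀ a ∈ s, ‖z - a‖ ≤ r) :
    ‖rootProd s z‖ ≤ r ^ s.card := by
  induction s using Multiset.induction_on with
  | empty => simp [rootProd_zero]
  | cons a s ih =>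
    rw [rootProd_cons, Multiset.card_cons, pow_succ', norm_mul]
    have h1 := h a (Multiset.mem_cons_self a s)
    exact mul_le_mul h1 (ih fun b hb => h b (Multiset.mem_cons_of_mem hb)) (norm_nonneg _)
      ((norm_nonneg _).trans h1)

theorem continuous_rootProd_map (k : ℕ) :
    Continuous fun x : (Fin k → ℂ) × ℂ => rootProd (Finset.univ.val.map x.1) x.2 := by
  have : (fun x : (Fin k → ℂ) × ℂ => rootProd (Finset.univ.val.map x.1) x.2) =
      fun x => ∏ j, (x.2 - x.1 j) := by
    funext x
    rw [rootProd, Multiset.map_map]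
    rfl
  rw [this]
  fun_prop

end rootProd

theorem exists_dist_lower_bound {L Z : Set ℂ} (hL : IsCompact L) (hZ : IsClosed Z)
    (h : Disjoint L Z) : ∃ d : ℝ, 0 < d ∧ d ≤ 1 ∧ ∀ z ∈ L, ∀ a ∈ Z, d ≤ ‖z - a‖ := by
  obtain ⟨r, hr, hr'⟩ := Metric.exists_pos_forall_lt_edist hL hZ h
  refine ⟨min r 1, lt_min (by exact_mod_cast hr) one_pos, min_le_right _ _, fun z hz a ha => ?_⟩
  have := hr' z hz a ha
  rw [edist_dist, ← ENNReal.ofReal_coe_nnreal, ENNReal.ofReal_lt_ofReal_iff_of_nonneg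
    (by positivity), dist_eq_norm] at this
  exact (min_le_left _ _).trans this.le

theorem exists_dist_upper_bound {L Z : Set ℂ} (hL : IsCompact L) (hZ : IsCompact Z) :
    ∃ r : ℝ, 1 ≤ r ∧ ∀ z ∈ L, ∀ a ∈ Z, ‖z - a‖ ≤ r := by
  obtain ⟨r, hr⟩ := (hL.union hZ).isBounded.subset_closedBall 0 |>.imp fun _ h => h
  refine ⟨max 1 (r + r), le_max_left _ _, fun z hz a ha => le_max_of_le_right ?_⟩
  have h1 := hr (Or.inl hz)
  have h2 := hr (Or.inr ha)
  rw [mem_closedBall_zero_iff] at h1 h2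
  exact (norm_sub_le _ _).trans (add_le_add h1 h2)

/-- An open set with compact boundary in `D` that contains `W \ D` and a compact subset of `W`. -/
theorem exists_isOpen_frontier_subset {W D L : Set ℂ} (hW : IsOpen W) (hK : IsCompact (W \ D))
    (hL : IsCompact L) (hLW : L ⊆ W) : ∃ V : Set ℂ, Bornology.IsBounded V ∧ L ⊆ V ∧ W \ D ⊆ V ∧
      closure V ⊆ W ∧ IsCompact (frontier V) ∧ frontier V ⊆ D := by
  obtain ⟨V, hVo, hV, hVW, hVc⟩ := exists_open_between_and_isCompact_closure (hL.union hK) hW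
    (union_subset hLW sdiff_subset)
  refine ⟨V, hVc.isBounded.subset subset_closure, subset_union_left.trans hV,
    subset_union_right.trans hV, hVW, hVc.of_isClosed_subset isClosed_frontier
      frontier_subset_closure, fun z hz => ?_⟩
  by_contra hzD
  rw [hVo.frontier_eq] at hz
  exact hz.2 (hV (Or.inr ⟨hVW hz.1, hzD⟩))

variable {E : Type*} [AddCommGroup E] [Module ℂ E] [TopologicalSpace E] [FrechetSpace E]

/-- The function `u` on `D` extends to a meromorphic function on `W` with denominator
`rootProd s`. -/
def HasDen (W D : Set ℂ) (s : Multiset ℂ) (u : ℂ → E) : Prop :=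
  ∃ v : ℂ → E, HolOn v W ∧ ∀ z ∈ D, v z = rootProd s z • u z

namespace HasDen

variable {W D : Set ℂ} {s t : Multiset ℂ} {u w : ℂ → E}

theorem congr (h : HasDen W D s u) (huw : ∀ z ∈ D, w z = u z) : HasDen W D s w := by
  obtain ⟨v, hv, hvu⟩ := h
  exact ⟨v, hv, fun z hz => by rw [hvu z hz, huw z hz]⟩

theorem mono {W' D' : Set ℂ} (h : HasDen W D s u) (hW : W' ⊆ W) (hD : D' ⊆ D) :
    HasDen W' D' s u := by
  obtain ⟨v, hv, hvu⟩ := h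
  exact ⟨v, hv.mono hW, fun z hz => hvu z (hD hz)⟩

theorem add_left (h : HasDen W D s u) (t : Multiset ℂ) : HasDen W D (t + s) u := by
  obtain ⟨v, hv, hvu⟩ := h
  refine ⟨_, hv.smul (differentiable_rootProd t).differentiableOn, fun z hz => ?_⟩
  rw [hvu z hz, smul_smul, rootProd_add]

theorem of_le (h : HasDen W D s u) (hst : s ≤ t) : HasDen W D t u := by
  obtain ⟨r, rfl⟩ := Multiset.le_iff_exists_add.1 hst
  rw [add_comm]
  exact h.add_left r

theorem add (h : HasDen W D s u) (h' : HasDen W D s w) : HasDen W D s (fun z => u z + w z) := by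
  obtain ⟨v, hv, hvu⟩ := h
  obtain ⟨v', hv', hvu'⟩ := h'
  exact ⟨_, hv.add hv', fun z hz => by rw [hvu z hz, hvu' z hz, smul_add]⟩

theorem sub (h : HasDen W D s u) (h' : HasDen W D t w) :
    HasDen W D (s + t) (fun z => u z - w z) := by
  obtain ⟨v, hv, hvu⟩ := h.add_left t
  obtain ⟨v', hv', hvu'⟩ := h'.add_left s
  rw [add_comm] at hvu
  exact ⟨_, hv.sub hv', fun z hz => by rw [hvu z hz, hvu' z hz, smul_sub]⟩

theorem const_smul (c : ℂ) (h : HasDen W D s u) : HasDen W D s (fun z => c • u z) := by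
  obtain ⟨v, hv, hvu⟩ := h
  exact ⟨_, hv.const_smul c, fun z hz => by rw [hvu z hz, smul_comm]⟩

theorem of_holOn (h : HolOn u W) (s : Multiset ℂ) : HasDen W D s u :=
  ⟨_, h.smul (differentiable_rootProd s).differentiableOn, fun _ _ => rfl⟩

/-- The values on a compact set of the meromorphic extension of a function on `D` are bounded by
the values on a compact subset of `D`. -/
theorem exists_estimate (hW : IsOpen W) (hK : IsCompact (W \ D)) {Z L : Set ℂ}
    (hZ : IsClosed Z) (hZK : Z ⊆ W \ D) (hL : IsCompact L) (hLW : L ⊆ W \ Z) (m : ℕ) :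
    ∃ Γ ⊆ D, IsCompact Γ ∧ ∃ C : ℝ, 0 < C ∧ ∀ p : Seminorm ℂ E, Continuous p →
      ∀ s : Multiset ℂ, (∀ a ∈ s, a ∈ Z) → s.card ≤ m → ∀ u v w : ℂ → E, HolOn v W →
      (∀ z ∈ D, v z = rootProd s z • u z) → (∀ z ∈ L, v z = rootProd s z • w z) →
      ∀ B : ℝ, 0 ≤ B → (∀ z ∈ Γ, p (u z) ≤ B) → ∀ z ∈ L, p (w z) ≤ C * B := by
  obtain ⟨V, hVb, hLV, hKV, hVW, hVf, hVD⟩ := exists_isOpen_frontier_subset hW hK hL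
    (hLW.trans sdiff_subset)
  obtain ⟨d, hd, hd1, hd'⟩ := exists_dist_lower_bound hL hZ
    (disjoint_left.2 fun z hz => (hLW hz).2)
  obtain ⟨r, hr, hr'⟩ := exists_dist_upper_bound hVf (hK.of_isClosed_subset hZ hZK)
  -- r bounds the factors of the denominator from above on the frontier, and d bounds them from
  -- below on L. Taking r ≥ 1 and d ≤ 1 makes the m-th powers valid for every degree up to m.
  refine ⟨frontier V, hVD, hVf, r ^ m / d ^ m, by positivity,
    fun p hp s hs hsm u v w hv hvu hvw B hB0 hB z hz => ?_⟩
  have h1 : p (v z) ≤ r ^ m * B := by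
    refine hv.seminorm_le_of_frontier hVb hVW hp (fun x hx => ?_) (subset_closure (hLV hz))
    rw [hvu x (hVD hx), map_smul_eq_mul]
    refine mul_le_mul ?_ (hB x hx) (apply_nonneg _ _) (by positivity)
    exact (norm_rootProd_le_pow fun a ha => hr' x hx a (hs a ha)).trans
      (pow_le_pow_right₀ hr hsm)
  rw [hvw z hz, map_smul_eq_mul] at h1
  have h2 : d ^ m ≤ ‖rootProd s z‖ := (pow_le_pow_of_le_one hd.le hd1 hsm).trans
    (pow_le_norm_rootProd hd.le fun a ha => hd' z hz a (hs a ha))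
  rw [div_mul_eq_mul_div, le_div_iff₀ (by positivity), mul_comm]
  exact (mul_le_mul_of_nonneg_right h2 (apply_nonneg _ _)).trans h1

end HasDen

/-- The maximum principle, in the form of `HasDen.exists_estimate` in degree 0, bounds a function on
W by its values on a compact subset of D. -/
theorem isClosed_range_resL {W D : Set ℂ} (hW : IsOpen W) (hD : IsOpen D) (hDW : D ⊆ W)
    (hK : IsCompact (W \ D)) : IsClosed (range (Hol.resL (E := E) hDW)) := by
  have := Hol.frechetSpace (E := E) hW
  have := Hol.frechetSpace (E := E) hD
  refine FrechetSpace.isClosed_range_of_nhds _ fun N hN => ?_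
  obtain ⟨L, p, hL, hLW, hp, hLN⟩ := Hol.exists_seminorm_subset hN
  obtain ⟨Γ, hΓD, hΓ, C, hC, h⟩ := HasDen.exists_estimate (E := E) hW hK isClosed_empty
    (empty_subset _) hL (by simpa using hLW) 0
  refine ⟨_, Hol.setOf_seminorm_lt_mem_nhds hΓ hΓD hp (r := 1 / (2 * C)) (by positivity),
    fun f hf => hLN fun z hz => ?_⟩
  have h1 := h p hp 0 (by simp) (by simp) (fn (Hol.resL hDW f)) (fn f) (fn f) (fn_holOn f hW)
    (fun z hz => by rw [rootProd_zero, one_smul, Hol.fn_resL hDW f hz])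
    (fun z hz => by rw [rootProd_zero, one_smul]) (1 / (2 * C)) (by positivity)
    (fun z hz => (hf z hz).le) z hz
  refine h1.trans_lt ?_
  field_simp
  norm_num

/-- For each degree k ≤ m the zeros range over the compact space of maps from `Fin k` to Z. The
pairs (zeros, u) whose product extends form a closed set, as the preimage of a closed range under a
continuous map, and projection along a compact factor is a closed map. -/
theorem isClosed_setOf_hasDen {W D Z : Set ℂ} (hW : IsOpen W) (hD : IsOpen D) (hDW : D ⊆ W)
    (hK : IsCompact (W \ D)) (hZ : IsCompact Z) (m : ℕ) :
    IsClosed {u : Hol E D | ∃ s : Multiset ℂ, (∀ a ∈ s, a ∈ Z) ∧ s.card ≤ m ∧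
      HasDen W D s (fn u)} := by
  have : LocallyCompactSpace D := hD.locallyCompactSpace
  have : CompactSpace Z := isCompact_iff_compactSpace.1 hZ
  let ms : ∀ k, (Fin k → Z) → Multiset ℂ := fun k a => Finset.univ.val.map fun j => (a j : ℂ)
  have hhol : ∀ k (x : (Fin k → Z) × Hol E D),
      HolOn (fun z => rootProd (ms k x.1) z • fn x.2 z) D := fun k x =>
    (fn_holOn x.2 hD).smul (differentiable_rootProd _).differentiableOn
  let T : ∀ k, (Fin k → Z) × Hol E D → Hol E D := fun k x => (hhol k x).toHol hD
  have hT : ∀ k, Continuous (T k) := by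
    intro k
    refine continuous_induced_rng.2 (ContinuousMap.continuous_of_continuous_uncurry _ ?_)
    have h1 : Continuous fun y : ((Fin k → Z) × Hol E D) × D =>
        rootProd (ms k y.1.1) (y.2 : ℂ) • y.1.2.1 y.2 := by
      refine Continuous.smul ?_ ?_
      · exact (continuous_rootProd_map k).comp (f := fun y : ((Fin k → Z) × Hol E D) × D =>
          ((fun j => (y.1.1 j : ℂ)), (y.2 : ℂ))) (by fun_prop)
      · exact (continuous_subtype_val.comp (continuous_snd.comp continuous_fst)).eval
          continuous_snd
    convert h1 using 2 with y
    change rootProd (ms k y.1.1) (y.2 : ℂ) • fn y.1.2 y.2 = _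
    rw [fn_coe]
  have hcl := isClosed_range_resL (E := E) hW hD hDW hK
  have key : {u : Hol E D | ∃ s : Multiset ℂ, (∀ a ∈ s, a ∈ Z) ∧ s.card ≤ m ∧
      HasDen W D s (fn u)} =
      ⋃ k ∈ Finset.range (m + 1), Prod.snd '' (T k ⁻¹' range (Hol.resL (E := E) hDW)) := by
    ext u
    simp only [mem_ofPred_eq, mem_iUnion, Finset.mem_range, Order.lt_add_one_iff, mem_image,
      mem_preimage, exists_prop]
    constructor
    · rintro ⟨s, hs, hsm, v, hv, hvu⟩
      refine ⟨s.card, hsm, ⟨⟨fun j => ⟨s.toList.get (j.cast (by simp)), ?_⟩, u⟩, ?_, rfl⟩⟩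
      · exact hs _ (Multiset.mem_toList.1 (List.get_mem _ _))
      · refine ⟨hv.toHol hW, ext_fn fun z hz => ?_⟩
        rw [Hol.fn_resL hDW _ hz, HolOn.fn_toHol _ _ (hDW hz), HolOn.fn_toHol _ _ hz, hvu z hz]
        congr 2
        exact (multiset_map_toList_get s).symm
    · rintro ⟨k, hk, ⟨⟨a, u⟩, ⟨v, hv⟩, rfl⟩⟩
      refine ⟨ms k a, ?_, by simpa [ms] using hk, fn v, fn_holOn v hW, fun z hz => ?_⟩
      · intro b hb
        obtain ⟨j, -, rfl⟩ := Multiset.mem_map.1 hb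
        exact (a j).2
      · rw [← Hol.fn_resL hDW v hz, hv, HolOn.fn_toHol _ _ hz]
  rw [key]
  refine Set.Finite.isClosed_biUnion (Finset.finite_toSet _) fun k _ => ?_
  exact isClosedMap_snd_of_compactSpace _ (hcl.preimage (hT k))

/-- Smooth families of functions on `D` with denominators of bounded degree and zeros in `Z` are
smooth as families of functions on any open subset of `W \ Z`. -/
theorem exists_cInf_extend {q : ℕ} {U : Set (EuclideanSpace ℝ (Fin q))} (hU : IsOpen U)
    {W D D' Z : Set ℂ} (hW : IsOpen W) (hD : IsOpen D) (hDW : D ⊆ W) (hK : IsCompact (W \ D))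
    (hZ : IsCompact Z) (hZK : Z ⊆ W \ D) (hD' : IsOpen D') (hDW' : D' ⊆ W \ Z)
    (g : CInf (Hol E D) U) (m : ℕ)
    (hg : ∀ y, ∃ s : Multiset ℂ, (∀ a ∈ s, a ∈ Z) ∧ s.card ≤ m ∧ HasDen W D s (fn (ev g y))) :
    ∃ g' : CInf (Hol E D') U, ∀ y, ∃ s : Multiset ℂ, (∀ a ∈ s, a ∈ Z) ∧ s.card ≤ m ∧
      ∃ v : ℂ → E, HolOn v W ∧ (∀ z ∈ D, v z = rootProd s z • fn (ev g y) z) ∧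
        ∀ z ∈ D', v z = rootProd s z • fn (ev g' y) z := by
  have := Hol.frechetSpace (E := E) hD
  have := Hol.frechetSpace (E := E) hD'
  -- The relation joins the restrictions to D and to D' of one meromorphic function on W; its degree
  -- bounds the number of zeros of a common denominator.
  let Γ : ℕ → Set (Hol E D × Hol E D') := fun m => {x | ∃ s : Multiset ℂ, (∀ a ∈ s, a ∈ Z) ∧
    s.card ≤ m ∧ ∃ v : ℂ → E, HolOn v W ∧ (∀ z ∈ D, v z = rootProd s z • fn x.1 z) ∧
        ∀ z ∈ D', v z = rootProd s z • fn x.2 z}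
  have hfst : ∀ m, Prod.fst '' Γ m = {u : Hol E D | ∃ s : Multiset ℂ, (∀ a ∈ s, a ∈ Z) ∧
      s.card ≤ m ∧ HasDen W D s (fn u)} := by
    intro m
    ext u
    constructor
    · rintro ⟨⟨u, u'⟩, ⟨s, hs, hsm, v, hv, h1, h2⟩, rfl⟩
      exact ⟨s, hs, hsm, v, hv, h1⟩
    · rintro ⟨s, hs, hsm, v, hv, h1⟩
      have hne : ∀ z ∈ D', rootProd s z ≠ 0 := fun z hz =>
        rootProd_ne_zero fun hzs => (hDW' hz).2 (hs z hzs)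
      have hol : HolOn (fun z => (rootProd s z)⁻¹ • v z) D' :=
        (hv.mono (hDW'.trans sdiff_subset)).smul
          ((differentiable_rootProd s).differentiableOn.inv hne)
      refine ⟨⟨u, hol.toHol hD'⟩, ⟨s, hs, hsm, v, hv, h1, fun z hz => ?_⟩, rfl⟩
      rw [HolOn.fn_toHol _ _ hz, smul_inv_smul₀ (hne z hz)]
  refine exists_cInf_of_relation hU Γ ?_ ?_ ?_ ?_ g m fun y => ?_
  · rintro m n ⟨x, x'⟩ ⟨s, hs, hsm, v, hv, h1, h2⟩ ⟨y, y'⟩ ⟨t, ht, htn, w, hw, h3, h4⟩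
    refine ⟨s + t, fun a ha => (Multiset.mem_add.1 ha).elim (hs a) (ht a),
      by rw [Multiset.card_add]; omega, _,
      (hv.smul (differentiable_rootProd t).differentiableOn).sub
        (hw.smul (differentiable_rootProd s).differentiableOn), fun z hz => ?_, fun z hz => ?_⟩
    · simp only [Prod.fst_sub, fn_sub]
      rw [h1 z hz, h3 z hz, rootProd_add]
      module
    · simp only [Prod.snd_sub, fn_sub]
      rw [h2 z hz, h4 z hz, rootProd_add]
      module
  · rintro m c ⟨x, x'⟩ ⟨s, hs, hsm, v, hv, h1, h2⟩
    refine ⟨s, hs, hsm, _, hv.const_smul c, fun z hz => ?_, fun z hz => ?_⟩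
    · simp only [Prod.smul_fst, fn_smul]
      rw [h1 z hz, smul_comm]
    · simp only [Prod.smul_snd, fn_smul]
      rw [h2 z hz, smul_comm]
  · intro m N hN
    obtain ⟨L, p, hL, hLW, hp, hLN⟩ := Hol.exists_seminorm_subset hN
    obtain ⟨Γ', hΓD, hΓ, C, hC, h⟩ := HasDen.exists_estimate (E := E) hW hK hZ.isClosed
      hZK hL (hLW.trans hDW') m
    refine ⟨_, Hol.setOf_seminorm_lt_mem_nhds hΓ hΓD hp (r := 1 / (2 * C)) (by positivity), ?_⟩
    rintro ⟨x, x'⟩ ⟨s, hs, hsm, v, hv, h1, h2⟩ hx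
    refine hLN fun z hz => (h p hp s hs hsm _ v _ hv h1 (fun z hz => h2 z (hLW hz)) (1 / (2 * C))
      (by positivity) (fun z hz => (hx z hz).le) z hz).trans_lt ?_
    field_simp
    norm_num
  · intro m
    rw [hfst]
    exact isClosed_setOf_hasDen hW hD hDW hK hZ m
  · rw [hfst]
    exact hg y

end Mellin

/-! ### Principal parts -/

namespace Mellin

theorem tendsto_norm_rootProd_cons (a : ℂ) (s : Multiset ℂ) :
    Tendsto (fun z => ‖rootProd (a ::ₘ s) z‖) (cocompact ℂ) atTop := by
  have h1 : ∀ a : ℂ, Tendsto (fun z => ‖z - a‖) (cocompact ℂ) atTop := fun a => by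
    have := tendsto_norm_cocompact_atTop.comp
      (Homeomorph.subRight a).isClosedEmbedding.tendsto_cocompact
    exact this
  induction s using Multiset.induction_on generalizing a with
  | empty =>
    simp only [rootProd_cons, rootProd_zero, mul_one]
    exact h1 a
  | cons b s ih =>
    simp only [rootProd_cons a, norm_mul]
    exact (h1 a).atTop_mul_atTop₀ (ih b)

variable {E : Type*} [AddCommGroup E] [Module ℂ E] [TopologicalSpace E] [FrechetSpace E]

/-- Two functions that agree on the overlap of two open sets glue to a holomorphic function. -/
theorem HolOn.exists_glue {u v : ℂ → E} {V W : Set ℂ} (hu : HolOn u V) (hv : HolOn v W)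
    (hV : IsOpen V) (hW : IsOpen W) (h : ∀ z ∈ V ∩ W, u z = v z) :
    ∃ w : ℂ → E, HolOn w (V ∪ W) ∧ EqOn w u V ∧ EqOn w v W := by
  classical
  have h1 : EqOn (V.piecewise u v) u V := fun z hz => piecewise_eq_of_mem _ _ _ hz
  have h2 : EqOn (V.piecewise u v) v W := fun z hz => by
    by_cases hzV : z ∈ V
    · rw [h1 hzV, h z ⟨hzV, hz⟩]
    · exact piecewise_eq_of_notMem _ _ _ hzV
  exact ⟨_, (hu.congr h1).union (hv.congr h2) hV hW, h1, h2⟩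

/-- Liouville's theorem for the splitting of a function into a part that is holomorphic off a
compact set and vanishes at infinity, and a part that is holomorphic near this compact set. -/
theorem HolOn.eq_of_splitting {S X : Set ℂ} (hS : IsOpen S) (hX : IsCompact X) (hXS : X ⊆ S)
    {u u' h h' : ℂ → E} (hu : HolOn u Xᶜ) (hu' : HolOn u' Xᶜ)
    (hu0 : Tendsto u (cocompact ℂ) (𝓝 0)) (hu0' : Tendsto u' (cocompact ℂ) (𝓝 0))
    (hh : HolOn h S) (hh' : HolOn h' S) (heq : ∀ z ∈ S \ X, u z + h z = u' z + h' z) :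
    ∀ z ∈ Xᶜ, u z = u' z := by
  obtain ⟨w, hw, hw1, hw2⟩ := (hu.sub hu').exists_glue (hh'.sub hh) hX.isClosed.isOpen_compl hS
    fun z hz => by
      have := heq z ⟨hz.2, hz.1⟩
      rw [sub_eq_sub_iff_add_eq_add, this, add_comm]
  have huniv : Xᶜ ∪ S = univ := eq_univ_of_forall fun z => by
    by_cases hz : z ∈ X
    · exact Or.inr (hXS hz)
    · exact Or.inl hz
  rw [huniv] at hw
  have h0 : Tendsto w (cocompact ℂ) (𝓝 0) := by
    have := hu0.sub hu0'
    rw [sub_zero] at this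
    refine this.congr' ?_
    filter_upwards [hX.compl_mem_cocompact] with z hz using (hw1 hz).symm
  intro z hz
  exact sub_eq_zero.1 ((hw1 hz).symm.trans (hw.eq_zero_of_tendsto_cocompact h0 z))

/-- Splitting of `v / rootProd s` into its principal parts and a holomorphic remainder, by
Newton interpolation, with an estimate for the principal parts. -/
theorem exists_splitting {S X V L : Set ℂ} (hS : IsOpen S) (hX : IsCompact X) (hXV : X ⊆ V)
    (hVb : Bornology.IsBounded V) (hVS : closure V ⊆ S) (hVc : IsCompact (frontier V))
    (hVX : Disjoint (frontier V) X) (hL : IsCompact L) (hLX : Disjoint L X) (m : ℕ) :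
    ∃ C : ℝ, 0 < C ∧ ∀ s : Multiset ℂ, (∀ a ∈ s, a ∈ X) → s.card = m → ∀ v : ℂ → E, HolOn v S →
      ∃ N h : ℂ → E, HasDen univ Xᶜ s N ∧ HolOn N Xᶜ ∧ Tendsto N (cocompact ℂ) (𝓝 0) ∧
        HolOn h S ∧ (∀ z ∈ S \ X, v z = rootProd s z • (N z + h z)) ∧
        ∀ p : Seminorm ℂ E, Continuous p → ∀ B : ℝ, 0 ≤ B → (∀ z ∈ frontier V, p (v z) ≤ B) →
          ∀ z ∈ L, p (N z) ≤ C * B := by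
  obtain ⟨d, hd, hd1, hd'⟩ := exists_dist_lower_bound hVc hX.isClosed hVX
  obtain ⟨e, he, he1, he'⟩ := exists_dist_lower_bound hL hX.isClosed hLX
  induction m with
  | zero =>
    refine ⟨1, one_pos, fun s _ hs v hv => ?_⟩
    rw [Multiset.card_eq_zero] at hs
    subst hs
    refine ⟨fun _ => 0, v, .of_holOn (.const 0) _, .const 0, tendsto_const_nhds, hv,
      fun z _ => by rw [rootProd_zero, one_smul, zero_add], fun p _ B hB _ z _ => ?_⟩
    rw [map_zero, one_mul]
    exact hB
  | succ m ih =>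
    obtain ⟨C, hC, ih⟩ := ih
    -- Writing v = v(a) + (z - a) v₁ splits off v(a)/`rootProd (a ::ₘ s)`, which accounts for the
    -- first summand. Since v₁ is at most 2B/d on the frontier, induction for v₁/`rootProd s`
    -- accounts for the second.
    refine ⟨1 / e ^ (m + 1) + C * (2 / d), by positivity, fun s hsX hs v hv => ?_⟩
    obtain ⟨a, has⟩ := Multiset.exists_mem_of_ne_zero (s := s) (by rintro rfl; simp at hs)
    obtain ⟨s, rfl⟩ := Multiset.exists_cons_of_mem has
    have ha : a ∈ X := hsX a (Multiset.mem_cons_self a s)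
    have hs' : s.card = m := by simpa using hs
    have haS : a ∈ S := hVS (subset_closure (hXV ha))
    obtain ⟨v₁, hv₁, hvv⟩ := hv.exists_slope hS haS
    obtain ⟨N, h, ⟨w, hw, hwN⟩, hN, hN0, hh, heq, hest⟩ := ih s
      (fun b hb => hsX b (Multiset.mem_cons_of_mem hb)) hs' v₁ hv₁
    have hne : ∀ z ∈ Xᶜ, rootProd (a ::ₘ s) z ≠ 0 := fun z hz =>
      rootProd_ne_zero fun hzs => hz (hsX z hzs)
    refine ⟨fun z => (rootProd (a ::ₘ s) z)⁻¹ • v a + N z, h, ⟨fun z => v a + (z - a) • w z,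
      (HolOn.const _).add (hw.smul (by fun_prop)), fun z hz => ?_⟩, ?_, ?_, hh, fun z hz => ?_, ?_⟩
    · beta_reduce
      rw [smul_add, smul_inv_smul₀ (hne z hz), hwN z hz, rootProd_cons, smul_smul]
    · exact ((HolOn.const _).smul ((differentiable_rootProd _).differentiableOn.inv hne)).add hN
    · have h0 : Tendsto (fun z => (rootProd (a ::ₘ s) z)⁻¹) (cocompact ℂ) (𝓝 0) :=
        tendsto_zero_iff_norm_tendsto_zero.2 (by
          simp only [norm_inv]
          exact (tendsto_norm_rootProd_cons a s).inv_tendsto_atTop)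
      simpa using (h0.smul_const (v a)).add hN0
    · rw [add_assoc, smul_add, smul_inv_smul₀ (hne z hz.2), rootProd_cons, mul_smul, ← heq z hz,
        ← hvv]
    · intro p hp B hB0 hB z hz
      have h1 : p (v a) ≤ B :=
        hv.seminorm_le_of_frontier hVb hVS hp hB (subset_closure (hXV ha))
      have h2 : ∀ z ∈ frontier V, p (v₁ z) ≤ 2 / d * B := by
        intro z hz
        have h3 := hd' z hz a ha
        have h4 : p ((z - a) • v₁ z) ≤ B + B := by
          rw [show (z - a) • v₁ z = v z - v a by rw [hvv z]; abel]
          exact (map_sub_le_add p _ _).trans (add_le_add (hB z hz) h1)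
        rw [map_smul_eq_mul] at h4
        rw [div_mul_eq_mul_div, le_div_iff₀ hd, mul_comm, two_mul]
        exact (mul_le_mul_of_nonneg_right h3 (apply_nonneg _ _)).trans h4
      have h5 := hest p hp (2 / d * B) (by positivity) h2 z hz
      have h6 : e ^ (m + 1) ≤ ‖rootProd (a ::ₘ s) z‖ := by
        rw [← hs]
        exact pow_le_norm_rootProd he.le fun b hb => he' z hz b (hsX b hb)
      have h7 : p ((rootProd (a ::ₘ s) z)⁻¹ • v a) ≤ 1 / e ^ (m + 1) * B := by
        rw [map_smul_eq_mul, norm_inv, ← one_div]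
        exact mul_le_mul (one_div_le_one_div_of_le (by positivity) h6) h1 (apply_nonneg _ _)
          (by positivity)
      refine (map_add_le_add p _ _).trans ((add_le_add h7 h5).trans_eq ?_)
      ring

/-- A smooth family of functions with poles in the compact set `X`, the degrees of the denominators
being bounded, has a smooth family of principal parts. -/
theorem exists_cInf_split {q : ℕ} {U : Set (EuclideanSpace ℝ (Fin q))} (hU : IsOpen U)
    {S X : Set ℂ} (hS : IsOpen S) (hX : IsCompact X) (hXS : X ⊆ S)
    (g : CInf (Hol E (S \ X)) U) (m : ℕ)
    (hg : ∀ y, ∃ s : Multiset ℂ, (∀ a ∈ s, a ∈ X) ∧ s.card ≤ m ∧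
      HasDen S (S \ X) s (fn (ev g y))) :
    ∃ g' : CInf (Hol E Xᶜ) U, ∀ y, (∃ s : Multiset ℂ, (∀ a ∈ s, a ∈ X) ∧ s.card ≤ m ∧
      HasDen univ Xᶜ s (fn (ev g' y))) ∧ ∃ h : ℂ → E, HolOn h S ∧
        ∀ z ∈ S \ X, fn (ev g y) z = fn (ev g' y) z + h z := by
  have hD : IsOpen (S \ X) := hS.sdiff hX.isClosed
  have hXo : IsOpen Xᶜ := hX.isClosed.isOpen_compl
  have := Hol.frechetSpace (E := E) hD
  have := Hol.frechetSpace (E := E) hXo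
  have hSX : S \ (S \ X) = X := by rw [sdiff_sdiff_right_self]; exact inter_eq_right.2 hXS
  obtain ⟨V, hVb, -, hXV, hVS, hVc, hVD⟩ := exists_isOpen_frontier_subset (D := S \ X) hS
    (by rw [hSX]; exact hX) isCompact_empty (empty_subset _)
  rw [hSX] at hXV
  have hVX : Disjoint (frontier V) X := disjoint_left.2 fun z hz => (hVD hz).2
  -- The decay at infinity normalizes the principal part. Without it an entire function could be
  -- moved between the two summands, and no estimate of the second component would hold.
  let Γ : ℕ → Set (Hol E (S \ X) × Hol E Xᶜ) := fun m => {x | ∃ s : Multiset ℂ, (∀ a ∈ s, a ∈ X) ∧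
    s.card ≤ m ∧ HasDen univ Xᶜ s (fn x.2) ∧ Tendsto (fn x.2) (cocompact ℂ) (𝓝 0) ∧
    ∃ h : ℂ → E, HolOn h S ∧ ∀ z ∈ S \ X, fn x.1 z = fn x.2 z + h z}
  have hfst : ∀ m, Prod.fst '' Γ m = {u : Hol E (S \ X) | ∃ s : Multiset ℂ, (∀ a ∈ s, a ∈ X) ∧
      s.card ≤ m ∧ HasDen S (S \ X) s (fn u)} := by
    intro m
    ext u
    constructor
    · rintro ⟨⟨u, u'⟩, ⟨s, hs, hsm, hu', -, h, hh, heq⟩, rfl⟩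
      refine ⟨s, hs, hsm, ?_⟩
      exact ((hu'.mono (subset_univ _) (fun z hz => hz.2)).add (.of_holOn hh s)).congr heq
    · rintro ⟨s, hs, hsm, v, hv, h1⟩
      obtain ⟨C, hC, hC'⟩ := exists_splitting (E := E) (L := ∅) hS hX hXV hVb hVS hVc hVX
        isCompact_empty (by simp) s.card
      obtain ⟨N, h, hden, hN, hN0, hh, heq, -⟩ := hC' s hs rfl v hv
      refine ⟨⟨u, hN.toHol hXo⟩, ⟨s, hs, hsm, hden.congr fun z hz => hN.fn_toHol hXo hz,
        hN0.congr' ?_, h, hh, fun z hz => ?_⟩, rfl⟩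
      · filter_upwards [hX.compl_mem_cocompact] with z hz using (hN.fn_toHol hXo hz).symm
      · have h2 := heq z hz
        rw [h1 z hz] at h2
        rw [hN.fn_toHol hXo hz.2]
        exact smul_right_injective E (rootProd_ne_zero fun hzs => hz.2 (hs z hzs)) h2
  obtain ⟨g', hg'⟩ := exists_cInf_of_relation hU Γ (by
    rintro m n ⟨x, x'⟩ ⟨s, hs, hsm, h1, h2, h, hh, h3⟩ ⟨y, y'⟩ ⟨t, ht, htn, k1, k2, k, hk, k3⟩
    refine ⟨s + t, fun a ha => (Multiset.mem_add.1 ha).elim (hs a) (ht a),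
      by rw [Multiset.card_add]; omega, (h1.sub k1).congr fun z _ => fn_sub _ _ _, ?_,
      _, hh.sub hk, fun z hz => ?_⟩
    · rw [← sub_zero (0 : E)]
      exact (h2.sub k2).congr fun z => (fn_sub _ _ _).symm
    · simp only [Prod.fst_sub, Prod.snd_sub, fn_sub]
      rw [h3 z hz, k3 z hz]
      abel) (by
    rintro m c ⟨x, x'⟩ ⟨s, hs, hsm, h1, h2, h, hh, h3⟩
    refine ⟨s, hs, hsm, (h1.const_smul c).congr fun z _ => fn_smul _ _ _, ?_, _, hh.const_smul c,
      fun z hz => ?_⟩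
    · rw [← smul_zero c]
      exact (h2.const_smul c).congr fun z => (fn_smul _ _ _).symm
    · simp only [Prod.smul_fst, Prod.smul_snd, fn_smul]
      rw [h3 z hz, smul_add]) (by
    intro m N hN
    obtain ⟨L, p, hL, hLW, hp, hLN⟩ := Hol.exists_seminorm_subset hN
    have hC := fun k => exists_splitting (E := E) hS hX hXV hVb hVS hVc hVX hL
      (disjoint_left.2 hLW) k
    choose C hC0 hC using hC
    obtain ⟨r, hr, hr'⟩ := exists_dist_upper_bound hVc hX
    -- The splitting constants are given for exact degrees; their sum serves all degrees up to m at
    -- once.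
    set A : ℝ := ∑ k ∈ Finset.range (m + 1), C k with hA
    have hCA : ∀ k ≤ m, C k ≤ A := fun k hk => Finset.single_le_sum (fun j _ => (hC0 j).le)
      (Finset.mem_range.2 (by omega))
    have hA0 : 0 < A := (hC0 0).trans_le (hCA 0 (Nat.zero_le _))
    refine ⟨_, Hol.setOf_seminorm_lt_mem_nhds hVc hVD hp (r := 1 / (2 * A * r ^ m))
      (by positivity), ?_⟩
    rintro ⟨x, x'⟩ ⟨s, hs, hsm, ⟨w, hw, hwx⟩, h2, h, hh, h3⟩ hx
    refine hLN fun z hz => ?_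
    obtain ⟨N', h', -, hN', hN0', hh', heq, hest⟩ := hC s.card s hs rfl
      (fun z => w z + rootProd s z • h z) ((hw.mono (subset_univ _)).add
        (hh.smul (differentiable_rootProd s).differentiableOn))
    -- By Liouville's theorem any related x' coincides with the principal part obtained by
    -- interpolation, and so inherits its estimate.
    have h4 : fn x' z = N' z := HolOn.eq_of_splitting hS hX hXS (fn_holOn x' hXo) hN' h2 hN0' hh hh'
      (fun z hz => by
        have := heq z hz
        rw [hwx z hz.2, ← smul_add] at this
        exact smul_right_injective E (rootProd_ne_zero fun hzs => hz.2 (hs z hzs)) this) z (hLW hz)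
    rw [h4]
    have h5 := hest p hp (r ^ m * (1 / (2 * A * r ^ m))) (by positivity) (fun z hz => by
      rw [hwx z (hVD hz).2, ← smul_add, ← h3 z (hVD hz), map_smul_eq_mul]
      refine mul_le_mul ?_ (hx z hz).le (apply_nonneg _ _) (by positivity)
      exact (norm_rootProd_le_pow fun a ha => hr' z hz a (hs a ha)).trans
        (pow_le_pow_right₀ hr hsm)) z hz
    refine h5.trans_lt ?_
    calc _ ≤ A * (r ^ m * (1 / (2 * A * r ^ m))) :=
          mul_le_mul_of_nonneg_right (hCA _ hsm) (by positivity)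
      _ < 1 := by
        have : 0 < r ^ m := by positivity
        field_simp
        norm_num) (fun m => by
      rw [hfst]
      exact isClosed_setOf_hasDen hS hD sdiff_subset (by rw [hSX]; exact hX) hX m) g m
    (fun y => by rw [hfst]; exact hg y)
  refine ⟨g', fun y => ?_⟩
  obtain ⟨s, hs, hsm, h1, -, h⟩ := hg' y
  exact ⟨⟨s, hs, hsm, h1⟩, h⟩

end Mellin

/-! ### Integrals along boundaries of rectangles -/

instance : FrechetSpace ℂ := FrechetSpace.of_uniformSpace ℂ

namespace Mellin

/-- The closed rectangle with corners `a` and `b`. -/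
def closedRect (a b : ℂ) : Set ℂ := Icc a.re b.re ×ℂ Icc a.im b.im

/-- The boundary of the rectangle with corners `a` and `b`. -/
def rectFrame (a b : ℂ) : Set ℂ := closedRect a b \ (Ioo a.re b.re ×ℂ Ioo a.im b.im)

section Scalar

variable {a b : ℂ} {f g : ℂ → ℂ}

theorem bottom_mem_rectFrame (h : a.im ≤ b.im) {x : ℝ} (hx : x ∈ Icc a.re b.re) :
    (x + a.im * Complex.I : ℂ) ∈ rectFrame a b := by
  simp [rectFrame, closedRect, Complex.mem_reProdIm, hx.1, hx.2, h]

theorem top_mem_rectFrame (h : a.im ≤ b.im) {x : ℝ} (hx : x ∈ Icc a.re b.re) :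
    (x + b.im * Complex.I : ℂ) ∈ rectFrame a b := by
  simp [rectFrame, closedRect, Complex.mem_reProdIm, hx.1, hx.2, h]

theorem right_mem_rectFrame (h : a.re ≤ b.re) {t : ℝ} (ht : t ∈ Icc a.im b.im) :
    (b.re + t * Complex.I : ℂ) ∈ rectFrame a b := by
  simp [rectFrame, closedRect, Complex.mem_reProdIm, ht.1, ht.2, h]

theorem left_mem_rectFrame (h : a.re ≤ b.re) {t : ℝ} (ht : t ∈ Icc a.im b.im) :
    (a.re + t * Complex.I : ℂ) ∈ rectFrame a b := by
  simp [rectFrame, closedRect, Complex.mem_reProdIm, ht.1, ht.2, h]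

theorem isCompact_rectFrame (a b : ℂ) : IsCompact (rectFrame a b) :=
  (isCompact_Icc.reProdIm isCompact_Icc).diff (isOpen_Ioo.reProdIm isOpen_Ioo)

theorem rectIntegrable_of_continuousOn (h1 : a.re ≤ b.re) (h2 : a.im ≤ b.im)
    (hf : ContinuousOn f (rectFrame a b)) : RectIntegrable a b f := by
  refine ⟨ContinuousOn.intervalIntegrable_of_Icc h1 ?_,
    ContinuousOn.intervalIntegrable_of_Icc h1 ?_, ContinuousOn.intervalIntegrable_of_Icc h2 ?_,
    ContinuousOn.intervalIntegrable_of_Icc h2 ?_⟩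
  · exact hf.comp (by fun_prop) fun x hx => bottom_mem_rectFrame h2 hx
  · exact hf.comp (by fun_prop) fun x hx => top_mem_rectFrame h2 hx
  · exact hf.comp (by fun_prop) fun x hx => right_mem_rectFrame h1 hx
  · exact hf.comp (by fun_prop) fun x hx => left_mem_rectFrame h1 hx

theorem RectIntegrable.congr (h1 : a.re ≤ b.re) (h2 : a.im ≤ b.im) (hf : RectIntegrable a b f)
    (h : EqOn f g (rectFrame a b)) : RectIntegrable a b g := by
  obtain ⟨f1, f2, f3, f4⟩ := hf
  refine ⟨f1.congr fun x hx => h (bottom_mem_rectFrame h2 ?_),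
    f2.congr fun x hx => h (top_mem_rectFrame h2 ?_),
    f3.congr fun x hx => h (right_mem_rectFrame h1 ?_),
    f4.congr fun x hx => h (left_mem_rectFrame h1 ?_)⟩ <;>
  · rw [uIoc_of_le (by assumption)] at hx
    exact Ioc_subset_Icc_self hx

theorem rectIntegral_congr (h1 : a.re ≤ b.re) (h2 : a.im ≤ b.im)
    (h : EqOn f g (rectFrame a b)) : rectIntegral a b f = rectIntegral a b g := by
  rw [rectIntegral, rectIntegral]
  have e1 := intervalIntegral.integral_congr (a := a.re) (b := b.re) (μ := MeasureTheory.volume)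
    (f := fun x : ℝ => f (x + a.im * Complex.I)) (g := fun x : ℝ => g (x + a.im * Complex.I))
    fun x hx => h (bottom_mem_rectFrame h2 (by rwa [uIcc_of_le h1] at hx))
  have e2 := intervalIntegral.integral_congr (a := a.re) (b := b.re) (μ := MeasureTheory.volume)
    (f := fun x : ℝ => f (x + b.im * Complex.I)) (g := fun x : ℝ => g (x + b.im * Complex.I))
    fun x hx => h (top_mem_rectFrame h2 (by rwa [uIcc_of_le h1] at hx))
  have e3 := intervalIntegral.integral_congr (a := a.im) (b := b.im) (μ := MeasureTheory.volume)
    (f := fun t : ℝ => f (b.re + t * Complex.I)) (g := fun t : ℝ => g (b.re + t * Complex.I))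
    fun x hx => h (right_mem_rectFrame h1 (by rwa [uIcc_of_le h2] at hx))
  have e4 := intervalIntegral.integral_congr (a := a.im) (b := b.im) (μ := MeasureTheory.volume)
    (f := fun t : ℝ => f (a.re + t * Complex.I)) (g := fun t : ℝ => g (a.re + t * Complex.I))
    fun x hx => h (left_mem_rectFrame h1 (by rwa [uIcc_of_le h2] at hx))
  rw [e1, e2, e3, e4]

theorem norm_rectIntegral_le (h1 : a.re ≤ b.re) (h2 : a.im ≤ b.im) {C : ℝ}
    (h : ∀ z ∈ rectFrame a b, ‖f z‖ ≤ C) :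
    ‖rectIntegral a b f‖ ≤ ‖(2 * Real.pi * Complex.I)⁻¹‖ *
      (C * (b.re - a.re) + C * (b.re - a.re) + C * (b.im - a.im) + C * (b.im - a.im)) := by
  have e1 : |b.re - a.re| = b.re - a.re := abs_of_nonneg (by linarith)
  have e2 : |b.im - a.im| = b.im - a.im := abs_of_nonneg (by linarith)
  rw [rectIntegral, norm_mul]
  refine mul_le_mul_of_nonneg_left ?_ (norm_nonneg _)
  refine (norm_sub_le _ _).trans (add_le_add ((norm_add_le _ _).trans (add_le_add
    ((norm_sub_le _ _).trans (add_le_add ?_ ?_)) ?_)) ?_)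
  · rw [← e1]
    refine intervalIntegral.norm_integral_le_of_norm_le_const fun x hx =>
      h _ (bottom_mem_rectFrame h2 ?_)
    rw [uIoc_of_le h1] at hx
    exact Ioc_subset_Icc_self hx
  · rw [← e1]
    refine intervalIntegral.norm_integral_le_of_norm_le_const fun x hx =>
      h _ (top_mem_rectFrame h2 ?_)
    rw [uIoc_of_le h1] at hx
    exact Ioc_subset_Icc_self hx
  · rw [← e2, norm_mul, Complex.norm_I, one_mul]
    refine intervalIntegral.norm_integral_le_of_norm_le_const fun x hx =>
      h _ (right_mem_rectFrame h1 ?_)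
    rw [uIoc_of_le h2] at hx
    exact Ioc_subset_Icc_self hx
  · rw [← e2, norm_mul, Complex.norm_I, one_mul]
    refine intervalIntegral.norm_integral_le_of_norm_le_const fun x hx =>
      h _ (left_mem_rectFrame h1 ?_)
    rw [uIoc_of_le h2] at hx
    exact Ioc_subset_Icc_self hx

theorem rectIntegral_add (hf : RectIntegrable a b f) (hg : RectIntegrable a b g) :
    rectIntegral a b (fun z => f z + g z) = rectIntegral a b f + rectIntegral a b g := by
  obtain ⟨u1, u2, u3, u4⟩ := hf
  obtain ⟨v1, v2, v3, v4⟩ := hg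
  simp only [rectIntegral]
  rw [intervalIntegral.integral_add u1 v1, intervalIntegral.integral_add u2 v2,
    intervalIntegral.integral_add u3 v3, intervalIntegral.integral_add u4 v4]
  ring

theorem rectIntegral_mul_const (c : ℂ) :
    rectIntegral a b (fun z => f z * c) = rectIntegral a b f * c := by
  simp only [rectIntegral, intervalIntegral.integral_mul_const]
  ring

theorem rectIntegral_const_mul (c : ℂ) :
    rectIntegral a b (fun z => c * f z) = c * rectIntegral a b f := by
  simp only [rectIntegral, intervalIntegral.integral_const_mul]
  ring

theorem rectIntegral_eq_zero (h1 : a.re ≤ b.re) (h2 : a.im ≤ b.im)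
    (hf : DifferentiableOn ℂ f (closedRect a b)) : rectIntegral a b f = 0 := by
  have := Complex.integral_boundary_rect_eq_zero_of_differentiableOn f a b
    (by rwa [uIcc_of_le h1, uIcc_of_le h2])
  simp only [smul_eq_mul] at this
  rw [rectIntegral, this, mul_zero]

theorem rectIntegral_add_horizontal {p q r s t : ℝ}
    (h1 : IntervalIntegrable (fun x : ℝ => f (x + s * Complex.I)) MeasureTheory.volume p q)
    (h2 : IntervalIntegrable (fun x : ℝ => f (x + s * Complex.I)) MeasureTheory.volume q r)
    (h3 : IntervalIntegrable (fun x : ℝ => f (x + t * Complex.I)) MeasureTheory.volume p q)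
    (h4 : IntervalIntegrable (fun x : ℝ => f (x + t * Complex.I)) MeasureTheory.volume q r) :
    rectIntegral ⟨p, s⟩ ⟨r, t⟩ f = rectIntegral ⟨p, s⟩ ⟨q, t⟩ f + rectIntegral ⟨q, s⟩ ⟨r, t⟩ f := by
  simp only [rectIntegral]
  rw [← intervalIntegral.integral_add_adjacent_intervals h1 h2,
    ← intervalIntegral.integral_add_adjacent_intervals h3 h4]
  ring

theorem rectIntegral_add_vertical {p q r s t : ℝ}
    (h1 : IntervalIntegrable (fun x : ℝ => f (s + x * Complex.I)) MeasureTheory.volume p q)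
    (h2 : IntervalIntegrable (fun x : ℝ => f (s + x * Complex.I)) MeasureTheory.volume q r)
    (h3 : IntervalIntegrable (fun x : ℝ => f (t + x * Complex.I)) MeasureTheory.volume p q)
    (h4 : IntervalIntegrable (fun x : ℝ => f (t + x * Complex.I)) MeasureTheory.volume q r) :
    rectIntegral ⟨s, p⟩ ⟨t, r⟩ f = rectIntegral ⟨s, p⟩ ⟨t, q⟩ f + rectIntegral ⟨s, q⟩ ⟨t, r⟩ f := by
  simp only [rectIntegral]
  rw [← intervalIntegral.integral_add_adjacent_intervals h1 h2,
    ← intervalIntegral.integral_add_adjacent_intervals h3 h4]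
  ring

theorem Surrounds.rectFrame_subset {X : Set ℂ} (h : Surrounds a b X) : rectFrame a b ⊆ Xᶜ :=
  fun _ hz hx => hz.2 (h.2.2 hx)

/-- The integral of a function that is holomorphic off `X` does not change if a rectangle
surrounding `X` is enlarged. -/
theorem rectIntegral_eq_of_subset {X : Set ℂ} (hf : DifferentiableOn ℂ f Xᶜ)
    (h : Surrounds a b X) {a' b' : ℂ} (h1 : a'.re ≤ a.re) (h2 : a'.im ≤ a.im)
    (h3 : b.re ≤ b'.re) (h4 : b.im ≤ b'.im) : rectIntegral a' b' f = rectIntegral a b f := by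
  obtain ⟨a1, a2⟩ := a
  obtain ⟨b1, b2⟩ := b
  obtain ⟨c1, c2⟩ := a'
  obtain ⟨d1, d2⟩ := b'
  obtain ⟨hre, him, hX⟩ := h
  simp only at h1 h2 h3 h4 hre him hX
  have hc := hf.continuousOn
  have hnot : ∀ z : ℂ, z.re ≤ a1 ∨ b1 ≤ z.re ∨ z.im ≤ a2 ∨ b2 ≤ z.im → z ∈ Xᶜ := by
    intro z hz hzX
    obtain ⟨⟨k1, k2⟩, k3, k4⟩ := hX hzX
    rcases hz with hz | hz | hz | hz <;> linarith
  have hor : ∀ s p q : ℝ, s ≤ a2 ∨ b2 ≤ s →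
      IntervalIntegrable (fun x : ℝ => f (x + s * Complex.I)) MeasureTheory.volume p q := by
    intro s p q hs
    refine (ContinuousOn.comp hc (by fun_prop) fun x _ => hnot _ ?_).intervalIntegrable
    simpa using Or.inr (Or.inr hs)
  have ver : ∀ s p q : ℝ, s ≤ a1 ∨ b1 ≤ s →
      IntervalIntegrable (fun x : ℝ => f (s + x * Complex.I)) MeasureTheory.volume p q := by
    intro s p q hs
    refine (ContinuousOn.comp hc (by fun_prop) fun x _ => hnot _ ?_).intervalIntegrable
    rcases hs with hs | hs <;> simp [hs]
  have z1 : rectIntegral ⟨c1, c2⟩ ⟨a1, d2⟩ f = 0 :=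
    rectIntegral_eq_zero h1 (by simp only; linarith)
      (hf.mono fun z hz => hnot z (Or.inl hz.1.2))
  have z2 : rectIntegral ⟨b1, c2⟩ ⟨d1, d2⟩ f = 0 :=
    rectIntegral_eq_zero h3 (by simp only; linarith)
      (hf.mono fun z hz => hnot z (Or.inr (Or.inl hz.1.1)))
  have z3 : rectIntegral ⟨a1, c2⟩ ⟨b1, a2⟩ f = 0 :=
    rectIntegral_eq_zero hre.le h2
      (hf.mono fun z hz => hnot z (Or.inr (Or.inr (Or.inl hz.2.2))))
  have z4 : rectIntegral ⟨a1, b2⟩ ⟨b1, d2⟩ f = 0 :=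
    rectIntegral_eq_zero hre.le h4
      (hf.mono fun z hz => hnot z (Or.inr (Or.inr (Or.inr hz.2.1))))
  have hc2 : c2 ≤ a2 ∨ b2 ≤ c2 := Or.inl h2
  have hd2 : d2 ≤ a2 ∨ b2 ≤ d2 := Or.inr h4
  have ha1 : a1 ≤ a1 ∨ b1 ≤ a1 := Or.inl le_rfl
  have hb1 : b1 ≤ a1 ∨ b1 ≤ b1 := Or.inr le_rfl
  rw [rectIntegral_add_horizontal (hor c2 c1 a1 hc2) (hor c2 a1 d1 hc2) (hor d2 c1 a1 hd2)
    (hor d2 a1 d1 hd2), z1, rectIntegral_add_horizontal (hor c2 a1 b1 hc2) (hor c2 b1 d1 hc2)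
    (hor d2 a1 b1 hd2) (hor d2 b1 d1 hd2), z2, rectIntegral_add_vertical (ver a1 c2 a2 ha1)
    (ver a1 a2 d2 ha1) (ver b1 c2 a2 hb1) (ver b1 a2 d2 hb1), z3, rectIntegral_add_vertical
    (ver a1 a2 b2 ha1) (ver a1 b2 d2 ha1) (ver b1 a2 b2 hb1) (ver b1 b2 d2 hb1), z4]
  ring

/-- Both rectangles can be enlarged to one rectangle containing them. -/
theorem rectIntegral_eq_of_surrounds {X : Set ℂ} (hf : DifferentiableOn ℂ f Xᶜ)
    (h : Surrounds a b X) {a' b' : ℂ} (h' : Surrounds a' b' X) :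
    rectIntegral a b f = rectIntegral a' b' f := by
  rw [← rectIntegral_eq_of_subset hf h (a' := ⟨min a.re a'.re, min a.im a'.im⟩)
    (b' := ⟨max b.re b'.re, max b.im b'.im⟩) (min_le_left _ _) (min_le_left _ _)
    (le_max_left _ _) (le_max_left _ _)]
  exact rectIntegral_eq_of_subset hf h' (min_le_right _ _) (min_le_right _ _)
    (le_max_right _ _) (le_max_right _ _)

/-- Deform to the square of side 2 centred at x. A quarter turn identifies the right side with the
bottom and the left side with the top, and the difference of bottom and top is 2i times an
arctangent integral. -/
theorem rectIntegral_inv_sub (x : ℂ) (h : Surrounds a b {x}) :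
    rectIntegral a b (fun z => (z - x)⁻¹) = 1 := by
  have hd : DifferentiableOn ℂ (fun z => (z - x)⁻¹) {x}ᶜ :=
    DifferentiableOn.inv (by fun_prop) fun z hz => sub_ne_zero.2 hz
  rw [rectIntegral_eq_of_surrounds hd h (a' := ⟨x.re - 1, x.im - 1⟩)
    (b' := ⟨x.re + 1, x.im + 1⟩) ⟨by norm_num; linarith, by norm_num; linarith, by
      rintro z rfl; simp [Complex.mem_reProdIm]⟩]
  have key : ∀ t : ℝ, (1 + (t : ℂ) ^ 2) ≠ 0 := fun t => by
    have : (1 + (t : ℂ) ^ 2) = ((1 + t ^ 2 : ℝ) : ℂ) := by push_cast; ring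
    rw [this]
    exact Complex.ofReal_ne_zero.2 (by positivity)
  have hI := Complex.I_sq
  have k1 : ∀ t : ℝ, (t - Complex.I) * (t + Complex.I) = 1 + (t : ℂ) ^ 2 := fun t => by
    linear_combination (-1 : ℂ) * hI
  have n1 : ∀ t : ℝ, ((t : ℂ) - Complex.I) ≠ 0 := fun t h0 => key t (by rw [← k1, h0, zero_mul])
  have n2 : ∀ t : ℝ, ((t : ℂ) + Complex.I) ≠ 0 := fun t h0 => key t (by rw [← k1, h0, mul_zero])
  have i1 : ∀ w : ℝ → ℂ, (∀ t, w t ≠ 0) → Continuous w →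
      IntervalIntegrable (fun t => (w t)⁻¹) MeasureTheory.volume (-1) 1 := fun w hw hc =>
    (hc.inv₀ hw).intervalIntegrable _ _
  have harc : (∫ t : ℝ in (-1 : ℝ)..1, (1 + (t : ℂ) ^ 2)⁻¹) = (Real.pi / 2 : ℂ) := by
    have : ∀ t : ℝ, (1 + (t : ℂ) ^ 2)⁻¹ = (((1 + t ^ 2)⁻¹ : ℝ) : ℂ) := fun t => by push_cast; rfl
    simp only [this]
    rw [intervalIntegral.integral_ofReal, integral_inv_one_add_sq, Real.arctan_neg,
      Real.arctan_one]
    push_cast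
    ring
  have hs : ∀ (c : ℝ) (F : ℝ → ℂ),
      (∫ t : ℝ in (c - 1)..(c + 1), F t) = ∫ t : ℝ in (-1 : ℝ)..1, F (t + c) := fun c F => by
    rw [intervalIntegral.integral_comp_add_right]
    congr 1 <;> ring
  have hB : ∀ t : ℝ, (((t + x.re : ℝ) : ℂ) + ((x.im - 1 : ℝ) : ℂ) * Complex.I - x)⁻¹ =
      ((t : ℂ) - Complex.I)⁻¹ := fun t => by
    congr 1
    apply Complex.ext <;> simp
  have hT : ∀ t : ℝ, (((t + x.re : ℝ) : ℂ) + ((x.im + 1 : ℝ) : ℂ) * Complex.I - x)⁻¹ =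
      ((t : ℂ) + Complex.I)⁻¹ := fun t => by
    congr 1
    apply Complex.ext <;> simp
  have hR : ∀ t : ℝ, Complex.I * (((x.re + 1 : ℝ) : ℂ) + ((t + x.im : ℝ) : ℂ) * Complex.I - x)⁻¹ =
      ((t : ℂ) - Complex.I)⁻¹ := fun t => by
    rw [show (((x.re + 1 : ℝ) : ℂ) + ((t + x.im : ℝ) : ℂ) * Complex.I - x) =
      Complex.I * ((t : ℂ) - Complex.I) by apply Complex.ext <;> simp, mul_inv,
      mul_inv_cancel_left₀ Complex.I_ne_zero]
  have hL : ∀ t : ℝ, Complex.I * (((x.re - 1 : ℝ) : ℂ) + ((t + x.im : ℝ) : ℂ) * Complex.I - x)⁻¹ =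
      ((t : ℂ) + Complex.I)⁻¹ := fun t => by
    rw [show (((x.re - 1 : ℝ) : ℂ) + ((t + x.im : ℝ) : ℂ) * Complex.I - x) =
      Complex.I * ((t : ℂ) + Complex.I) by apply Complex.ext <;> simp, mul_inv,
      mul_inv_cancel_left₀ Complex.I_ne_zero]
  have hBT : (∫ t : ℝ in (-1 : ℝ)..1, ((t : ℂ) - Complex.I)⁻¹) -
      (∫ t : ℝ in (-1 : ℝ)..1, ((t : ℂ) + Complex.I)⁻¹) = Complex.I * Real.pi := by
    rw [← intervalIntegral.integral_sub (i1 _ n1 (by fun_prop)) (i1 _ n2 (by fun_prop))]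
    have : ∀ t : ℝ, ((t : ℂ) - Complex.I)⁻¹ - ((t : ℂ) + Complex.I)⁻¹ =
        2 * Complex.I * (1 + (t : ℂ) ^ 2)⁻¹ := fun t => by
      rw [← k1, inv_sub_inv (n1 t) (n2 t), div_eq_mul_inv]
      ring
    simp only [this]
    rw [intervalIntegral.integral_const_mul, harc]
    ring
  simp only [rectIntegral, hs, ← intervalIntegral.integral_const_mul, hB, hT, hR, hL]
  rw [add_sub_assoc, hBT]
  have := Complex.I_ne_zero
  have := Complex.ofReal_ne_zero.2 Real.pi_ne_zero
  field_simp
  ring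

end Scalar

end Mellin

/-! ### Analytic functionals of meromorphic functions -/

namespace Mellin

variable {E : Type*} [AddCommGroup E] [Module ℂ E] [TopologicalSpace E] [FrechetSpace E]

section IsRectIntegral

variable {a b : ℂ} {u v : ℂ → E} {e e' : E}

theorem IsRectIntegral.congr (hu : IsRectIntegral a b u e) (h1 : a.re ≤ b.re) (h2 : a.im ≤ b.im)
    (h : EqOn u v (rectFrame a b)) : IsRectIntegral a b v e := fun φ => by
  have h3 : EqOn (fun z => φ (u z)) (fun z => φ (v z)) (rectFrame a b) := fun z hz =>
    congrArg φ (h hz)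
  exact ⟨(hu φ).1.congr h1 h2 h3, (rectIntegral_congr h1 h2 h3).symm.trans (hu φ).2⟩

theorem IsRectIntegral.unique (hu : IsRectIntegral a b u e) (hu' : IsRectIntegral a b u e') :
    e = e' :=
  FrechetSpace.eq_of_dual fun φ => (hu φ).2.symm.trans (hu' φ).2

theorem isRectIntegral_smul_const {g : ℂ → ℂ} (hg : RectIntegrable a b g) (e : E) :
    IsRectIntegral a b (fun z => g z • e) (rectIntegral a b g • e) := fun φ => by
  obtain ⟨g1, g2, g3, g4⟩ := hg
  simp only [map_smul, smul_eq_mul]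
  exact ⟨⟨g1.mul_const _, g2.mul_const _, g3.mul_const _, g4.mul_const _⟩,
    rectIntegral_mul_const _⟩

theorem HolOn.isRectIntegral_zero {W : Set ℂ} (hu : HolOn u W) (h1 : a.re ≤ b.re)
    (h2 : a.im ≤ b.im) (hW : closedRect a b ⊆ W) : IsRectIntegral a b u 0 := fun φ => by
  refine ⟨rectIntegrable_of_continuousOn h1 h2
    (((hu.2 φ).continuousOn.mono hW).mono sdiff_subset), ?_⟩
  rw [map_zero]
  exact rectIntegral_eq_zero h1 h2 ((hu.2 φ).mono hW)

end IsRectIntegral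

/-- The analytic functional `h ↦ ∫ h(z) g(z) (2πi)⁻¹ dz` given by a continuous function on the
boundary of a rectangle. -/
theorem exists_rectFunctional {a b : ℂ} (h1 : a.re ≤ b.re) (h2 : a.im ≤ b.im) {g : ℂ → ℂ}
    (hg : ContinuousOn g (rectFrame a b)) :
    ∃ l : Hol ℂ univ →L[ℂ] ℂ, ∀ h, l h = rectIntegral a b (fun z => fn h z * g z) := by
  have hint : ∀ h : Hol ℂ univ, RectIntegrable a b (fun z => fn h z * g z) := fun h =>
    rectIntegrable_of_continuousOn h1 h2
      (((fn_holOn h isOpen_univ).continuousOn.mono (subset_univ _)).mul hg)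
  let l : Hol ℂ univ →ₗ[ℂ] ℂ :=
    { toFun := fun h => rectIntegral a b (fun z => fn h z * g z)
      map_add' := fun h h' => by
        rw [← rectIntegral_add (hint h) (hint h')]
        simp only [fn_add, add_mul]
      map_smul' := fun c h => by
        rw [RingHom.id_apply, smul_eq_mul, ← rectIntegral_const_mul]
        simp only [fn_smul, smul_eq_mul, mul_assoc] }
  have hl : Continuous l := by
    refine continuous_of_continuousAt_zero l ?_
    rw [ContinuousAt, map_zero, Metric.tendsto_nhds]
    intro ε hε
    obtain ⟨C, hC⟩ := (isCompact_rectFrame a b).exists_bound_of_continuousOn hg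
    set M := ‖(2 * Real.pi * Complex.I : ℂ)⁻¹‖ *
      ((b.re - a.re) + (b.re - a.re) + (b.im - a.im) + (b.im - a.im)) with hM
    have hM0 : 0 ≤ M := mul_nonneg (norm_nonneg _) (by linarith)
    have hp : Continuous (normSeminorm ℂ ℂ) := continuous_norm
    filter_upwards [Hol.setOf_seminorm_lt_mem_nhds (isCompact_rectFrame a b) (subset_univ _) hp
      (r := ε / (M * (|C| + 1) + 1)) (by positivity)] with h hh
    rw [dist_zero_right]
    have := norm_rectIntegral_le h1 h2 (f := fun z => fn h z * g z)
      (C := ε / (M * (|C| + 1) + 1) * (|C| + 1)) (fun z hz => by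
        rw [norm_mul]
        refine mul_le_mul (hh z hz).le ?_ (norm_nonneg _) (by positivity)
        linarith [hC z hz, le_abs_self C])
    refine this.trans_lt ?_
    calc _ = ε * (M * (|C| + 1)) / (M * (|C| + 1) + 1) := by rw [hM]; ring
      _ < ε := by
        rw [div_lt_iff₀ (by positivity)]
        nlinarith
  exact ⟨⟨l, hl⟩, fun h => rfl⟩

/-- Meromorphic functions with poles in a compact set define analytic functionals that do not
depend on the choice of the contour. -/
theorem HasDen.exists_functional {X : Set ℂ} (hX : IsCompact X) {s : Multiset ℂ}
    (hs : ∀ a ∈ s, a ∈ X) {u : ℂ → E} (hu : HasDen univ Xᶜ s u) :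
    ∃ ζ : Hol ℂ univ →L[ℂ] E, ∀ h a b, Surrounds a b X →
      IsRectIntegral a b (fun z => fn h z • u z) (ζ h) := by
  obtain ⟨v, hv, hvu⟩ := hu
  induction s using Multiset.induction_on generalizing u v with
  | empty =>
    refine ⟨0, fun h a b hab => ?_⟩
    refine ((hv.smul (((fn_holOn h isOpen_univ).2 (.id ℂ ℂ)))).isRectIntegral_zero hab.1.le
      hab.2.1.le (subset_univ _)).congr hab.1.le hab.2.1.le fun z hz => ?_
    beta_reduce
    rw [hvu z (hab.rectFrame_subset hz), rootProd_zero, one_smul]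
    rfl
  | cons x s ih =>
    obtain ⟨v₁, hv₁, hvv⟩ := hv.exists_slope isOpen_univ (mem_univ x)
    have hne : ∀ z ∈ Xᶜ, rootProd (x ::ₘ s) z ≠ 0 := fun z hz =>
      rootProd_ne_zero fun hzs => hz (hs z hzs)
    have hne' : ∀ z ∈ Xᶜ, rootProd s z ≠ 0 := fun z hz =>
      rootProd_ne_zero fun hzs => hz (hs z (Multiset.mem_cons_of_mem hzs))
    obtain ⟨ζ, hζ⟩ := ih (fun a ha => hs a (Multiset.mem_cons_of_mem ha))
      (u := fun z => (rootProd s z)⁻¹ • v₁ z) v₁ hv₁ fun z hz => by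
        rw [smul_inv_smul₀ (hne' z hz)]
    have hd : DifferentiableOn ℂ (fun z => (rootProd (x ::ₘ s) z)⁻¹) Xᶜ :=
      (differentiable_rootProd _).differentiableOn.inv hne
    -- Splitting off one zero leaves a scalar function times a fixed vector, whose integral exists
    -- without any vector-valued integration theory, and a function with a shorter denominator.
    have hdecomp : ∀ z ∈ Xᶜ, u z = (rootProd (x ::ₘ s) z)⁻¹ • v x + (rootProd s z)⁻¹ • v₁ z := by
      intro z hz
      have h1 : z - x ≠ 0 := fun h0 => hne z hz (by rw [rootProd_cons, h0, zero_mul])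
      have h2 : u z = (rootProd (x ::ₘ s) z)⁻¹ • v z := by rw [hvu z hz, inv_smul_smul₀ (hne z hz)]
      rw [h2, hvv z, smul_add, smul_smul, rootProd_cons, mul_inv, mul_right_comm,
        inv_mul_cancel₀ h1, one_mul]
    obtain ⟨r, hr⟩ := hX.isBounded.subset_ball 0
    -- One reference rectangle defines the scalar functional; Cauchy's theorem carries it over to
    -- every other one.
    obtain ⟨c, d, hcd⟩ : ∃ c d : ℂ, Surrounds c d X := by
      refine ⟨⟨-|r| - 1, -|r| - 1⟩, ⟨|r| + 1, |r| + 1⟩, by simp only; linarith [abs_nonneg r],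
        by simp only; linarith [abs_nonneg r], fun z hz => ?_⟩
      have h1 := mem_ball_zero_iff.1 (hr hz)
      have h2 := abs_le.1 (Complex.abs_re_le_norm z)
      have h3 := abs_le.1 (Complex.abs_im_le_norm z)
      have h4 := le_abs_self r
      exact ⟨⟨by simp only; linarith, by simp only; linarith⟩,
        ⟨by simp only; linarith, by simp only; linarith⟩⟩
    obtain ⟨l, hl⟩ := exists_rectFunctional hcd.1.le hcd.2.1.le
      (hd.continuousOn.mono hcd.rectFrame_subset)
    refine ⟨l.smulRight (v x) + ζ, fun h a b hab => ?_⟩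
    have hdh : DifferentiableOn ℂ (fun z => fn h z * (rootProd (x ::ₘ s) z)⁻¹) Xᶜ :=
      (((fn_holOn h isOpen_univ).2 (.id ℂ ℂ)).mono (subset_univ _)).mul hd
    have h1 := (isRectIntegral_smul_const (rectIntegrable_of_continuousOn hab.1.le hab.2.1.le
      (hdh.continuousOn.mono hab.rectFrame_subset)) (v x)).add (hζ h a b hab)
    rw [rectIntegral_eq_of_surrounds hdh hab hcd, ← hl] at h1
    refine h1.congr hab.1.le hab.2.1.le fun z hz => ?_
    rw [hdecomp z (hab.rectFrame_subset hz), smul_add, smul_smul]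

/-- A meromorphic function with vanishing analytic functional is holomorphic. -/
theorem exists_holOn_of_isRectIntegral_zero {S X : Set ℂ} (hS : IsOpen S) (hXS : X ⊆ S) {a b : ℂ}
    (hab : Surrounds a b X) (hR : closedRect a b ⊆ S) {s : Multiset ℂ} (hs : ∀ x ∈ s, x ∈ X)
    {d : ℂ → E} (hd : HasDen S (S \ X) s d)
    (h0 : ∀ P : ℂ → ℂ, Differentiable ℂ P → IsRectIntegral a b (fun z => P z • d z) 0) :
    ∃ w : ℂ → E, HolOn w S ∧ ∀ z ∈ S \ X, w z = d z := by
  obtain ⟨v, hv, hvd⟩ := hd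
  induction s using Multiset.induction_on generalizing v with
  | empty => exact ⟨v, hv, fun z hz => by rw [hvd z hz, rootProd_zero, one_smul]⟩
  | cons x s ih =>
    have hx : x ∈ X := hs x (Multiset.mem_cons_self x s)
    obtain ⟨v₁, hv₁, hvv⟩ := hv.exists_slope hS (hXS hx)
    have hsub : ∀ z ∈ rectFrame a b, z ∈ S \ X := fun z hz =>
      ⟨hR hz.1, hab.rectFrame_subset hz⟩
    have hne : ∀ z ∈ S \ X, z - x ≠ 0 := fun z hz h => hz.2 (by rwa [sub_eq_zero.1 h])
    have hsx : Surrounds a b {x} := ⟨hab.1, hab.2.1, (singleton_subset_iff.2 hx).trans hab.2.2⟩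
    have h1 := (isRectIntegral_smul_const (rectIntegrable_of_continuousOn hab.1.le hab.2.1.le
      (f := fun z => (z - x)⁻¹) (ContinuousOn.inv₀ (by fun_prop) fun z hz => hne z (hsub z hz)))
      (v x)).add (hv₁.isRectIntegral_zero hab.1.le hab.2.1.le hR)
    rw [rectIntegral_inv_sub x hsx, one_smul, add_zero] at h1
    -- Testing with the polynomial `rootProd s` cancels all zeros but x, and the integral of v(z)/(z
    -- - x) is v(x). The numerator thus vanishes at x, so this zero can be removed from the
    -- denominator.
    have h2 : v x = 0 := by
      refine (h1.congr hab.1.le hab.2.1.le fun z hz => ?_).unique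
        (h0 (rootProd s) (differentiable_rootProd s))
      have h3 := hvd z (hsub z hz)
      rw [rootProd_cons, mul_smul] at h3
      have h4 : rootProd s z • d z = (z - x)⁻¹ • v z := by
        rw [h3, inv_smul_smul₀ (hne z (hsub z hz))]
      rw [h4, hvv z, smul_add, inv_smul_smul₀ (hne z (hsub z hz))]
    refine ih (fun y hy => hs y (Multiset.mem_cons_of_mem hy)) v₁ hv₁ fun z hz => ?_
    have h3 := hvd z hz
    rw [hvv z, h2, zero_add, rootProd_cons, mul_smul] at h3
    exact smul_right_injective E (hne z hz) h3

end Mellin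

/-! ### Subordination in terms of denominators -/

namespace Mellin

variable {E : Type*} [AddCommGroup E] [Module ℂ E] [TopologicalSpace E] [FrechetSpace E]

open scoped Classical in
theorem rootProd_eq_pow_mul (s : Multiset ℂ) (p z : ℂ) :
    rootProd s z = (z - p) ^ s.count p * rootProd (s.filter (· ≠ p)) z := by
  conv_lhs => rw [← Multiset.filter_add_not (· = p) s]
  rw [rootProd_add, Multiset.filter_eq']
  congr 1
  simp [rootProd]

open scoped Classical in
/-- A function with local denominators has a global denominator. -/
theorem HasDen.of_forall_local {W : Set ℂ} (hW : IsOpen W) {s : Multiset ℂ} {u : ℂ → E}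
    (hu : HolOn u (W \ {z | z ∈ s}))
    (h : ∀ p ∈ W, p ∈ s → ∃ V : Set ℂ, IsOpen V ∧ p ∈ V ∧ ∃ G : ℂ → E, HolOn G V ∧
      ∀ z ∈ V, z ∈ W → z ∉ s → G z = (z - p) ^ s.count p • u z) :
    HasDen W (W \ {z | z ∈ s}) s u := by
  choose! V hV hpV G hG hGu using h
  have hfin : ∀ t : Multiset ℂ, IsClosed {z | z ∈ t} := fun t => by
    have : {z | z ∈ t} = (t.toFinset : Set ℂ) := by ext; simp
    rw [this]
    exact t.toFinset.finite_toSet.isClosed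
  let v : ℂ → E := fun z => if z ∈ s then rootProd (s.filter (· ≠ z)) z • G z z
    else rootProd s z • u z
  have hv : ∀ z, z ∉ s → v z = rootProd s z • u z := fun z hz => if_neg hz
  refine ⟨v, HolOn.of_local fun p hp => ?_, fun z hz => hv z hz.2⟩
  by_cases hps : p ∈ s
  · refine ⟨(V p ∩ W) \ {z | z ∈ s.filter (· ≠ p)}, ((hV p hp hps).inter hW).sdiff (hfin _),
      ⟨⟨hpV p hp hps, hp⟩, by simp⟩, ?_⟩
    refine (((hG p hp hps).mono fun z hz => hz.1.1).smul
      (differentiable_rootProd (s.filter (· ≠ p))).differentiableOn).congr fun z hz => ?_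
    by_cases hzs : z ∈ s
    · have : z = p := by
        by_contra hne
        exact hz.2 (Multiset.mem_filter.2 ⟨hzs, hne⟩)
      subst this
      exact if_pos hzs
    · beta_reduce
      rw [hv z hzs, hGu p hp hps z hz.1.1 hz.1.2 hzs, rootProd_eq_pow_mul s p z, smul_smul,
        mul_comm]
  · exact ⟨W \ {z | z ∈ s}, hW.sdiff (hfin s), ⟨hp, hps⟩,
      (hu.smul (differentiable_rootProd s).differentiableOn).congr fun z hz => hv z hz.2⟩

open scoped Classical in
/-- The denominator of the functions subordinate to a finite set of pairs. -/
noncomputable def den (A : Finset (ℂ × ℕ)) : Multiset ℂ :=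
  A.sup fun x => Multiset.replicate (x.2 + 1) x.1

open scoped Classical in
theorem count_den (A : Finset (ℂ × ℕ)) (p : ℂ) :
    (den A).count p = A.sup fun x => if x.1 = p then x.2 + 1 else 0 := by
  rw [den, Multiset.count_finset_sup]
  simp only [Multiset.count_replicate]

-- A set of pairs may contain several l for the same p, and the denominator takes the largest
-- exponent. The maximum is attained by an actual pair, as `Subordinate` demands.
open scoped Classical in
theorem exists_count_den {A : Finset (ℂ × ℕ)} {p : ℂ} (hp : p ∈ proj (A : Set (ℂ × ℕ))) :
    ∃ l, (p, l) ∈ A ∧ (den A).count p = l + 1 := by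
  obtain ⟨⟨p', l₀⟩, hl, rfl⟩ := hp
  obtain ⟨⟨p, l⟩, hx, hx'⟩ := A.exists_mem_eq_sup ⟨_, hl⟩ fun x => if x.1 = p' then x.2 + 1 else 0
  have h1 := Finset.le_sup (f := fun x : ℂ × ℕ => if x.1 = p' then x.2 + 1 else 0) hl
  rw [count_den, hx']
  rw [hx'] at h1
  simp only [if_true] at h1
  by_cases hpp : p = p'
  · subst hpp
    exact ⟨l, hx, if_pos rfl⟩
  · simp [hpp] at h1

open scoped Classical in
theorem le_count_den {A : Finset (ℂ × ℕ)} {x : ℂ × ℕ} (hx : x ∈ A) :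
    x.2 + 1 ≤ (den A).count x.1 := by
  rw [count_den]
  have := Finset.le_sup (f := fun y : ℂ × ℕ => if y.1 = x.1 then y.2 + 1 else 0) hx
  simpa using this

theorem mem_den {A : Finset (ℂ × ℕ)} {p : ℂ} : p ∈ den A ↔ p ∈ proj (A : Set (ℂ × ℕ)) := by
  classical
  constructor
  · intro h
    rw [← Multiset.count_pos, count_den, Finset.lt_sup_iff] at h
    obtain ⟨x, hx, hxp⟩ := h
    exact ⟨x, hx, by by_contra hne; simp [hne] at hxp⟩
  · intro h
    obtain ⟨l, -, hl⟩ := exists_count_den h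
    exact Multiset.count_pos.1 (by omega)

theorem card_den_le (A : Finset (ℂ × ℕ)) : (den A).card ≤ ∑ x ∈ A, (1 + x.2) := by
  classical
  have h : den A ≤ ∑ x ∈ A, Multiset.replicate (x.2 + 1) x.1 :=
    Finset.sup_le fun x hx =>
      Finset.single_le_sum (f := fun x : ℂ × ℕ => Multiset.replicate (x.2 + 1) x.1)
        (fun _ _ => Multiset.zero_le _) hx
  refine (Multiset.card_le_card h).trans_eq ?_
  rw [Multiset.card_sum]
  simp [add_comm]

/-- The translation back from multisets to sets of pairs, preserving the total multiplicity. -/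
theorem exists_le_den (s : Multiset ℂ) : ∃ A : Finset (ℂ × ℕ), (∀ p ∈ proj (A : Set (ℂ × ℕ)), p ∈ s) ∧
    ∑ x ∈ A, (1 + x.2) = s.card ∧ s ≤ den A := by
  classical
  -- A pair (p, l) stands for multiplicity l + 1, hence the shift; counts of members are positive,
  -- so nothing is lost by truncated subtraction.
  refine ⟨s.toFinset.image fun p => (p, s.count p - 1), ?_, ?_, ?_⟩
  · rintro p ⟨x, hx, rfl⟩
    obtain ⟨p, hp, rfl⟩ := Finset.mem_image.1 (Finset.mem_coe.1 hx)
    exact Multiset.mem_toFinset.1 hp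
  · rw [Finset.sum_image fun p _ p' _ h => congrArg Prod.fst h, ← Multiset.toFinset_sum_count_eq]
    refine Finset.sum_congr rfl fun p hp => ?_
    have := Multiset.count_pos.2 (Multiset.mem_toFinset.1 hp)
    simp only
    omega
  · rw [Multiset.le_iff_count]
    intro p
    by_cases hp : p ∈ s
    · have h1 := le_count_den (A := s.toFinset.image fun p => (p, s.count p - 1))
        (x := (p, s.count p - 1)) (Finset.mem_image_of_mem _ (Multiset.mem_toFinset.2 hp))
      simp only at h1
      omega
    · rw [Multiset.count_eq_zero_of_notMem hp]
      exact Nat.zero_le _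

/-- A subordinate function has the corresponding denominator on every open set that contains
only finitely many of the pairs. -/
theorem Subordinate.hasDen {A : Set (ℂ × ℕ)} {f : Hol E (proj A)ᶜ} (hf : Subordinate A f)
    {W : Set ℂ} (hW : IsOpen W) {B : Finset (ℂ × ℕ)} (hB : (B : Set (ℂ × ℕ)) = restr W A) :
    HasDen W (W \ proj A) (den B) (fn f) := by
  classical
  have hBW : W \ {z | z ∈ den B} = W \ proj A := by
    ext z
    simp only [Set.mem_sdiff, mem_ofPred_eq, mem_den, hB]
    refine and_congr_right fun hz => not_congr ⟨?_, ?_⟩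
    · rintro ⟨x, hx, rfl⟩
      exact ⟨x, hx.1, rfl⟩
    · rintro ⟨x, hx, rfl⟩
      exact ⟨x, ⟨hx, hz⟩, rfl⟩
  have hfin : IsClosed {z | z ∈ den B} := by
    have : {z | z ∈ den B} = ((den B).toFinset : Set ℂ) := by ext; simp
    rw [this]
    exact (den B).toFinset.finite_toSet.isClosed
  have ho : IsOpen (W \ proj A) := hBW ▸ hW.sdiff hfin
  rw [← hBW]
  refine HasDen.of_forall_local hW ?_ fun p hpW hp => ?_
  · rw [hBW]
    exact (fn_holOn (Hol.resL (fun z hz => hz.2) f) ho).congr fun z hz =>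
      (Hol.fn_resL (fun z hz => hz.2) f hz).symm
  · obtain ⟨x, hx, hxp⟩ := mem_den.1 hp
    rw [hB] at hx
    obtain ⟨l, hl, V, hV, hpV, G, hG⟩ := hf p ⟨x, hx.1, hxp⟩
    have hlB : (p, l) ∈ B := by
      rw [← Finset.mem_coe, hB]
      exact ⟨hl, hpW⟩
    obtain ⟨k, hk⟩ := Nat.exists_eq_add_of_le (le_count_den hlB)
    refine ⟨V, hV, hpV, fun z => (z - p) ^ k • fn G z,
      (fn_holOn G hV).smul (by fun_prop), fun z hzV hzW hz => ?_⟩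
    have hzA : z ∈ (proj A)ᶜ := (hBW ▸ (⟨hzW, hz⟩ : z ∈ W \ {z | z ∈ den B}) : z ∈ W \ proj A).2
    beta_reduce
    rw [fn_apply G hzV, hG z hzV hzA (by rintro rfl; exact hz hp), hk, smul_smul, mul_comm, ← pow_add,
      fn_apply f hzA, add_comm]

theorem ExtendsSubordinate.hasDen {K : Set ℂ} {A : Finset (ℂ × ℕ)}
    (hAK : proj (A : Set (ℂ × ℕ)) ⊆ K) {g : Hol E Kᶜ} (hg : ExtendsSubordinate A g) :
    HasDen univ Kᶜ (den A) (fn g) := by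
  obtain ⟨f, hf, hfg⟩ := hg
  have h1 := hf.hasDen isOpen_univ (B := A) (by ext; simp [restr])
  have hK : Kᶜ ⊆ univ \ proj (A : Set (ℂ × ℕ)) := fun z hz => ⟨mem_univ z, fun h => hz (hAK h)⟩
  refine (h1.mono subset_rfl hK).congr fun z hz => ?_
  rw [fn_apply g hz, fn_apply f (hK hz).2]
  exact hfg z hz (hK hz).2

/-- The quotient of the entire numerator by the denominator is the extension. At p the power of z -
p cancels and the remaining factors of the denominator do not vanish, which gives the order of the
pole. -/
theorem HasDen.extendsSubordinate {K : Set ℂ} {A : Finset (ℂ × ℕ)} {g : Hol E Kᶜ} (hg : HasDen univ Kᶜ (den A) (fn g)) :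
    ExtendsSubordinate A g := by
  classical
  obtain ⟨v, hv, hvg⟩ := hg
  have hfin : ∀ t : Multiset ℂ, IsClosed {z | z ∈ t} := fun t => by
    have : {z | z ∈ t} = (t.toFinset : Set ℂ) := by ext; simp
    rw [this]
    exact t.toFinset.finite_toSet.isClosed
  have ho : IsOpen (proj (A : Set (ℂ × ℕ)))ᶜ := (A.finite_toSet.image _).isClosed.isOpen_compl
  have hf : HolOn (fun z => (rootProd (den A) z)⁻¹ • v z) (proj (A : Set (ℂ × ℕ)))ᶜ :=
    (hv.mono (subset_univ _)).smul ((differentiable_rootProd _).differentiableOn.inv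
      fun z hz => rootProd_ne_zero fun h => hz (mem_den.1 h))
  refine ⟨hf.toHol ho, fun p hp => ?_, fun z hzK hzA => ?_⟩
  · obtain ⟨l, hl, hlc⟩ := exists_count_den hp
    have hVo : IsOpen {z | z ∈ (den A).filter (· ≠ p)}ᶜ := (hfin _).isOpen_compl
    have hG : HolOn (fun z => (rootProd ((den A).filter (· ≠ p)) z)⁻¹ • v z)
        {z | z ∈ (den A).filter (· ≠ p)}ᶜ :=
      (hv.mono (subset_univ _)).smul ((differentiable_rootProd _).differentiableOn.inv
        fun z hz => rootProd_ne_zero hz)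
    refine ⟨l, hl, _, hVo, by simp, hG.toHol hVo, fun z hzV hzA hzp => ?_⟩
    rw [← fn_apply _ hzV, ← fn_apply _ hzA, HolOn.fn_toHol _ _ hzV, HolOn.fn_toHol _ _ hzA,
      rootProd_eq_pow_mul (den A) p z, hlc, mul_inv, mul_smul, smul_inv_smul₀]
    exact pow_ne_zero _ (sub_ne_zero.2 hzp)
  · rw [← fn_apply g hzK, ← fn_apply _ hzA, HolOn.fn_toHol _ _ hzA, hvg z hzK, inv_smul_smul₀]
    exact rootProd_ne_zero fun h => hzA (mem_den.1 h)

/-- This dictionary makes the estimates for denominators available for the bullet spaces. -/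
theorem mem_bullet_iff {q : ℕ} {U : Set (EuclideanSpace ℝ (Fin q))} {K : Set ℂ}
    {g : CInf (Hol E Kᶜ) U} : g ∈ bullet E U K ↔ ∃ m : ℕ, ∀ y, ∃ s : Multiset ℂ,
      (∀ a ∈ s, a ∈ K) ∧ s.card ≤ m ∧ HasDen univ Kᶜ s (fn (ev g y)) := by
  constructor
  · rintro ⟨M, hM⟩
    refine ⟨M, fun y => ?_⟩
    obtain ⟨A, hAK, hAM, hA⟩ := hM y
    exact ⟨den A, fun a ha => hAK (mem_den.1 ha), (card_den_le A).trans hAM, hA.hasDen hAK⟩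
  · rintro ⟨m, hm⟩
    refine ⟨m, fun y => ?_⟩
    obtain ⟨s, hsK, hsm, hs⟩ := hm y
    obtain ⟨A, hA, hAs, hsA⟩ := exists_le_den s
    have hAK : proj (A : Set (ℂ × ℕ)) ⊆ K := fun p hp => hsK p (hA p hp)
    exact ⟨A, hAK, hAs.trans_le hsm, (hs.of_le hsA).extendsSubordinate⟩

/-- Multiplication by a fixed denominator is continuous, and the condition says that the product
lies in the closed range of restriction. -/
theorem isClosed_setOf_hasDen_const {W D : Set ℂ} (hW : IsOpen W) (hD : IsOpen D) (hDW : D ⊆ W)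
    (hK : IsCompact (W \ D)) (s : Multiset ℂ) : IsClosed {u : Hol E D | HasDen W D s (fn u)} := by
  have : LocallyCompactSpace D := hD.locallyCompactSpace
  have hhol : ∀ u : Hol E D, HolOn (fun z => rootProd s z • fn u z) D := fun u =>
    (fn_holOn u hD).smul (differentiable_rootProd _).differentiableOn
  let T : Hol E D → Hol E D := fun u => (hhol u).toHol hD
  have hT : Continuous T := by
    refine continuous_induced_rng.2 (ContinuousMap.continuous_of_continuous_uncurry _ ?_)
    have h1 : Continuous fun y : Hol E D × D => rootProd s (y.2 : ℂ) • y.1.1 y.2 := by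
      refine Continuous.smul ?_ ?_
      · exact (differentiable_rootProd s).continuous.comp (by fun_prop)
      · exact (continuous_subtype_val.comp continuous_fst).eval continuous_snd
    convert h1 using 2 with y
    change rootProd s (y.2 : ℂ) • fn y.1 y.2 = _
    rw [fn_coe]
  convert (isClosed_range_resL (E := E) hW hD hDW hK).preimage hT using 1
  ext u
  constructor
  · rintro ⟨v, hv, hvu⟩
    refine ⟨hv.toHol hW, ext_fn fun z hz => ?_⟩
    rw [Hol.fn_resL hDW _ hz, HolOn.fn_toHol _ _ (hDW hz), HolOn.fn_toHol _ _ hz, hvu z hz]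
  · rintro ⟨v, hv⟩
    refine ⟨fn v, fn_holOn v hW, fun z hz => ?_⟩
    rw [← Hol.fn_resL hDW v hz, hv, HolOn.fn_toHol _ _ hz]

/-! ### The summands and the non-direct sum as Fréchet spaces -/

section AsymptoticTypes

variable {q : ℕ} {Ω : Set (EuclideanSpace ℝ (Fin q))}
  {R : EuclideanSpace ℝ (Fin q) → Set (ℂ × ℕ)}

theorem restr_mono {K K' : Set ℂ} (h : K ⊆ K') (A : Set (ℂ × ℕ)) : restr K A ⊆ restr K' A :=
  fun _ hx => ⟨hx.1, h hx.2⟩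

theorem isOpen_strip (c c' : ℝ) : IsOpen (strip c c') :=
  (isOpen_lt continuous_const Complex.continuous_re).inter
    (isOpen_lt Complex.continuous_re continuous_const)

theorem exists_subset_strip {K : Set ℂ} (hK : IsCompact K) : ∃ c : ℝ, 0 < c ∧ K ⊆ strip (-c) c := by
  obtain ⟨r, hr⟩ := hK.isBounded.subset_ball 0
  refine ⟨|r| + 1, by positivity, fun z hz => ?_⟩
  have h1 := mem_ball_zero_iff.1 (hr hz)
  have h2 := abs_le.1 (Complex.abs_re_le_norm z)
  have h3 := le_abs_self r
  exact ⟨by linarith, by linarith⟩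

/-- Over a relatively compact set, the number of the pairs over a compact set, counted with
multiplicities, is bounded. -/
theorem IsAsymptoticType.exists_bound (hR : IsAsymptoticType Ω R)
    {U : Set (EuclideanSpace ℝ (Fin q))} (hU : U ∈ relCompactOpens Ω) {K : Set ℂ}
    (hK : IsCompact K) : ∃ M : ℕ, ∀ y ∈ U, ∃ A : Finset (ℂ × ℕ),
      (A : Set (ℂ × ℕ)) = restr K (R y) ∧ ∑ x ∈ A, (1 + x.2) ≤ M := by
  obtain ⟨c, hc, hKc⟩ := exists_subset_strip hK
  obtain ⟨b, hb, hb', rfl⟩ := hR (-c) c U (by linarith) hU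
  choose M hM using b.bounded
  refine ⟨∑ i, M i, fun y hy => ?_⟩
  obtain ⟨i, hi⟩ := mem_iUnion.1 (b.cover (subset_closure hy))
  have hsub : restr K (R y) ⊆ restr (b.K i) (R y) := by
    intro x hx
    refine ⟨hx.1, b.poles_subset i y hi ⟨⟨x, hx.1, rfl⟩, ?_⟩⟩
    have h1 := hKc hx.2
    have h2 := b.ε_pos i
    rw [hb, hb']
    exact ⟨by linarith [h1.1], by linarith [h1.2]⟩
  have hbd : ∀ A : Finset (ℂ × ℕ), (A : Set (ℂ × ℕ)) ⊆ restr K (R y) →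
      ∑ x ∈ A, (1 + x.2) ≤ ∑ i, M i := fun A hA =>
    (hM i y hi A (hA.trans hsub)).trans
      (Finset.single_le_sum (fun _ _ => Nat.zero_le _) (Finset.mem_univ i))
  -- The definition bounds only sums over finite subsets. As every pair contributes at least 1, the
  -- bound also forces finiteness.
  have hfin : (restr K (R y)).Finite := by
    by_contra hinf
    obtain ⟨A, hA, hAc⟩ := Set.Infinite.exists_subset_card_eq hinf (∑ i, M i + 1)
    have h1 := hbd A hA
    have h2 : A.card ≤ ∑ x ∈ A, (1 + x.2) := by
      rw [Finset.card_eq_sum_ones]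
      exact Finset.sum_le_sum fun x _ => by omega
    omega
  exact ⟨hfin.toFinset, hfin.coe_toFinset, hbd _ (by rw [hfin.coe_toFinset])⟩

namespace Datum

variable (b : Datum Ω R)

theorem isCompact_Kb : IsCompact b.Kb := isCompact_iUnion b.K_compact

theorem isOpen_compl_Kb : IsOpen b.Kbᶜ := b.isCompact_Kb.isClosed.isOpen_compl

theorem isOpen_S : IsOpen b.S := isOpen_strip _ _

theorem isOpen_Sε (i) : IsOpen (b.Sε i) := isOpen_strip _ _

theorem S_subset_Sε (i) : b.S ⊆ b.Sε i := fun z hz =>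
  ⟨by have := b.ε_pos i; linarith [hz.1], by have := b.ε_pos i; linarith [hz.2]⟩

theorem K_subset_Kb (i) : b.K i ⊆ b.Kb := subset_iUnion _ i

/-- The asymptotic type already bounds the degree of the denominators uniformly in y, so the uniform
bound in `bullet` is automatic and membership becomes a condition at each y separately. -/
theorem mem_merPart_iff (hR : IsAsymptoticType Ω R) {g : CInf (Hol E b.Kbᶜ) b.U} :
    g ∈ b.merPart E ↔ ∀ (y : b.U) (A : Finset (ℂ × ℕ)), (A : Set (ℂ × ℕ)) = restr b.Kb (R y) →
      HasDen univ b.Kbᶜ (den A) (fn (ev g y)) := by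
  have hproj : ∀ (y : b.U) (A : Finset (ℂ × ℕ)), (A : Set (ℂ × ℕ)) = restr b.Kb (R y) →
      proj (A : Set (ℂ × ℕ)) ⊆ b.Kb := by
    rintro y A hA _ ⟨x, hx, rfl⟩
    rw [hA] at hx
    exact hx.2
  constructor
  · rintro ⟨-, hg⟩ y A hA
    have := hg y
    rw [← hA] at this
    exact this.hasDen (hproj y A hA)
  · intro h
    obtain ⟨M, hM⟩ := hR.exists_bound b.U_mem b.isCompact_Kb
    refine ⟨mem_bullet_iff.2 ⟨M, fun y => ?_⟩, fun y => ?_⟩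
    · obtain ⟨A, hA, hAM⟩ := hM y y.2
      exact ⟨den A, fun a ha => hproj y A hA (mem_den.1 ha), (card_den_le A).trans hAM, h y A hA⟩
    · obtain ⟨A, hA, hAM⟩ := hM y y.2
      rw [← hA]
      exact (h y A hA).extendsSubordinate

/-- Membership is an intersection over y of conditions with a fixed denominator, each closed and
pulled back along a continuous evaluation. -/
theorem isClosed_merPart (hR : IsAsymptoticType Ω R) :
    IsClosed (b.merPart E : Set (CInf (Hol E b.Kbᶜ) b.U)) := by
  have : (b.merPart E : Set (CInf (Hol E b.Kbᶜ) b.U)) =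
      ⋂ (y : b.U) (A : Finset (ℂ × ℕ)) (_ : (A : Set (ℂ × ℕ)) = restr b.Kb (R y)),
        (fun g => ev g y) ⁻¹' {u | HasDen univ b.Kbᶜ (den A) (fn u)} := by
    ext g
    simp only [SetLike.mem_coe, b.mem_merPart_iff hR, mem_iInter, mem_preimage, mem_ofPred_eq]
  rw [this]
  have := Hol.frechetSpace (E := E) b.isOpen_compl_Kb
  refine isClosed_iInter fun y => isClosed_iInter fun A => isClosed_iInter fun _ => ?_
  refine (isClosed_setOf_hasDen_const isOpen_univ b.isOpen_compl_Kb (subset_univ _) ?_ _).preimage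
    (continuous_ev y)
  rw [← compl_eq_univ_sdiff, compl_compl]
  exact b.isCompact_Kb

theorem frechetSpace_holPart : FrechetSpace (CInf (Hol E b.S) b.U) := by
  have := Hol.frechetSpace (E := E) b.isOpen_S
  exact frechetSpace_cInf b.U_mem.1

theorem frechetSpace_merPart (hR : IsAsymptoticType Ω R) : FrechetSpace (b.merPart E) := by
  have := Hol.frechetSpace (E := E) b.isOpen_compl_Kb
  have := frechetSpace_cInf (F := Hol E b.Kbᶜ) b.U_mem.1
  exact FrechetSpace.of_isClosed _ (b.isClosed_merPart hR)

theorem sumMap_apply (x : CInf (Hol E b.S) b.U × b.merPart E) (y : b.U) (z : ↥(b.S \ b.Kb)) :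
    b.sumMap E x y z = fn (ev x.1 y) z + fn (ev x.2.1 y) z := by
  rw [fn_apply _ z.2.1, fn_apply _ z.2.2]
  rfl

theorem continuous_sumMap_apply (y : b.U) (z : ↥(b.S \ b.Kb)) :
    Continuous fun x => b.sumMap E x y z := by
  have := Hol.frechetSpace (E := E) b.isOpen_S
  have := Hol.frechetSpace (E := E) b.isOpen_compl_Kb
  simp only [sumMap_apply]
  exact ((continuous_fn _).comp ((continuous_ev y).comp continuous_fst)).add
    ((continuous_fn _).comp ((continuous_ev y).comp
      (continuous_subtype_val.comp continuous_snd)))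

/-- The kernel of the sum map is the common zero set of the continuous evaluations at points (y, z),
so it is closed. -/
theorem frechetSpace_sumSpace (hR : IsAsymptoticType Ω R) :
    @FrechetSpace (b.sumSpace E) _ _ (b.sumTopology E) := by
  have := b.frechetSpace_holPart (E := E)
  have := b.frechetSpace_merPart (E := E) hR
  refine FrechetSpace.coinduced _ (LinearMap.surjective_rangeRestrict _) ?_
  have key : IsClosed {x : CInf (Hol E b.S) b.U × b.merPart E | ∀ y z, b.sumMap E x y z = 0} := by
    simp only [ofPred_forall]
    exact isClosed_iInter fun y => isClosed_iInter fun z =>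
      isClosed_eq (b.continuous_sumMap_apply y z) continuous_const
  refine (congrArg IsClosed (Set.ext fun x => ?_)).mpr key
  exact ⟨fun h y z => congrFun (congrFun (congrArg Subtype.val h) y) z,
    fun h => Subtype.ext (funext fun y => funext (h y))⟩

/-- The quotient topology is handled later only through these evaluations: they make overlap
conditions and graphs closed. -/
theorem continuous_sumSpace_apply (y : b.U) (z : ↥(b.S \ b.Kb)) :
    @Continuous _ _ (b.sumTopology E) _
      fun x : b.sumSpace E => (x : b.U → ↥(b.S \ b.Kb) → E) y z :=
  continuous_coinduced_dom.2 (b.continuous_sumMap_apply y z)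

end Datum

end AsymptoticTypes

end Mellin

/-! ### Smooth families restrict to the non-direct sums -/

namespace Mellin

section evaluation

variable {F : Type*} [AddCommGroup F] [Module ℂ F] [TopologicalSpace F]
  [IsTopologicalAddGroup F] [ContinuousConstSMul ℂ F]
  {q : ℕ} {U : Set (EuclideanSpace ℝ (Fin q))}

theorem ev_add (u v : CInf F U) (y : U) : ev (u + v) y = ev u y + ev v y := rfl

theorem ev_sub (u v : CInf F U) (y : U) : ev (u - v) y = ev u y - ev v y := rfl

theorem ev_sum {ι : Type*} (s : Finset ι) (u : ι → CInf F U) (y : U) :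
    ev (∑ i ∈ s, u i) y = ∑ i ∈ s, ev (u i) y :=
  map_sum (⟨⟨fun D => ev D y, rfl⟩, fun u v => ev_add u v y⟩ : CInf F U →+ F) u s

end evaluation

/-- A finite smooth partition of unity on a compact set. -/
theorem exists_partition {q n : ℕ} {C : Set (EuclideanSpace ℝ (Fin q))} (hC : IsClosed C)
    (V : Fin n → Set (EuclideanSpace ℝ (Fin q))) (hV : ∀ i, IsOpen (V i)) (hCV : C ⊆ ⋃ i, V i) :
    ∃ χ : Fin n → EuclideanSpace ℝ (Fin q) → ℝ, (∀ i, ContDiff ℝ (⊤ : ℕ∞) (χ i)) ∧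
      (∀ i, tsupport (χ i) ⊆ V i) ∧ ∀ y ∈ C, ∑ i, χ i y = 1 := by
  obtain ⟨f, hf⟩ := SmoothPartitionOfUnity.exists_isSubordinate
    (modelWithCornersSelf ℝ (EuclideanSpace ℝ (Fin q))) hC V hV hCV
  refine ⟨fun i => f i, fun i => (f i).contMDiff.contDiff, hf, fun y hy => ?_⟩
  rw [← finsum_eq_sum_of_fintype]
  exact f.sum_eq_one hy

theorem exists_surrounds {K : Set ℂ} (hK : IsCompact K) {c c' : ℝ} (hc : c < c')
    (hKs : K ⊆ strip c c') : ∃ a b : ℂ, Surrounds a b K ∧ closedRect a b ⊆ strip c c' := by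
  obtain ⟨r, hr⟩ := hK.isBounded.subset_ball 0
  -- The midpoint keeps the set nonempty, so that extremal real parts exist even when K is empty.
  have hK' : IsCompact (insert (((c + c') / 2 : ℝ) : ℂ) K) := hK.insert _
  obtain ⟨z₁, hz₁, h1⟩ := hK'.exists_isMinOn (insert_nonempty _ _) Complex.continuous_re.continuousOn
  obtain ⟨z₂, hz₂, h2⟩ := hK'.exists_isMaxOn (insert_nonempty _ _) Complex.continuous_re.continuousOn
  have hs : ∀ z ∈ insert (((c + c') / 2 : ℝ) : ℂ) K, c < z.re ∧ z.re < c' := by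
    rintro z (rfl | hz)
    · simp only [Complex.ofReal_re]
      exact ⟨by linarith, by linarith⟩
    · exact hKs hz
  have h3 := hs z₁ hz₁
  have h4 := hs z₂ hz₂
  have h5 : z₁.re ≤ z₂.re := h1 hz₂
  refine ⟨⟨(c + z₁.re) / 2, -|r| - 1⟩, ⟨(z₂.re + c') / 2, |r| + 1⟩,
    ⟨by simp only; linarith, by simp only; linarith [abs_nonneg r], fun z hz => ?_⟩,
    fun z hz => ?_⟩
  · have k1 := mem_ball_zero_iff.1 (hr hz)
    have k3 := abs_le.1 (Complex.abs_im_le_norm z)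
    have k4 := le_abs_self r
    have k5 : z₁.re ≤ z.re := h1 (mem_insert_of_mem _ hz)
    have k6 : z.re ≤ z₂.re := h2 (mem_insert_of_mem _ hz)
    exact ⟨⟨by simp only; linarith, by simp only; linarith⟩,
      ⟨by simp only; linarith, by simp only; linarith⟩⟩
  · obtain ⟨⟨k1, k2⟩, -⟩ := hz
    simp only at k1 k2
    exact ⟨by linarith, by linarith⟩

variable {E : Type*} [AddCommGroup E] [Module ℂ E] [TopologicalSpace E] [FrechetSpace E]

theorem HasDen.sum {W D : Set ℂ} {s : Multiset ℂ} {ι : Type*} (t : Finset ι) {u : ι → ℂ → E}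
    (h : ∀ i ∈ t, HasDen W D s (u i)) : HasDen W D s (fun z => ∑ i ∈ t, u i z) := by
  classical
  induction t using Finset.induction_on with
  | empty => exact .of_holOn (by simpa using HolOn.const (0 : E)) s
  | insert i t hi ih =>
    simp only [Finset.sum_insert hi]
    exact (h i (Finset.mem_insert_self i t)).add
      (ih fun j hj => h j (Finset.mem_insert_of_mem hj))

theorem fn_sum {ι : Type*} {W : Set ℂ} (s : Finset ι) (u : ι → Hol E W) (z : ℂ) :
    fn (∑ i ∈ s, u i) z = ∑ i ∈ s, fn (u i) z :=
  map_sum (⟨⟨fun f => fn f z, fn_zero z⟩, fun f g => fn_add f g z⟩ : Hol E W →+ E) u s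

theorem den_mono {A B : Finset (ℂ × ℕ)} (h : A ⊆ B) : den A ≤ den B := by
  classical
  exact Finset.sup_mono h

variable {q : ℕ} {Ω : Set (EuclideanSpace ℝ (Fin q))}
  {R : EuclideanSpace ℝ (Fin q) → Set (ℂ × ℕ)}

namespace Datum

variable (b : Datum Ω R)

theorem restr_Sε {i : Fin (b.N + 1)} {y : EuclideanSpace ℝ (Fin q)} (hy : y ∈ b.V i) :
    restr (b.Sε i) (R y) = restr (b.K i) (R y) := by
  ext x
  exact and_congr_right fun hx => ⟨fun h => b.poles_subset i y hy ⟨⟨x, hx, rfl⟩, h⟩,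
    fun h => b.K_subset i h⟩

theorem hasDen_of_subordinate {i : Fin (b.N + 1)} {y : EuclideanSpace ℝ (Fin q)} (hy : y ∈ b.V i)
    {f : Hol E (proj (R y))ᶜ} (hf : Subordinate (R y) f) {A : Finset (ℂ × ℕ)}
    (hA : (A : Set (ℂ × ℕ)) = restr (b.K i) (R y)) :
    HasDen (b.Sε i) (b.Sε i \ b.K i) (den A) (fn f) :=
  (hf.hasDen (b.isOpen_Sε i) (hA.trans (b.restr_Sε hy).symm)).mono subset_rfl
    fun _ hz => ⟨hz.1, b.not_mem_proj_of_V hy hz⟩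

/-- The functional of f over `b.V i` comes from a family g with poles in `b.K i`. Since f - g has
vanishing functional, it is holomorphic across `b.K i`; this is h. On the larger strip g = f - h, so
g has no worse poles than f. -/
theorem exists_local_splitting (hR : IsAsymptoticType Ω R)
    {f : ∀ y : Ω, Hol E (proj (R y))ᶜ} (hf : f ∈ MSpace E Ω R) (i : Fin (b.N + 1)) :
    ∃ (h : CInf (Hol E b.S) (b.V i)) (g : CInf (Hol E b.Kbᶜ) (b.V i)), ∀ y : b.V i,
      (∀ z ∈ b.S \ b.Kb, fn (f ⟨y, b.mem_Ω_of_V y.2⟩) z = fn (ev h y) z + fn (ev g y) z) ∧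
      ∀ A : Finset (ℂ × ℕ), (A : Set (ℂ × ℕ)) = restr b.Kb (R y) →
        HasDen univ b.Kbᶜ (den A) (fn (ev g y)) := by
  obtain ⟨⟨F, hF⟩, δ, ⟨g, hg, hgδ⟩, hfδ⟩ := hf.2 b i
  have hKo : IsOpen (b.K i)ᶜ := (b.K_compact i).isClosed.isOpen_compl
  have hDo : IsOpen (b.Sε i \ b.K i) := (b.isOpen_Sε i).sdiff (b.K_compact i).isClosed
  have hFf : ∀ (y : b.V i), ∀ z ∈ b.Sε i \ b.K i,
      fn (ev F y) z = fn (f ⟨y, b.mem_Ω_of_V y.2⟩) z := fun y z hz => by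
    rw [fn_apply _ hz, fn_apply _ (b.not_mem_proj_of_V y.2 hz)]
    exact hF y ⟨z, hz⟩
  obtain ⟨M, hM⟩ := hR.exists_bound (b.V_mem i) (b.K_compact i)
  have hfden : ∀ (y : b.V i) (A : Finset (ℂ × ℕ)), (A : Set (ℂ × ℕ)) = restr (b.K i) (R y) →
      HasDen (b.Sε i) (b.Sε i \ b.K i) (den A) (fn (f ⟨y, b.mem_Ω_of_V y.2⟩)) := fun y A hA =>
    b.hasDen_of_subordinate y.2 (hf.1 ⟨y, b.mem_Ω_of_V y.2⟩) hA
  obtain ⟨m, hm⟩ := mem_bullet_iff.1 hg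
  have hvan : ∀ y : b.V i, ∃ w : ℂ → E, HolOn w (b.Sε i) ∧ ∀ z ∈ b.Sε i \ b.K i,
      w z = fn (f ⟨y, b.mem_Ω_of_V y.2⟩) z - fn (ev g y) z := by
    intro y
    have hlt : b.c - b.ε i < b.c' + b.ε i := by linarith [b.lt, b.ε_pos i]
    obtain ⟨u, v, huv, huvS⟩ := exists_surrounds (b.K_compact i) hlt (b.K_subset i)
    obtain ⟨A, hA, -⟩ := hM y y.2
    obtain ⟨s, hsK, -, hs⟩ := hm y
    have hAK : ∀ a ∈ den A, a ∈ b.K i := fun a ha => by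
      obtain ⟨x, hx, rfl⟩ := mem_den.1 ha
      rw [hA] at hx
      exact hx.2
    refine exists_holOn_of_isRectIntegral_zero (b.isOpen_Sε i) (b.K_subset i) huv huvS
      (s := den A + s) (fun x hx => (Multiset.mem_add.1 hx).elim (hAK x) (hsK x))
      ((hfden y A hA).sub (hs.mono (subset_univ _) fun z hz => hz.2)) fun P hP => ?_
    have hPh : HolOn P univ := ⟨hP.continuous.continuousOn, fun φ =>
      (φ.differentiable.comp hP).differentiableOn⟩
    -- Both f and g represent the same functional along this rectangle, so the integrals of P f and
    -- P g cancel for every entire P.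
    have h1 := (hfδ y u v huv huvS (hPh.toHol isOpen_univ)).add
      ((hgδ y u v huv (hPh.toHol isOpen_univ)).smul (-1))
    rw [neg_one_smul, add_neg_cancel] at h1
    convert h1 using 2 with z
    change P z • (fn (f ⟨y, b.mem_Ω_of_V y.2⟩) z - fn (ev g y) z) =
      P z • fn (f ⟨y, b.mem_Ω_of_V y.2⟩) z + (-1 : ℂ) • P z • fn (ev g y) z
    module
  have := Hol.frechetSpace (E := E) hKo
  have := Hol.frechetSpace (E := E) hDo
  have := Hol.frechetSpace (E := E) b.isOpen_S
  have := Hol.frechetSpace (E := E) (b.isOpen_Sε i)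
  have := Hol.frechetSpace (E := E) b.isOpen_compl_Kb
  have hDK : b.Sε i \ b.K i ⊆ (b.K i)ᶜ := fun z hz => hz.2
  obtain ⟨g₁, hg₁⟩ := exists_cInf_map (U := b.V i) subset_rfl (Hol.resL (E := E) hDK) g
  have hdiff : b.Sε i \ (b.Sε i \ b.K i) = b.K i := by
    rw [sdiff_sdiff_right_self]
    exact inter_eq_right.2 (b.K_subset i)
  -- Degree 0 with no admissible zeros: the difference is holomorphic for each y, and this makes its
  -- extension over `b.K i` smooth in y.
  obtain ⟨h, hh⟩ := exists_cInf_extend (b.V_mem i).1 (b.isOpen_Sε i) hDo sdiff_subset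
    (by rw [hdiff]; exact b.K_compact i) isCompact_empty (empty_subset _) (b.isOpen_Sε i)
    (by rw [sdiff_empty]) (F - g₁) 0 (fun y => by
      obtain ⟨w, hw, hwe⟩ := hvan y
      refine ⟨0, by simp, by simp, w, hw, fun z hz => ?_⟩
      rw [rootProd_zero, one_smul, ev_sub, fn_sub, hg₁, Hol.fn_resL _ _ hz, hwe z hz, hFf y z hz])
  have hsplit : ∀ (y : b.V i), ∀ z ∈ b.Sε i \ b.K i,
      fn (f ⟨y, b.mem_Ω_of_V y.2⟩) z = fn (ev h y) z + fn (ev g y) z := by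
    intro y z hz
    obtain ⟨s, -, hs0, v, -, h1, h2⟩ := hh y
    obtain rfl : s = 0 := Multiset.card_eq_zero.1 (Nat.le_zero.1 hs0)
    have h3 := h1 z hz
    rw [h2 z hz.1, rootProd_zero, one_smul, one_smul, ev_sub, fn_sub, hg₁, Hol.fn_resL _ _ hz,
      hFf y z hz] at h3
    rw [h3, sub_add_cancel]
  -- Membership in the bullet space allows g arbitrary poles in `b.K i`. Gluing `rootProd (den A) •
  -- g` off `b.K i` to the numerator of f minus the multiple of h on the strip shows that the
  -- denominator of f suffices.
  have hgden : ∀ (y : b.V i) (A : Finset (ℂ × ℕ)), (A : Set (ℂ × ℕ)) = restr (b.K i) (R y) →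
      HasDen univ (b.K i)ᶜ (den A) (fn (ev g y)) := by
    intro y A hA
    obtain ⟨v, hv, hvf⟩ := hfden y A hA
    obtain ⟨w, hw, hw1, -⟩ := ((fn_holOn (ev g y) hKo).smul
      (differentiable_rootProd (den A)).differentiableOn).exists_glue
      (hv.sub ((fn_holOn (ev h y) (b.isOpen_Sε i)).smul
        (differentiable_rootProd (den A)).differentiableOn)) hKo (b.isOpen_Sε i) fun z hz => by
        rw [hvf z ⟨hz.2, hz.1⟩, hsplit y z ⟨hz.2, hz.1⟩]
        module
    refine ⟨w, hw.mono fun z _ => ?_, hw1⟩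
    by_cases hz : z ∈ b.K i
    · exact Or.inr (b.K_subset i hz)
    · exact Or.inl hz
  obtain ⟨h', hh'⟩ := exists_cInf_map (U := b.V i) subset_rfl (Hol.resL (E := E) (b.S_subset_Sε i)) h
  have hKK : b.Kbᶜ ⊆ (b.K i)ᶜ := compl_subset_compl.2 (b.K_subset_Kb i)
  obtain ⟨g', hg'⟩ := exists_cInf_map (U := b.V i) subset_rfl (Hol.resL (E := E) hKK) g
  refine ⟨h', g', fun y => ⟨fun z hz => ?_, fun A hA => ?_⟩⟩
  · rw [hh', hg', Hol.fn_resL _ _ hz.1, Hol.fn_resL _ _ hz.2]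
    exact hsplit y z ⟨b.S_subset_Sε i hz.1, hKK hz.2⟩
  · obtain ⟨B, hB, -⟩ := hM y y.2
    have hBA : B ⊆ A := by
      rw [← Finset.coe_subset, hA, hB]
      exact restr_mono (b.K_subset_Kb i) _
    refine (((hgden y B hB).mono subset_rfl hKK).of_le (den_mono hBA)).congr fun z hz => ?_
    rw [hg', Hol.fn_resL _ _ hz]

/-- A partition of unity in y glues the local splittings. At each fixed y this is a linear
combination of functions with the same denominator, so it creates no new poles and raises no orders.
-/
theorem restrict_mem_sumSpace (hR : IsAsymptoticType Ω R)
    {f : ∀ y : Ω, Hol E (proj (R y))ᶜ} (hf : f ∈ MSpace E Ω R) : b.restrict f ∈ b.sumSpace E := by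
  choose h g hfg hden using b.exists_local_splitting hR hf
  obtain ⟨χ, hχ, hχV, hχ1⟩ := exists_partition isClosed_closure b.V (fun i => (b.V_mem i).1) b.cover
  have := Hol.frechetSpace (E := E) b.isOpen_S
  have := Hol.frechetSpace (E := E) b.isOpen_compl_Kb
  choose H hH using fun i => exists_cInf_cutoff b.U_mem.1 (b.V_mem i).1 (h i) (hχ i) (hχV i)
  choose G hG using fun i => exists_cInf_cutoff b.U_mem.1 (b.V_mem i).1 (g i) (hχ i) (hχV i)
  have hGm : ∑ i, G i ∈ b.merPart E := by
    rw [b.mem_merPart_iff hR]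
    intro y A hA
    refine (HasDen.sum Finset.univ (u := fun i => fn (ev (G i) y)) fun i _ => ?_).congr fun z _ => ?_
    · by_cases hy : (y : EuclideanSpace ℝ (Fin q)) ∈ b.V i
      · refine ((hden i ⟨y, hy⟩ A hA).const_smul (χ i y : ℂ)).congr fun z _ => ?_
        rw [hG, extU_apply _ hy, fn_smul]
      · refine HasDen.of_holOn ((HolOn.const 0).congr fun z _ => ?_) _
        rw [hG, extU_of_notMem _ hy, smul_zero, fn_zero]
    · rw [ev_sum, fn_sum]
  refine ⟨(∑ i, H i, ⟨∑ i, G i, hGm⟩), ?_⟩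
  funext y z
  rw [b.sumMap_apply]
  change _ = (f ⟨y, b.mem_Ω y.2⟩).1 ⟨z, b.not_mem_proj y.2 z.2⟩
  rw [← fn_apply, ev_sum, ev_sum, fn_sum,
    fn_sum, ← Finset.sum_add_distrib]
  have h1 : ∀ i, fn (ev (H i) y) z + fn (ev (G i) y) z =
      (χ i y : ℂ) • fn (f ⟨y, b.mem_Ω y.2⟩) z := by
    intro i
    rw [hH, hG, fn_smul, fn_smul, ← smul_add]
    by_cases hy : (y : EuclideanSpace ℝ (Fin q)) ∈ b.V i
    · rw [extU_apply _ hy, extU_apply _ hy, hfg i ⟨y, hy⟩ z z.2]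
    · have : χ i y = 0 := image_eq_zero_of_notMem_tsupport fun h => hy (hχV i h)
      rw [this, Complex.ofReal_zero, zero_smul, zero_smul]
  simp only [h1]
  rw [← Finset.sum_smul, ← Complex.ofReal_sum, hχ1 y (subset_closure y.2), Complex.ofReal_one,
    one_smul]

end Datum

end Mellin

/-! ### Identity theorem on strips and recovery of a family from its restrictions -/

namespace Mellin

/-- An arctangent in the real part maps the plane bijectively and continuously onto the strip, and
the plane minus a countable set is connected. -/
theorem isPreconnected_strip_diff {c c' : ℝ} (hc : c < c') {P : Set ℂ} (hP : P.Finite) :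
    IsPreconnected (strip c c' \ P) := by
  let σ : ℝ → ℝ := fun x => c + (c' - c) * (Real.arctan x / Real.pi + 1 / 2)
  have hσ : Continuous σ := by
    have := Real.continuous_arctan
    fun_prop
  have hpi := Real.pi_pos
  have hσi : Function.Injective σ := by
    intro x y hxy
    have h1 : (c' - c) * (Real.arctan x / Real.pi + 1 / 2) =
        (c' - c) * (Real.arctan y / Real.pi + 1 / 2) := add_left_cancel hxy
    have h2 := mul_left_cancel₀ (sub_ne_zero.2 hc.ne') h1
    have h3 : Real.arctan x / Real.pi = Real.arctan y / Real.pi := add_right_cancel h2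
    exact Real.arctan_injective ((div_left_inj' hpi.ne').1 h3)
  have hσm : ∀ x, c < σ x ∧ σ x < c' := by
    intro x
    have h1 := Real.neg_pi_div_two_lt_arctan x
    have h2 := Real.arctan_lt_pi_div_two x
    have h3 : 0 < Real.arctan x / Real.pi + 1 / 2 := by
      have : 0 < (Real.arctan x + Real.pi / 2) / Real.pi := div_pos (by linarith) hpi
      rwa [add_div, div_div, mul_comm, ← div_div, div_self hpi.ne'] at this
    have h4 : Real.arctan x / Real.pi + 1 / 2 < 1 := by
      have : (Real.arctan x + Real.pi / 2) / Real.pi < 1 := by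
        rw [div_lt_one hpi]
        linarith
      rwa [add_div, div_div, mul_comm, ← div_div, div_self hpi.ne'] at this
    constructor <;> simp only [σ] <;> nlinarith
  have hσs : ∀ t, c < t → t < c' → ∃ x, σ x = t := by
    intro t h1 h2
    have h3 : ((t - c) / (c' - c) - 1 / 2) * Real.pi ∈ range Real.arctan := by
      rw [Real.range_arctan]
      have h4 : 0 < (t - c) / (c' - c) := div_pos (by linarith) (by linarith)
      have h5 : (t - c) / (c' - c) < 1 := (div_lt_one (by linarith)).2 (by linarith)
      constructor <;> nlinarith
    obtain ⟨x, hx⟩ := h3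
    refine ⟨x, ?_⟩
    simp only [σ]
    rw [hx, mul_div_cancel_right₀ _ hpi.ne', sub_add_cancel, mul_div_cancel₀ _ (by linarith)]
    ring
  let φ : ℂ → ℂ := fun z => (σ z.re : ℂ) + z.im * Complex.I
  have hre : ∀ z, (φ z).re = σ z.re := fun z => by simp [φ]
  have him : ∀ z, (φ z).im = z.im := fun z => by simp [φ]
  have hφ : Continuous φ := by fun_prop
  have hφi : Function.Injective φ := fun z w h => Complex.ext
    (hσi (by rw [← hre z, h, hre])) (by rw [← him z, h, him])
  have hcount : (φ ⁻¹' P).Countable := (hP.preimage hφi.injOn).countable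
  have hconn : IsPreconnected (φ ⁻¹' P)ᶜ :=
    (hcount.isConnected_compl_of_one_lt_rank (by rw [Complex.rank_real_complex]; norm_num)).2
  convert hconn.image φ hφ.continuousOn using 1
  ext z
  constructor
  · rintro ⟨⟨h1, h2⟩, hzP⟩
    obtain ⟨x, hx⟩ := hσs _ h1 h2
    have hz : φ ⟨x, z.im⟩ = z := Complex.ext ((hre _).trans hx) (him _)
    exact ⟨_, fun h => hzP (by rwa [mem_preimage, hz] at h), hz⟩
  · rintro ⟨w, hw, rfl⟩
    exact ⟨⟨by rw [hre]; exact (hσm _).1, by rw [hre]; exact (hσm _).2⟩, hw⟩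

theorem exists_mem_strip_notMem {c c' : ℝ} (hc : c < c') {L : Set ℂ} (hL : IsCompact L) :
    ∃ z ∈ strip c c', z ∉ L := by
  obtain ⟨r, hr⟩ := hL.isBounded.subset_ball 0
  refine ⟨⟨(c + c') / 2, |r| + 1⟩, ⟨by simp only; linarith, by simp only; linarith⟩, fun h => ?_⟩
  have h1 := mem_ball_zero_iff.1 (hr h)
  have h2 := abs_le.1 (Complex.abs_im_le_norm ⟨(c + c') / 2, |r| + 1⟩)
  simp only at h2
  linarith [le_abs_self r]

variable {E : Type*} [AddCommGroup E] [Module ℂ E] [TopologicalSpace E] [FrechetSpace E]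

/-- The identity theorem on a strip minus a finite set. -/
theorem HolOn.eq_of_strip {c c' : ℝ} (hc : c < c') {P L : Set ℂ} (hP : P.Finite)
    (hL : IsCompact L) {u w : ℂ → E} (hu : HolOn u (strip c c' \ P))
    (hw : HolOn w (strip c c' \ P)) (h : ∀ z ∈ strip c c' \ P, z ∉ L → u z = w z) :
    ∀ z ∈ strip c c' \ P, u z = w z := by
  obtain ⟨z₀, hz₀, hz₀'⟩ := exists_mem_strip_notMem hc (hP.isCompact.union hL)
  have hmem : z₀ ∈ strip c c' \ (P ∪ L) := ⟨hz₀, hz₀'⟩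
  have ho : IsOpen (strip c c' \ (P ∪ L)) :=
    (isOpen_strip c c').sdiff (hP.isCompact.union hL).isClosed
  intro z hz
  refine sub_eq_zero.1 ((hu.sub hw).eqOn_zero ((isOpen_strip c c').sdiff hP.isClosed)
    (isPreconnected_strip_diff hc hP) (z₀ := z₀) ⟨hz₀, fun h => hz₀' (Or.inl h)⟩ ?_ z hz)
  filter_upwards [ho.mem_nhds hmem] with x hx
  exact sub_eq_zero.2 (h x ⟨hx.1, fun h => hx.2 (Or.inl h)⟩ fun h => hx.2 (Or.inr h))

/-- Entire functions that agree off a compact set are equal. -/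
theorem HolOn.eq_of_compl {L : Set ℂ} (hL : IsCompact L) {u w : ℂ → E} (hu : HolOn u univ)
    (hw : HolOn w univ) (h : ∀ z ∉ L, u z = w z) (z : ℂ) : u z = w z := by
  obtain ⟨z₀, -, hz₀⟩ := exists_mem_strip_notMem zero_lt_one hL
  refine sub_eq_zero.1 ((hu.sub hw).eqOn_zero isOpen_univ isPreconnected_univ (mem_univ z₀) ?_ z
    (mem_univ z))
  filter_upwards [hL.isClosed.isOpen_compl.mem_nhds hz₀] with x hx
  exact sub_eq_zero.2 (h x hx)

variable {q : ℕ} {Ω : Set (EuclideanSpace ℝ (Fin q))}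
  {R : EuclideanSpace ℝ (Fin q) → Set (ℂ × ℕ)}

theorem finite_setOf_mem (s : Multiset ℂ) : {z | z ∈ s}.Finite := by
  classical
  have : {z | z ∈ s} = (s.toFinset : Set ℂ) := by ext; simp
  rw [this]
  exact s.toFinset.finite_toSet

theorem fn_holOn_diff {P W : Set ℂ} (f : Hol E Pᶜ) (h : IsOpen (W \ P)) : HolOn (fn f) (W \ P) :=
  (fn_holOn (Hol.resL (fun _ hz => hz.2) f) h).congr fun _ hz =>
    (Hol.fn_resL (fun _ hz => hz.2) f hz).symm

namespace Datum

variable (b : Datum Ω R)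

/-- Inside the strip all points of R(y) lie in `b.Kb`, so only the finitely many zeros of the
denominator are removed. This finiteness feeds the identity theorem. -/
theorem S_diff_proj {y : EuclideanSpace ℝ (Fin q)} (hy : y ∈ b.U) {A : Finset (ℂ × ℕ)}
    (hA : (A : Set (ℂ × ℕ)) = restr b.Kb (R y)) :
    b.S \ proj (R y) = b.S \ {z | z ∈ den A} := by
  ext z
  refine and_congr_right fun hz => not_congr ⟨fun h => ?_, fun h => ?_⟩
  · have hzK : z ∈ b.Kb := by
      by_contra hzK
      exact b.not_mem_proj hy ⟨hz, hzK⟩ h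
    obtain ⟨x, hx, rfl⟩ := h
    refine mem_den.2 ⟨x, ?_, rfl⟩
    rw [hA]
    exact ⟨hx, hzK⟩
  · obtain ⟨x, hx, rfl⟩ := mem_den.1 h
    rw [hA] at hx
    exact ⟨x, hx.1, rfl⟩

/-- A function whose restriction lies in the non-direct sum is given on the whole strip by the
meromorphic extension. -/
theorem eq_of_sumMap_eq {f : ∀ y : Ω, Hol E (proj (R y))ᶜ}
    {x : CInf (Hol E b.S) b.U × b.merPart E} (hx : b.sumMap E x = b.restrict f) (y : b.U)
    {A : Finset (ℂ × ℕ)} (hA : (A : Set (ℂ × ℕ)) = restr b.Kb (R y)) {v : ℂ → E}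
    (hv : HolOn v univ) (hvg : ∀ z ∈ b.Kbᶜ, v z = rootProd (den A) z • fn (ev x.2.1 y) z) :
    ∀ z ∈ b.S \ proj (R y), fn (f ⟨y, b.mem_Ω y.2⟩) z =
      fn (ev x.1 y) z + (rootProd (den A) z)⁻¹ • v z := by
  have hfin := finite_setOf_mem (den A)
  have ho : IsOpen (b.S \ {z | z ∈ den A}) := b.isOpen_S.sdiff hfin.isClosed
  rw [b.S_diff_proj y.2 hA]
  refine HolOn.eq_of_strip b.lt hfin b.isCompact_Kb ?_ ?_ fun z hz hzK => ?_
  · have h1 := fn_holOn_diff (W := b.S) (f ⟨y, b.mem_Ω y.2⟩)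
      (by rw [b.S_diff_proj y.2 hA]; exact ho)
    rwa [b.S_diff_proj y.2 hA] at h1
  · exact ((fn_holOn _ b.isOpen_S).mono sdiff_subset).add ((hv.mono (subset_univ _)).smul
      ((differentiable_rootProd _).differentiableOn.inv fun z hz => rootProd_ne_zero hz.2))
  · rw [hvg z hzK, inv_smul_smul₀ (rootProd_ne_zero hz.2)]
    have h1 := congrFun (congrFun hx y) ⟨z, hz.1, hzK⟩
    rw [b.sumMap_apply] at h1
    rw [h1, fn_apply _ (b.not_mem_proj y.2 ⟨hz.1, hzK⟩)]
    rfl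

-- On the strip f equals a holomorphic function plus v divided by the denominator of R(y). The
-- exponent of z - p in that denominator is l + 1 for some pair (p, l) of R(y).
open scoped Classical in
theorem poleOrder_of_mem_sumSpace (hR : IsAsymptoticType Ω R)
    {f : ∀ y : Ω, Hol E (proj (R y))ᶜ} (hf : b.restrict f ∈ b.sumSpace E) (y : b.U) {p : ℂ}
    (hpS : p ∈ b.S) (hp : p ∈ proj (R y)) :
    ∃ l : ℕ, (p, l) ∈ R y ∧ PoleOrderLE (f ⟨y, b.mem_Ω y.2⟩) p (l + 1) := by
  obtain ⟨x, hx⟩ := hf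
  obtain ⟨M, hM⟩ := hR.exists_bound b.U_mem b.isCompact_Kb
  obtain ⟨A, hA, -⟩ := hM y y.2
  obtain ⟨v, hv, hvg⟩ := (b.mem_merPart_iff hR).1 x.2.2 y A hA
  have key := b.eq_of_sumMap_eq hx y hA hv hvg
  have hpA : p ∈ den A := by
    by_contra h
    have : p ∈ b.S \ proj (R y) := by
      rw [b.S_diff_proj y.2 hA]
      exact ⟨hpS, h⟩
    exact this.2 hp
  obtain ⟨l, hl, hlc⟩ := exists_count_den (mem_den.1 hpA)
  have hlR : (p, l) ∈ R y := by
    rw [← Finset.mem_coe, hA] at hl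
    exact hl.1
  have hVo : IsOpen (b.S \ {z | z ∈ (den A).filter (· ≠ p)}) :=
    b.isOpen_S.sdiff (finite_setOf_mem _).isClosed
  have hG : HolOn (fun z => (z - p) ^ (l + 1) • fn (ev x.1 y) z +
      (rootProd ((den A).filter (· ≠ p)) z)⁻¹ • v z)
      (b.S \ {z | z ∈ (den A).filter (· ≠ p)}) :=
    (((fn_holOn _ b.isOpen_S).mono sdiff_subset).smul (by fun_prop)).add
      ((hv.mono (subset_univ _)).smul ((differentiable_rootProd _).differentiableOn.inv
        fun z hz => rootProd_ne_zero hz.2))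
  refine ⟨l, hlR, _, hVo, ⟨hpS, by simp⟩, hG.toHol hVo, fun z hzV hzR hzp => ?_⟩
  rw [← fn_apply _ hzV, HolOn.fn_toHol _ _ hzV, ← fn_apply _ hzR, key z ⟨hzV.1, hzR⟩, smul_add,
    rootProd_eq_pow_mul (den A) p z, hlc, mul_inv, mul_smul, smul_inv_smul₀]
  exact pow_ne_zero _ (sub_ne_zero.2 hzp)

/-- A family whose restriction lies in the non-direct sum for a larger strip and a larger set of
parameters is locally smooth off the poles. -/
theorem exists_cInf_of_mem_sumSpace (hR : IsAsymptoticType Ω R)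
    {f : ∀ y : Ω, Hol E (proj (R y))ᶜ} (d : Datum Ω R) (i : Fin (d.N + 1)) (hU : d.V i ⊆ b.U)
    (hS : d.Sε i ⊆ b.S) (hf : b.restrict f ∈ b.sumSpace E) :
    ∃ F : CInf (Hol E (d.Sε i \ d.K i)) (d.V i), ∀ y : d.V i, ∀ z ∈ d.Sε i \ d.K i,
      fn (ev F y) z = fn (f ⟨y, d.mem_Ω_of_V y.2⟩) z := by
  obtain ⟨x, hx⟩ := hf
  obtain ⟨M, hM⟩ := hR.exists_bound b.U_mem b.isCompact_Kb
  have hDo : IsOpen (d.Sε i \ d.K i) := (d.isOpen_Sε i).sdiff (d.K_compact i).isClosed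
  -- For y in `d.V i` no point of R(y) lies in `d.Sε i \ d.K i`, so the actual poles are confined to
  -- Z. The meromorphic summand, smooth a priori only off `b.Kb`, thus extends smoothly to the
  -- complement of Z.
  set Z : Set ℂ := b.Kb \ (d.Sε i \ d.K i) with hZ
  have hZc : IsCompact Z := b.isCompact_Kb.diff hDo
  have := Hol.frechetSpace (E := E) hDo
  have := Hol.frechetSpace (E := E) b.isOpen_S
  have := Hol.frechetSpace (E := E) b.isOpen_compl_Kb
  have := Hol.frechetSpace (E := E) hZc.isClosed.isOpen_compl
  have hAZ : ∀ (y : d.V i) (A : Finset (ℂ × ℕ)), (A : Set (ℂ × ℕ)) = restr b.Kb (R y) →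
      ∀ a ∈ den A, a ∈ Z := by
    intro y A hA a ha
    obtain ⟨x, hx, rfl⟩ := mem_den.1 ha
    rw [hA] at hx
    exact ⟨hx.2, fun h => d.not_mem_proj_of_V y.2 h ⟨x, hx.1, rfl⟩⟩
  obtain ⟨g₁, hg₁⟩ := exists_cInf_map hU (ContinuousLinearMap.id ℂ _) x.2.1
  have huniv : (univ : Set ℂ) \ b.Kbᶜ = b.Kb := by rw [← compl_eq_univ_sdiff, compl_compl]
  obtain ⟨g', hg'⟩ := exists_cInf_extend (d.V_mem i).1 isOpen_univ b.isOpen_compl_Kb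
    (subset_univ _) (by rw [huniv]; exact b.isCompact_Kb) hZc (by rw [huniv]; exact sdiff_subset)
    hZc.isClosed.isOpen_compl (by rw [← compl_eq_univ_sdiff]) g₁ M fun y => by
      obtain ⟨A, hA, hAM⟩ := hM y (hU y.2)
      refine ⟨den A, hAZ y A hA, (card_den_le A).trans hAM, ?_⟩
      rw [hg₁]
      exact (b.mem_merPart_iff hR).1 x.2.2 ⟨y, hU y.2⟩ A hA
  have hDZ : d.Sε i \ d.K i ⊆ Zᶜ := fun z hz hzZ => hzZ.2 hz
  have hDS : d.Sε i \ d.K i ⊆ b.S := sdiff_subset.trans hS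
  obtain ⟨F₁, hF₁⟩ := exists_cInf_map hU (Hol.resL (E := E) hDS) x.1
  obtain ⟨F₂, hF₂⟩ := exists_cInf_map (U := d.V i) subset_rfl (Hol.resL (E := E) hDZ) g'
  refine ⟨F₁ + F₂, fun y z hz => ?_⟩
  rw [ev_add, fn_add, hF₁, hF₂, Hol.fn_resL _ _ hz, Hol.fn_resL _ _ hz]
  obtain ⟨A, hA, -⟩ := hM y (hU y.2)
  obtain ⟨v, hv, hvg⟩ := (b.mem_merPart_iff hR).1 x.2.2 ⟨y, hU y.2⟩ A hA
  rw [b.eq_of_sumMap_eq hx ⟨y, hU y.2⟩ hA hv hvg z ⟨hDS hz, d.not_mem_proj_of_V y.2 hz⟩]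
  obtain ⟨s, hsZ, -, w, hw, hw1, hw2⟩ := hg' y
  -- The extension theorem returns its own denominator s. Cross-multiplied, the two representations
  -- are entire functions that agree off `b.Kb`, hence everywhere.
  have h1 : rootProd s z • v z = rootProd (den A) z • w z :=
    HolOn.eq_of_compl b.isCompact_Kb (hv.smul (differentiable_rootProd s).differentiableOn)
      (hw.smul (differentiable_rootProd (den A)).differentiableOn) (fun z hz => by
        rw [hvg z hz, hw1 z hz, hg₁, smul_comm]
        rfl) z
  have hs0 : rootProd s z ≠ 0 := rootProd_ne_zero fun h => hDZ hz (hsZ z h)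
  have hA0 : rootProd (den A) z ≠ 0 := rootProd_ne_zero fun h => hDZ hz (hAZ y A hA z h)
  rw [hw2 z (hDZ hz), smul_comm] at h1
  rw [smul_right_injective E hs0 h1, inv_smul_smul₀ hA0]

end Datum

theorem exists_relCompactOpens (hΩ : IsOpen Ω) {y : EuclideanSpace ℝ (Fin q)} (hy : y ∈ Ω) :
    ∃ U ∈ relCompactOpens Ω, y ∈ U := by
  obtain ⟨U, hUo, hU, hUΩ, hUc⟩ := exists_open_between_and_isCompact_closure
    (isCompact_singleton (x := y)) hΩ (singleton_subset_iff.2 hy)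
  exact ⟨U, ⟨hUo, hUc, hUΩ⟩, singleton_subset_iff.1 hU⟩

/-- A family belongs to the space of smooth families of meromorphic functions as soon as its
restrictions belong to the non-direct sums of an exhausting sequence. -/
theorem mem_MSpace_of_restrict (hΩ : IsOpen Ω) (hR : IsAsymptoticType Ω R) {b : ℕ → Datum Ω R}
    (hb : Exhausting b) {f : ∀ y : Ω, Hol E (proj (R y))ᶜ}
    (hf : ∀ n, (b n).restrict f ∈ (b n).sumSpace E) : f ∈ MSpace E Ω R := by
  have hsub : ∀ y : Ω, Subordinate (R y) (f y) := by
    intro y p hp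
    obtain ⟨U, hU, hyU⟩ := exists_relCompactOpens hΩ y.2
    -- Subordination is local in y and p, so any strip around p over a neighbourhood of y will do.
    obtain ⟨n, h1, h2, h3⟩ := hb (p.re - 1) (p.re + 1) U (by linarith) hU
    exact (b n).poleOrder_of_mem_sumSpace hR (hf n) ⟨y, h3 hyU⟩
      ⟨by linarith, by linarith⟩ hp
  refine ⟨hsub, fun d i => ?_⟩
  have hlt : d.c - d.ε i < d.c' + d.ε i := by linarith [d.lt, d.ε_pos i]
  -- Exhaustion is applied to the enlarged strip over `d.V i`, not to the strip and parameter set of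
  -- d itself.
  obtain ⟨n, h1, h2, h3⟩ := hb _ _ _ hlt (d.V_mem i)
  obtain ⟨F, hF⟩ := (b n).exists_cInf_of_mem_sumSpace hR d i h3
    (fun z hz => ⟨h1.trans_lt hz.1, hz.2.trans_le h2⟩) (hf n)
  refine ⟨⟨F, fun y z => ?_⟩, ?_⟩
  · rw [← fn_apply _ z.2, hF y z z.2, fn_apply]
  · obtain ⟨M, hM⟩ := hR.exists_bound (d.V_mem i) (d.K_compact i)
    -- The smooth principal part g of f represents the functional of f, because the holomorphic
    -- remainder integrates to zero.
    obtain ⟨g, hg⟩ := exists_cInf_split (d.V_mem i).1 (d.isOpen_Sε i) (d.K_compact i)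
      (d.K_subset i) F M fun y => by
        obtain ⟨A, hA, hAM⟩ := hM y y.2
        refine ⟨den A, fun a ha => ?_, (card_den_le A).trans hAM,
          (d.hasDen_of_subordinate y.2 (hsub ⟨y, d.mem_Ω_of_V y.2⟩) hA).congr fun z hz => hF y z hz⟩
        obtain ⟨x, hx, rfl⟩ := mem_den.1 ha
        rw [hA] at hx
        exact hx.2
    have hfun : ∀ y : d.V i, ∃ ζ : Hol ℂ univ →L[ℂ] E, ∀ h a b, Surrounds a b (d.K i) →
        IsRectIntegral a b (fun z => fn h z • fn (ev g y) z) (ζ h) := fun y => by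
      obtain ⟨⟨s, hsK, -, hs⟩, -⟩ := hg y
      exact hs.exists_functional (d.K_compact i) hsK
    choose ζ hζ using hfun
    have hfn : ∀ (h : Hol ℂ univ) (z : ℂ), fn h z = h.1 ⟨z, mem_univ z⟩ := fun h z =>
      fn_apply h (mem_univ z)
    refine ⟨ζ, ⟨g, mem_bullet_iff.2 ⟨M, fun y => (hg y).1⟩, fun y u v huv h => ?_⟩,
      fun y u v huv huvS h => ?_⟩
    · have := hζ y h u v huv
      simp only [hfn] at this
      exact this
    · obtain ⟨-, k, hk, hgk⟩ := hg y
      have h4 := ((hk.smul (((fn_holOn h isOpen_univ).2 (.id ℂ ℂ)).mono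
        (subset_univ _))).isRectIntegral_zero huv.1.le huv.2.1.le huvS)
      have h5 := (hζ y h u v huv).add h4
      rw [add_zero] at h5
      refine h5.congr huv.1.le huv.2.1.le fun z hz => ?_
      have hzD : z ∈ d.Sε i \ d.K i := ⟨huvS hz.1, huv.rectFrame_subset hz⟩
      have h6 := hgk z hzD
      rw [hF y z hzD] at h6
      change fn h z • fn (ev g y) z + fn h z • k z =
        h.1 ⟨z, mem_univ z⟩ • fn (f ⟨y, d.mem_Ω_of_V y.2⟩) z
      rw [h6, hfn, smul_add]

end Mellin

/-! ### Initial topologies and exhausting sequences -/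

theorem FrechetSpace.iInf_induced {ι V : Type*} [Countable ι] [AddCommGroup V] [Module ℂ V]
    {W : ι → Type*} [∀ i, AddCommGroup (W i)] [∀ i, Module ℂ (W i)] [∀ i, TopologicalSpace (W i)]
    [∀ i, FrechetSpace (W i)] (r : ∀ i, V →ₗ[ℂ] W i)
    (hinj : Function.Injective (LinearMap.pi r)) (hcl : IsClosed (range (LinearMap.pi r))) :
    @FrechetSpace V _ _ (⨅ i, TopologicalSpace.induced (r i) inferInstance) := by
  let _ : TopologicalSpace V := ⨅ i, TopologicalSpace.induced (r i) inferInstance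
  refine FrechetSpace.of_isClosedEmbedding (LinearMap.pi r) ⟨⟨⟨?_⟩, hinj⟩, hcl⟩
  exact (induced_to_pi _).symm

namespace Mellin

variable {E : Type*} [AddCommGroup E] [Module ℂ E] [TopologicalSpace E] [FrechetSpace E]

variable {q : ℕ} {Ω : Set (EuclideanSpace ℝ (Fin q))}
  {R : EuclideanSpace ℝ (Fin q) → Set (ℂ × ℕ)}

theorem exists_exhausting (hΩ : IsOpen Ω) (hR : IsAsymptoticType Ω R) :
    ∃ b : ℕ → Datum Ω R, Exhausting b := by
  have : LocallyCompactSpace Ω := hΩ.locallyCompactSpace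
  have hemb := hΩ.isOpenEmbedding_subtypeVal
  let C : CompactExhaustion Ω := default
  have hU : ∀ n, Subtype.val '' interior (C n) ∈ relCompactOpens Ω := by
    intro n
    have hc : IsCompact (Subtype.val '' C n) := (C.isCompact n).image continuous_subtype_val
    have h1 : closure (Subtype.val '' interior (C n)) ⊆ Subtype.val '' C n :=
      closure_minimal (image_mono interior_subset) hc.isClosed
    refine ⟨hemb.isOpenMap _ isOpen_interior, hc.of_isClosed_subset isClosed_closure h1,
      h1.trans ?_⟩
    rintro _ ⟨y, -, rfl⟩
    exact y.2
  choose b hb hb' hbU using fun n : ℕ => hR (-(n + 1 : ℝ)) (n + 1)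
    (Subtype.val '' interior (C n)) (by linarith [n.cast_nonneg (α := ℝ)]) (hU n)
  refine ⟨b, fun c c' U _ hUm => ?_⟩
  have hcU : IsCompact (Subtype.val ⁻¹' closure U : Set Ω) :=
    hemb.isInducing.isCompact_preimage_iff (by rw [Subtype.range_coe]; exact hUm.2.2)
      |>.2 hUm.2.1
  obtain ⟨k, hk⟩ := C.exists_superset_of_isCompact hcU
  obtain ⟨l, hl⟩ := exists_nat_ge (max |c| |c'|)
  -- The shift to k + 1 is needed because the parameter sets are interiors, and `C k` lies in the
  -- interior of `C (k + 1)`.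
  refine ⟨max (k + 1) l, ?_, ?_, fun y hy => ?_⟩
  · rw [hb]
    have h1 : (l : ℝ) ≤ (max (k + 1) l : ℕ) := by exact_mod_cast le_max_right _ _
    linarith [neg_abs_le c, le_max_left |c| |c'|]
  · rw [hb']
    have h1 : (l : ℝ) ≤ (max (k + 1) l : ℕ) := by exact_mod_cast le_max_right _ _
    linarith [le_abs_self c', le_max_right |c| |c'|]
  · rw [hbU]
    have hyΩ : y ∈ Ω := hUm.2.2 (subset_closure hy)
    have h1 : (⟨y, hyΩ⟩ : Ω) ∈ C k := hk (subset_closure hy)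
    refine ⟨⟨y, hyΩ⟩, ?_, rfl⟩
    exact interior_mono (C.subset (le_max_left _ _)) (C.subset_interior_succ k h1)

namespace Datum

variable (b : Datum Ω R)

theorem isOpen_S_diff_proj (hR : IsAsymptoticType Ω R) (y : b.U) : IsOpen (b.S \ proj (R y)) := by
  obtain ⟨M, hM⟩ := hR.exists_bound b.U_mem b.isCompact_Kb
  obtain ⟨A, hA, -⟩ := hM y y.2
  rw [b.S_diff_proj y.2 hA]
  exact b.isOpen_S.sdiff (finite_setOf_mem _).isClosed

/-- The identity theorem on the strip without the poles. -/
theorem eq_of_eq_off_compact (hR : IsAsymptoticType Ω R) (y : b.U) {c c' : ℝ} (hc : b.c ≤ c)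
    (hc' : c' ≤ b.c') {L : Set ℂ} (hL : IsCompact L) {u w : ℂ → E}
    (hu : HolOn u (strip c c' \ proj (R y))) (hw : HolOn w (strip c c' \ proj (R y)))
    (h : ∀ z ∈ strip c c' \ proj (R y), z ∉ L → u z = w z) :
    ∀ z ∈ strip c c' \ proj (R y), u z = w z := by
  obtain ⟨M, hM⟩ := hR.exists_bound b.U_mem b.isCompact_Kb
  obtain ⟨A, hA, -⟩ := hM y y.2
  have heq : strip c c' \ proj (R y) = strip c c' \ {z | z ∈ den A} := by
    ext z
    refine and_congr_right fun hz => ?_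
    have hzS : z ∈ b.S := ⟨hc.trans_lt hz.1, hz.2.trans_le hc'⟩
    have := Set.ext_iff.1 (b.S_diff_proj y.2 hA) z
    simpa only [Set.mem_sdiff, hzS, true_and] using this
  intro z hz
  have hlt : c < c' := hz.1.1.trans hz.1.2
  rw [heq] at hu hw h hz
  exact HolOn.eq_of_strip hlt (finite_setOf_mem _) hL hu hw h z hz

/-- Elements of the non-direct sum extend holomorphically to the strip without the poles. -/
theorem exists_holOn_of_mem_sumSpace (hR : IsAsymptoticType Ω R)
    {w : b.U → ↥(b.S \ b.Kb) → E} (hw : w ∈ b.sumSpace E) (y : b.U) :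
    ∃ F : ℂ → E, HolOn F (b.S \ proj (R y)) ∧ ∀ z : ↥(b.S \ b.Kb), F z = w y z := by
  obtain ⟨x, rfl⟩ := hw
  obtain ⟨M, hM⟩ := hR.exists_bound b.U_mem b.isCompact_Kb
  obtain ⟨A, hA, -⟩ := hM y y.2
  obtain ⟨v, hv, hvg⟩ := (b.mem_merPart_iff hR).1 x.2.2 y A hA
  refine ⟨fun z => fn (ev x.1 y) z + (rootProd (den A) z)⁻¹ • v z, ?_, fun z => ?_⟩
  · rw [b.S_diff_proj y.2 hA]
    exact ((fn_holOn _ b.isOpen_S).mono sdiff_subset).add ((hv.mono (subset_univ _)).smul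
      ((differentiable_rootProd _).differentiableOn.inv fun z hz => rootProd_ne_zero hz.2))
  · have hz : (z : ℂ) ∈ b.S \ proj (R y) := ⟨z.2.1, b.not_mem_proj y.2 z.2⟩
    rw [b.S_diff_proj y.2 hA] at hz
    beta_reduce
    rw [b.sumMap_apply, hvg z z.2.2, inv_smul_smul₀ (rootProd_ne_zero hz.2)]

theorem restrict_apply (f : ∀ y : Ω, Hol E (proj (R y))ᶜ) (y : b.U) (z : ↥(b.S \ b.Kb)) :
    b.restrict f y z = fn (f ⟨y, b.mem_Ω y.2⟩) z :=
  (fn_apply _ (b.not_mem_proj y.2 z.2)).symm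

variable (E) in
/-- The restriction map to the non-direct sum. -/
noncomputable def restrictL (hR : IsAsymptoticType Ω R) : MSpace E Ω R →ₗ[ℂ] b.sumSpace E where
  toFun f := ⟨b.restrict f.1, b.restrict_mem_sumSpace hR f.2⟩
  map_add' _ _ := rfl
  map_smul' _ _ := rfl

end Datum

theorem exists_mem_of_exhausting (hΩ : IsOpen Ω) {b : ℕ → Datum Ω R} (hb : Exhausting b) (y : Ω)
    (z : ℂ) : ∃ n, (y : EuclideanSpace ℝ (Fin q)) ∈ (b n).U ∧ z ∈ (b n).S := by
  obtain ⟨U, hU, hyU⟩ := exists_relCompactOpens hΩ y.2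
  obtain ⟨n, h1, h2, h3⟩ := hb (z.re - 1) (z.re + 1) U (by linarith) hU
  exact ⟨n, h3 hyU, by linarith, by linarith⟩

theorem isOpen_compl_proj (hΩ : IsOpen Ω) (hR : IsAsymptoticType Ω R) {b : ℕ → Datum Ω R}
    (hb : Exhausting b) (y : Ω) : IsOpen (proj (R y))ᶜ := by
  refine isOpen_iff_mem_nhds.2 fun z hz => ?_
  obtain ⟨n, hy, hzS⟩ := exists_mem_of_exhausting hΩ hb y z
  exact mem_of_superset (((b n).isOpen_S_diff_proj hR ⟨y, hy⟩).mem_nhds ⟨hzS, hz⟩)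
    fun _ hx => hx.2

/-- Every (y, z) is reached by some datum, but z may lie in its compact set, where the restriction
is blind. The identity theorem on the strip without the poles recovers the value. -/
theorem injective_pi_restrictL (hΩ : IsOpen Ω) (hR : IsAsymptoticType Ω R) {b : ℕ → Datum Ω R}
    (hb : Exhausting b) :
    Function.Injective (LinearMap.pi fun n => (b n).restrictL E hR) := by
  intro f f' hff
  refine Subtype.ext (funext fun y => ext_fn fun z hz => ?_)
  obtain ⟨n, hy, hzS⟩ := exists_mem_of_exhausting hΩ hb y z
  have ho := (b n).isOpen_S_diff_proj hR ⟨y, hy⟩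
  refine (b n).eq_of_eq_off_compact hR ⟨y, hy⟩ le_rfl le_rfl (b n).isCompact_Kb
    (fn_holOn_diff _ ho) (fn_holOn_diff _ ho) (fun x hx hxK => ?_) z ⟨hzS, hz⟩
  have h1 := congrFun (congrFun (congrArg Subtype.val (congrFun hff n)) ⟨y, hy⟩) ⟨x, hx.1, hxK⟩
  change (b n).restrict f.1 _ _ = (b n).restrict f'.1 _ _ at h1
  rwa [Datum.restrict_apply, Datum.restrict_apply] at h1

/-- Compatible families of elements of the non-direct sums are given by an element of the space of
smooth families of meromorphic functions. -/
theorem exists_restrict_eq (hΩ : IsOpen Ω) (hR : IsAsymptoticType Ω R) {b : ℕ → Datum Ω R}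
    (hb : Exhausting b) (w : ∀ n, (b n).sumSpace E)
    (hw : ∀ n m (y : EuclideanSpace ℝ (Fin q)) (hn : y ∈ (b n).U) (hm : y ∈ (b m).U) (z : ℂ)
      (hzn : z ∈ (b n).S \ (b n).Kb) (hzm : z ∈ (b m).S \ (b m).Kb),
      (w n).1 ⟨y, hn⟩ ⟨z, hzn⟩ = (w m).1 ⟨y, hm⟩ ⟨z, hzm⟩) :
    ∃ f : MSpace E Ω R, ∀ n, (b n).restrictL E hR f = w n := by
  choose F hF hFw using fun n => (b n).exists_holOn_of_mem_sumSpace hR (w n).2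
  have hcomp : ∀ n m (y : EuclideanSpace ℝ (Fin q)) (hn : y ∈ (b n).U) (hm : y ∈ (b m).U),
      ∀ z ∈ (b n).S, z ∈ (b m).S → z ∉ proj (R y) → F n ⟨y, hn⟩ z = F m ⟨y, hm⟩ z := by
    intro n m y hn hm z hzn hzm hz
    have hsub : ∀ x ∈ strip (max (b n).c (b m).c) (min (b n).c' (b m).c'),
        x ∈ (b n).S ∧ x ∈ (b m).S := fun x hx =>
      ⟨⟨(le_max_left _ _).trans_lt hx.1, hx.2.trans_le (min_le_left _ _)⟩,
        ⟨(le_max_right _ _).trans_lt hx.1, hx.2.trans_le (min_le_right _ _)⟩⟩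
    refine (b n).eq_of_eq_off_compact hR ⟨y, hn⟩ (le_max_left _ _) (min_le_left _ _)
      ((b n).isCompact_Kb.union (b m).isCompact_Kb)
      ((hF n ⟨y, hn⟩).mono fun x hx => ⟨(hsub x hx.1).1, hx.2⟩)
      ((hF m ⟨y, hm⟩).mono fun x hx => ⟨(hsub x hx.1).2, hx.2⟩) (fun x hx hxK => ?_) z
      ⟨⟨max_lt hzn.1 hzm.1, lt_min hzn.2 hzm.2⟩, hz⟩
    have h1 : x ∈ (b n).S \ (b n).Kb := ⟨(hsub x hx.1).1, fun h => hxK (Or.inl h)⟩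
    have h2 : x ∈ (b m).S \ (b m).Kb := ⟨(hsub x hx.1).2, fun h => hxK (Or.inr h)⟩
    exact (hFw n ⟨y, hn⟩ ⟨x, h1⟩).trans ((hw n m y hn hm x h1 h2).trans
      (hFw m ⟨y, hm⟩ ⟨x, h2⟩).symm)
  choose N hNy hNz using exists_mem_of_exhausting hΩ hb
  -- The index depends on (y, z); `hcomp` shows that off the poles any other admissible index gives
  -- the same value, so u is locally one of the extensions F n.
  let u : Ω → ℂ → E := fun y z => F (N y z) ⟨y, hNy y z⟩ z
  have hu : ∀ n (y : Ω) (hy : (y : EuclideanSpace ℝ (Fin q)) ∈ (b n).U), ∀ z ∈ (b n).S,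
      z ∉ proj (R y) → u y z = F n ⟨y, hy⟩ z := fun n y hy z hz hzp =>
    hcomp _ _ _ _ _ z (hNz y z) hz hzp
  have hhol : ∀ y : Ω, HolOn (u y) (proj (R y))ᶜ := fun y => by
    refine HolOn.of_local fun z hz => ?_
    obtain ⟨n, hy, hzS⟩ := exists_mem_of_exhausting hΩ hb y z
    exact ⟨_, (b n).isOpen_S_diff_proj hR ⟨y, hy⟩, ⟨hzS, hz⟩,
      (hF n ⟨y, hy⟩).congr fun x hx => hu n y hy x hx.1 hx.2⟩
  let f : ∀ y : Ω, Hol E (proj (R y))ᶜ := fun y => (hhol y).toHol (isOpen_compl_proj hΩ hR hb y)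
  have hf : ∀ n, (b n).restrict f = (w n).1 := by
    intro n
    funext y z
    have hz := (b n).not_mem_proj y.2 z.2
    rw [Datum.restrict_apply, HolOn.fn_toHol _ _ hz, hu n ⟨y, (b n).mem_Ω y.2⟩ y.2 z z.2.1 hz]
    exact hFw n y z
  exact ⟨⟨f, mem_MSpace_of_restrict hΩ hR hb fun n => by rw [hf n]; exact (w n).2⟩,
    fun n => Subtype.ext (hf n)⟩

/-- The image in the countable product consists exactly of the families that agree pointwise on
overlaps. These are equations between continuous evaluations, so the image is closed. -/
theorem frechetSpace_iInf_induced_restrictL (hΩ : IsOpen Ω) (hR : IsAsymptoticType Ω R)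
    {b : ℕ → Datum Ω R} (hb : Exhausting b) :
    @FrechetSpace (MSpace E Ω R) _ _
      (⨅ n, ((b n).sumTopology E).induced ((b n).restrictL E hR)) := by
  let _ : ∀ n, TopologicalSpace ((b n).sumSpace E) := fun n => (b n).sumTopology E
  have : ∀ n, FrechetSpace ((b n).sumSpace E) := fun n => (b n).frechetSpace_sumSpace hR
  refine FrechetSpace.iInf_induced (fun n => (b n).restrictL E hR)
    (injective_pi_restrictL hΩ hR hb) ?_
  have key : range (LinearMap.pi fun n => (b n).restrictL E hR) =
      ⋂ (n) (m) (y : EuclideanSpace ℝ (Fin q)) (hn : y ∈ (b n).U) (hm : y ∈ (b m).U) (z : ℂ)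
        (hzn : z ∈ (b n).S \ (b n).Kb) (hzm : z ∈ (b m).S \ (b m).Kb),
        {w : ∀ n, (b n).sumSpace E | (w n).1 ⟨y, hn⟩ ⟨z, hzn⟩ = (w m).1 ⟨y, hm⟩ ⟨z, hzm⟩} := by
    ext w
    simp only [mem_iInter, mem_ofPred_eq]
    constructor
    · rintro ⟨f, rfl⟩ n m y hn hm z hzn hzm
      rfl
    · intro h
      obtain ⟨f, hf⟩ := exists_restrict_eq hΩ hR hb w h
      exact ⟨f, funext hf⟩
  rw [key]
  refine isClosed_iInter fun n => isClosed_iInter fun m => isClosed_iInter fun y =>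
    isClosed_iInter fun hn => isClosed_iInter fun hm => isClosed_iInter fun z =>
    isClosed_iInter fun hzn => isClosed_iInter fun hzm => isClosed_eq ?_ ?_
  · exact ((b n).continuous_sumSpace_apply ⟨y, hn⟩ ⟨z, hzn⟩).comp (continuous_apply n)
  · exact ((b m).continuous_sumSpace_apply ⟨y, hm⟩ ⟨z, hzm⟩).comp (continuous_apply m)

/-- The closed graph theorem, applied with some `b n` that dominates d. The graph is described by
evaluations at points off both compact sets; by the identity theorem these determine the element of
`d.sumSpace E`. -/
theorem iInf_induced_le (hΩ : IsOpen Ω) (hR : IsAsymptoticType Ω R)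
    {b : ℕ → Datum Ω R} (hb : Exhausting b) (d : Datum Ω R) :
    (⨅ n, ((b n).sumTopology E).induced ((b n).restrictL E hR)) ≤
      (d.sumTopology E).induced (d.restrictL E hR) := by
  have hM := frechetSpace_iInf_induced_restrictL (E := E) hΩ hR hb
  have hd := d.frechetSpace_sumSpace (E := E) hR
  obtain ⟨n, h1, h2, h3⟩ := hb d.c d.c' d.U d.lt d.U_mem
  have hn : @Continuous _ _ (⨅ n, ((b n).sumTopology E).induced ((b n).restrictL E hR))
      ((b n).sumTopology E) ((b n).restrictL E hR) :=
    continuous_iff_le_induced.2 (iInf_le _ n)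
  let _ : TopologicalSpace (MSpace E Ω R) :=
    ⨅ n, ((b n).sumTopology E).induced ((b n).restrictL E hR)
  let _ : TopologicalSpace (d.sumSpace E) := d.sumTopology E
  let _ : TopologicalSpace ((b n).sumSpace E) := (b n).sumTopology E
  have hS : d.S ⊆ (b n).S := fun z hz => ⟨h1.trans_lt hz.1, hz.2.trans_le h2⟩
  refine continuous_iff_le_induced.1 (FrechetSpace.continuous_of_isClosed_graph _ ?_)
  have key : ((d.restrictL E hR).graph : Set (MSpace E Ω R × d.sumSpace E)) =
      ⋂ (y : EuclideanSpace ℝ (Fin q)) (hy : y ∈ d.U) (z : ℂ) (hz : z ∈ d.S \ d.Kb)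
        (hzn : z ∈ (b n).S \ (b n).Kb),
        {x | x.2.1 ⟨y, hy⟩ ⟨z, hz⟩ = ((b n).restrictL E hR x.1).1 ⟨y, h3 hy⟩ ⟨z, hzn⟩} := by
    ext ⟨f, w⟩
    simp only [mem_iInter, mem_ofPred_eq, SetLike.mem_coe, LinearMap.mem_graph_iff]
    constructor
    · rintro rfl y hy z hz hzn
      rfl
    · intro h
      refine Subtype.ext (funext fun y => funext fun z => ?_)
      obtain ⟨F, hF, hFw⟩ := d.exists_holOn_of_mem_sumSpace hR w.2 y
      have hz : (z : ℂ) ∈ d.S \ proj (R y) := ⟨z.2.1, d.not_mem_proj y.2 z.2⟩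
      change w.1 y z = d.restrict f.1 y z
      rw [← hFw, Datum.restrict_apply]
      refine d.eq_of_eq_off_compact hR y le_rfl le_rfl (d.isCompact_Kb.union (b n).isCompact_Kb) hF
        (fn_holOn_diff _ (d.isOpen_S_diff_proj hR y)) (fun x hx hxK => ?_) z hz
      have k1 : x ∈ d.S \ d.Kb := ⟨hx.1, fun h => hxK (Or.inl h)⟩
      have k2 : x ∈ (b n).S \ (b n).Kb := ⟨hS hx.1, fun h => hxK (Or.inr h)⟩
      have k3 := h y y.2 x k1 k2
      change _ = (b n).restrict f.1 _ _ at k3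
      rw [Datum.restrict_apply] at k3
      exact (hFw ⟨x, k1⟩).trans k3
  rw [key]
  refine isClosed_iInter fun y => isClosed_iInter fun hy => isClosed_iInter fun z =>
    isClosed_iInter fun hz => isClosed_iInter fun hzn => isClosed_eq ?_ ?_
  · exact (d.continuous_sumSpace_apply ⟨y, hy⟩ ⟨z, hz⟩).comp continuous_snd
  · exact ((b n).continuous_sumSpace_apply ⟨y, h3 hy⟩ ⟨z, hzn⟩).comp (hn.comp continuous_fst)

theorem iInf_induced_eq (hΩ : IsOpen Ω) (hR : IsAsymptoticType Ω R)
    {b : ℕ → Datum Ω R} (hb : Exhausting b) :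
    (⨅ d : Datum Ω R, (d.sumTopology E).induced (d.restrictL E hR)) =
      ⨅ n, ((b n).sumTopology E).induced ((b n).restrictL E hR) :=
  le_antisymm (le_iInf fun n => iInf_le _ (b n)) (le_iInf fun d => iInf_induced_le hΩ hR hb d)

end Mellin

theorem mainTheorem8 {q : ℕ} {Ω : Set (EuclideanSpace ℝ (Fin q))} (hΩ : IsOpen Ω)
    {E : Type*} [AddCommGroup E] [Module ℂ E] [TopologicalSpace E] [FrechetSpace E]
    (R : EuclideanSpace ℝ (Fin q) → Set (ℂ × ℕ)) (hR : Mellin.IsAsymptoticType Ω R) :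
    -- the asymptotic part is a closed subspace, and it and the non-direct sum are Fréchet spaces
    (∀ b : Mellin.Datum Ω R,
      IsClosed (b.merPart E : Set (Mellin.CInf (Mellin.Hol E b.Kbᶜ) b.U)) ∧
      FrechetSpace (Mellin.CInf (Mellin.Hol E b.S) b.U) ∧
      FrechetSpace (b.merPart E) ∧
      @FrechetSpace (b.sumSpace E) _ _ (b.sumTopology E)) ∧
    -- every element of the space restricts to an element of each non-direct sum
    ∃ r : ∀ b : Mellin.Datum Ω R, Mellin.MSpace E Ω R →ₗ[ℂ] b.sumSpace E,
      (∀ (b : Mellin.Datum Ω R) (f : Mellin.MSpace E Ω R), (r b f : b.U → ↥(b.S \ b.Kb) → E)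
        = b.restrict f.1) ∧
      -- the initial topology with respect to all these restrictions is a Fréchet topology
      @FrechetSpace (Mellin.MSpace E Ω R) _ _
        (⨅ b : Mellin.Datum Ω R, (b.sumTopology E).induced (r b)) ∧
      -- it is the topology of the intersection over any exhausting sequence
      (∃ b : ℕ → Mellin.Datum Ω R, Mellin.Exhausting b) ∧
      ∀ b : ℕ → Mellin.Datum Ω R, Mellin.Exhausting b →
        (∀ f : ∀ y : Ω, Mellin.Hol E (Mellin.proj (R y))ᶜ,
          f ∈ Mellin.MSpace E Ω R ↔ ∀ n, (b n).restrict f ∈ (b n).sumSpace E) ∧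
        (⨅ d : Mellin.Datum Ω R, (d.sumTopology E).induced (r d)) =
          ⨅ n, ((b n).sumTopology E).induced (r (b n)) := by
  obtain ⟨b₀, hb₀⟩ := Mellin.exists_exhausting hΩ hR
  refine ⟨fun b => ⟨b.isClosed_merPart hR, b.frechetSpace_holPart, b.frechetSpace_merPart hR,
    b.frechetSpace_sumSpace hR⟩, fun b => b.restrictL E hR, fun b f => rfl, ?_, ⟨b₀, hb₀⟩,
    fun b hb => ⟨fun f => ⟨fun hf n => (b n).restrict_mem_sumSpace hR hf,
      Mellin.mem_MSpace_of_restrict hΩ hR hb⟩, Mellin.iInf_induced_eq hΩ hR hb⟩⟩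
  -- The family of all data need not be countable; one exhausting sequence reduces the claim to a
  -- countable product.
  rw [Mellin.iInf_induced_eq hΩ hR hb₀]
  exact Mellin.frechetSpace_iInf_induced_restrictL hΩ hR hb₀
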